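/- Let $G$ be the two-fold cover of $\mathrm{SL}_2(\mathbb{Q}_2)$: the set $\mathrm{SL}_2(\mathbb{Q}_2)\times\{\pm1\}$ with multiplication $(g_1,\epsilon_1)(g_2,\epsilon_2)=(g_1g_2,\epsilon_1\epsilon_2\sigma(g_1,g_2))$, where, for $g=\begin{pmatrix}a&b\\c&d\end{pmatrix}$ and the Hilbert symbol $(\cdot,\cdot)$ of $\mathbb{Q}_2$, one puts $x(g)=c$ if $c\ne0$ and $x(g)=d$ if $c=0$; $s(g)=(c,d)$ if $cd\neq0$ and $\mathrm{ord}(c)$ is odd, and $s(g)=1$ otherwise; and $$\sigma(g_1,g_2)=(x(g_1g_2)x(g_1),\,x(g_1g_2)x(g_2))\,s(g_1)s(g_2)s(g_1g_2).$$ Let $x(u)=\left(\begin{pmatrix}1&u\\0&1\end{pmatrix},1\right)$, $w(t)=\left(\begin{pmatrix}0&t\\-t^{-1}&0\end{pmatrix},1\right)$, $h(t)=\left(\begin{pmatrix}t&0\\0&t^{-1}\end{pmatrix},1\right)$. Let $K\supset K_0$ be the inverse images in $G$ of $\mathrm{SL}_2(\mathbb{Z}_2)$ and of its subgroup defined by $c\in4\mathbb{Z}_2$,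 let $K_1$ be the set of $(g,1)$ with $g\in\mathrm{SL}_2(\mathbb{Z}_2)$, $a\in1+4\mathbb{Z}_2$, $c\in4\mathbb{Z}_2$, and let $M$ be the center of $G$ (the inverse image of $\{\pm1\}$), so that $K_0=M\times K_1$. Let $\gamma$ be a genuine character of $M$ (that is, $\gamma(-1)=-1$ for $-1\in\mu_2$). Extend it to $K_0$ trivially on $K_1$, and to the torus $T$ generated by the $h(t)$ so that it is trivial on $K_1\cap T$ and $\gamma(h(2^n))=1$ for all $n\in\mathbb{Z}$; write $\gamma(t)=\gamma(h(t))$ and $\zeta=(1+\gamma(-1))/\sqrt2$. For $s\in\mathbb{C}$ let $I(\gamma,s)$ be the space of smooth functions $\phi:G\to\mathbb{C}$ with $\phi(\epsilon x(u)h(t)g)=\epsilon\gamma(t)|t|^{s+1}\phi(g)$ for $\epsilon\in\mu_2$, $u\in\mathbb{Q}_2$, $t\in\mathbb{Q}_2^\times$. For $\phi\in I(\gamma,s)$ put $$(M(s)\phi)(g)=\int_{\mathbb{Q}_2}\phi(w(1)x(u)g)\,du,$$ where $du$ is the Haar measure with $\mathrm{vol}(\mathbb{Z}_2)=1$. Let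 $d_2=1$ and $d_{-1}=-2$. **Proposition.** For every $s\in\mathbb{C}$ and $j\in\{2,-1\}$ there is a unique $\phi_j=\phi_{j,s}\in I(\gamma,s)$ whose restriction to $K$ is given by $\phi_j(k)=d_j\gamma(k)$ for $k\in K_0$, $\phi_j(k_0w(1)k_0')=2^{-1/2}\zeta\gamma(k_0k_0')$ for $k_0,k_0'\in K_0$, and $\phi_j=0$ elsewhere on $K$. If $\mathrm{Re}(s)>0$, then the integrals defining $M(s)\phi_{j,s}$ converge absolutely and $$M(s)\phi_{2,s}=\frac{\zeta}{\sqrt2}\left(\frac{1-\frac12 2^{-2s}}{1-2^{-2s}}\right)\phi_{2,-s},\qquad M(s)\phi_{-1,s}=-\frac{\zeta}{2\sqrt2}\left(\frac{1-2\cdot2^{-2s}}{1-2^{-2s}}\right)\phi_{-1,-s}.$$ Moreover, for each $g\in G$ and each $j$ the function $s\mapsto(M(s)\phi_{j,s})(g)$ on $\mathrm{Re}(s)>0$ has a meromorphic continuation to $\mathbb{C}$, holomorphic where $2^{-2s}\ne1$, and at all $s$ with $2^{-2s}\neq1$ the same formulas hold with $(M(s)\phi_{j,s})(g)$ understood as the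 value of this continuation. -/

import Mathlib

open MeasureTheory
open scoped MatrixGroups

noncomputable section

namespace Metaplectic

open scoped Classical in
/-- The Hilbert symbol over `ℚ₂` (for nonzero `a`, `b`): it is `1` if `z² = a x² + b y²` has a
nontrivial solution and `-1` otherwise. -/
def hilbert (a b : ℚ_[2]) : ℤˣ :=
  if ∃ x y z : ℚ_[2], (x ≠ 0 ∨ y ≠ 0 ∨ z ≠ 0) ∧ z ^ 2 = a * x ^ 2 + b * y ^ 2 then 1 else -1

open scoped Classical in
/-- `x(g) = c` if `c ≠ 0`, and `x(g) = d` if `c = 0`. -/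
def xEntry (g : SL(2, ℚ_[2])) : ℚ_[2] :=
  if g 1 0 ≠ 0 then g 1 0 else g 1 1

open scoped Classical in
/-- `s(g) = (c, d)` if `cd ≠ 0` and `ord(c)` is odd, and `s(g) = 1` otherwise. -/
def sSign (g : SL(2, ℚ_[2])) : ℤˣ :=
  if g 1 0 * g 1 1 ≠ 0 ∧ Odd (g 1 0).valuation then hilbert (g 1 0) (g 1 1) else 1

/-- The cocycle `σ(g₁, g₂) = (x(g₁g₂) x(g₁), x(g₁g₂) x(g₂)) s(g₁) s(g₂) s(g₁g₂)`. -/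
def cocycle (g₁ g₂ : SL(2, ℚ_[2])) : ℤˣ :=
  hilbert (xEntry (g₁ * g₂) * xEntry g₁) (xEntry (g₁ * g₂) * xEntry g₂) *
    sSign g₁ * sSign g₂ * sSign (g₁ * g₂)

/-- The two-fold cover `G` of `SL₂(ℚ₂)`: the set `SL₂(ℚ₂) × {±1}`, with the multiplication
twisted by the cocycle `σ`. -/
@[ext] structure Mp where
  mat : SL(2, ℚ_[2])
  sign : ℤˣ

instance : Mul Mp where
  mul g₁ g₂ := ⟨g₁.mat * g₂.mat, g₁.sign * g₂.sign * cocycle g₁.mat g₂.mat⟩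

/-- The section `g ↦ (g, 1)`. -/
def sec (g : SL(2, ℚ_[2])) : Mp := ⟨g, 1⟩

/-- The element `ε ∈ μ₂ ⊆ G`. -/
def mu (ε : ℤˣ) : Mp := ⟨1, ε⟩

def x (u : ℚ_[2]) : Mp := sec ⟨!![1, u; 0, 1], by simp [Matrix.det_fin_two]⟩

def w (t : ℚ_[2]ˣ) : Mp :=
  sec ⟨!![0, (t : ℚ_[2]); -((t⁻¹ : ℚ_[2]ˣ) : ℚ_[2]), 0], by simp [Matrix.det_fin_two]⟩

def h (t : ℚ_[2]ˣ) : Mp :=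
  sec ⟨!![(t : ℚ_[2]), 0; 0, ((t⁻¹ : ℚ_[2]ˣ) : ℚ_[2])], by simp [Matrix.det_fin_two]⟩

/-- The center `M` of `G`, i.e. the inverse image of `{±1}`. -/
def M : Set Mp := {m | m.mat = 1 ∨ m.mat = -1}

/-- `K` is the inverse image of `SL₂(ℤ₂)`. -/
def K : Set Mp := {k | ∀ i j, ‖k.mat i j‖ ≤ 1}

/-- `K₀` is the inverse image of the matrices in `SL₂(ℤ₂)` with `c ∈ 4ℤ₂`. -/
def K₀ : Set Mp := {k | k ∈ K ∧ ‖k.mat 1 0‖ ≤ 1 / 4}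

/-- `K₁ = K₁(4)` consists of the `(g, 1)` with `g ∈ SL₂(ℤ₂)`, `a ∈ 1 + 4ℤ₂` and `c ∈ 4ℤ₂`. -/
def K₁ : Set Mp := {k | k ∈ K ∧ ‖k.mat 0 0 - 1‖ ≤ 1 / 4 ∧ ‖k.mat 1 0‖ ≤ 1 / 4 ∧ k.sign = 1}

/-- The principal congruence subgroup of `SL₂(ℤ₂)` of level `2ⁿ`. -/
def principalCongruence (n : ℕ) : Set SL(2, ℚ_[2]) :=
  {g | ∀ i j, ‖g i j - (1 : Matrix (Fin 2) (Fin 2) ℚ_[2]) i j‖ ≤ (2 : ℝ)⁻¹ ^ n}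

/-- `γ` is a genuine character of the center `M` (only its values on `M` are relevant). -/
def IsGenuineCentralCharacter (γ : Mp → ℂ) : Prop :=
  (∀ m ∈ M, ∀ m' ∈ M, γ (m * m') = γ m * γ m') ∧ γ (mu (-1)) = -1

open scoped Classical in
/-- The extension of `γ` from `M` to `K₀ = M × K₁` which is trivial on `K₁`: its value at
`m k₁` is `γ m`. (Outside `K₀` it is set to be `0`.) -/
def charK₀ (γ : Mp → ℂ) (k : Mp) : ℂ :=
  if hk : ∃ m : Mp, m ∈ M ∧ ∃ k₁ ∈ K₁, m * k₁ = k then γ hk.choose else 0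

/-- The element `2 ∈ ℚ₂ˣ`. -/
def two : ℚ_[2]ˣ := Units.mk0 2 two_ne_zero

/-- The value at `h(t)` of the extension of `γ` to the torus that is trivial on the
intersection with `K₁` and on all `h(2ⁿ)`. For `t = 2ⁿ v` with `v` a unit of `ℤ₂`, one has
`h(t) = (2ⁿ, v) h(2ⁿ) h(v)`, where `h(v) ∈ K₀`. -/
def charT (γ : Mp → ℂ) (t : ℚ_[2]ˣ) : ℂ :=
  let n : ℤ := (t : ℚ_[2]).valuation
  let v : ℚ_[2]ˣ := t * (two ^ n)⁻¹
  ((hilbert ((two ^ n : ℚ_[2]ˣ) : ℚ_[2]) (v : ℚ_[2]) : ℤ) : ℂ) * charK₀ γ (h v)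

/-- `ζ = (1 + γ(-1)) / √2`, where `γ(-1) = γ(h(-1))`. -/
def zeta (γ : Mp → ℂ) : ℂ := (1 + γ (h (-1))) / (Real.sqrt 2 : ℂ)

/-- The normalized principal series `I(γ, s)`: the smooth `φ : G → ℂ` with
`φ(ε x(u) h(t) g) = ε γ(t) |t|^{s+1} φ(g)`. Smooth means invariant under right translation by
an open subgroup; the images under the section of the principal congruence subgroups of level
`2ⁿ`, `n ≥ 2`, are a basis of neighbourhoods of the identity of `G`. -/
def principalSeries (γ : Mp → ℂ) (s : ℂ) : Submodule ℂ (Mp → ℂ) where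
  carrier := {φ |
    (∃ n : ℕ, ∀ k ∈ principalCongruence n, ∀ g : Mp, φ (g * sec k) = φ g) ∧
    ∀ (ε : ℤˣ) (u : ℚ_[2]) (t : ℚ_[2]ˣ) (g : Mp),
      φ (mu ε * x u * h t * g) =
        ((ε : ℤ) : ℂ) * charT γ t * ((‖(t : ℚ_[2])‖ : ℝ) : ℂ) ^ (s + 1) * φ g}
  zero_mem' := ⟨⟨0, fun _ _ _ => rfl⟩, fun _ _ _ _ => by simp⟩
  add_mem' := by
    have mono : ∀ {m n : ℕ}, m ≤ n → principalCongruence n ⊆ principalCongruence m :=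
      fun hmn _ hg i j => (hg i j).trans
        (pow_le_pow_of_le_one (by norm_num) (by norm_num) hmn)
    rintro φ ψ ⟨⟨m, hm⟩, hφ⟩ ⟨⟨n, hn⟩, hψ⟩
    refine ⟨⟨max m n, fun k hk g => ?_⟩, fun ε u t g => ?_⟩
    · simp only [Pi.add_apply]
      rw [hm k (mono (le_max_left m n) hk), hn k (mono (le_max_right m n) hk)]
    · simp only [Pi.add_apply]
      rw [hφ, hψ]
      ring
  smul_mem' := by
    rintro c φ ⟨⟨n, hn⟩, hφ⟩
    refine ⟨⟨n, fun k hk g => ?_⟩, fun ε u t g => ?_⟩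
    · simp only [Pi.smul_apply]
      rw [hn k hk]
    · simp only [Pi.smul_apply, smul_eq_mul]
      rw [hφ]
      ring

/-- `φ` is a vector of `I(γ, s)` whose restriction to `K` is `d γ(k)` on `K₀`,
`2^{-1/2} ζ γ(k₀ k₀')` at `k₀ w(1) k₀'` for `k₀, k₀' ∈ K₀`, and `0` elsewhere on `K`. -/
def IsPhi (γ : Mp → ℂ) (s d : ℂ) (φ : Mp → ℂ) : Prop :=
  φ ∈ principalSeries γ s ∧
  (∀ k ∈ K₀, φ k = d * charK₀ γ k) ∧
  (∀ k ∈ K₀, ∀ k' ∈ K₀,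
    φ (k * w 1 * k') = (Real.sqrt 2 : ℂ)⁻¹ * zeta γ * charK₀ γ (k * k')) ∧
  (∀ k ∈ K, k ∉ K₀ → (¬ ∃ k₀ ∈ K₀, ∃ k₀' ∈ K₀, k = k₀ * w 1 * k₀') → φ k = 0)

/-- The vector `φ` characterized by `IsPhi γ s d`. -/
def phi (γ : Mp → ℂ) (s d : ℂ) : Mp → ℂ := Classical.epsilon (IsPhi γ s d)

/-- The vector `φ₂ ∈ I(γ, s)`, with `d₂ = 1`. -/
def phiTwo (γ : Mp → ℂ) (s : ℂ) : Mp → ℂ := phi γ s 1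

/-- The vector `φ₋₁ ∈ I(γ, s)`, with `d₋₁ = -2`. -/
def phiNegOne (γ : Mp → ℂ) (s : ℂ) : Mp → ℂ := phi γ s (-2)

/-- The integrand of the intertwining operator at `g`, as a function of `u ∈ ℚ₂`. -/
def integrand (φ : Mp → ℂ) (g : Mp) (u : ℚ_[2]) : ℂ := φ (w 1 * x u * g)

/-- The intertwining integral `(M(s) φ)(g) = ∫_{ℚ₂} φ(w(1) x(u) g) du`, for `φ ∈ I(γ, s)`. -/
def intertwining [MeasurableSpace ℚ_[2]] (μ : Measure ℚ_[2]) (φ : Mp → ℂ) (g : Mp) : ℂ :=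
  ∫ u, integrand φ g u ∂μ

/-- The scalar `(ζ/√2) (1 - ½ 2^{-2s}) / (1 - 2^{-2s})`. -/
def scalarTwo (γ : Mp → ℂ) (s : ℂ) : ℂ :=
  zeta γ / (Real.sqrt 2 : ℂ) *
    ((1 - 1 / 2 * (2 : ℂ) ^ (-2 * s)) / (1 - (2 : ℂ) ^ (-2 * s)))

/-- The scalar `-(ζ/(2√2)) (1 - 2 · 2^{-2s}) / (1 - 2^{-2s})`. -/
def scalarNegOne (γ : Mp → ℂ) (s : ℂ) : ℂ :=
  -(zeta γ / (2 * (Real.sqrt 2 : ℂ))) *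
    ((1 - 2 * (2 : ℂ) ^ (-2 * s)) / (1 - (2 : ℂ) ^ (-2 * s)))

/-- For the family `s ↦ Φ s ∈ I(γ, s)`: the function `F` is the meromorphic continuation, from
`Re s > 0` to the whole plane, of `s ↦ (M(s) Φ_s)(g)`, and it is holomorphic away from the points
with `2^{-2s} = 1`. -/
def IsContinuation [MeasurableSpace ℚ_[2]] (μ : Measure ℚ_[2]) (Φ : ℂ → Mp → ℂ) (g : Mp)
    (F : ℂ → ℂ) : Prop :=
  MeromorphicOn F Set.univ ∧
  DifferentiableOn ℂ F {s | (2 : ℂ) ^ (-2 * s) ≠ 1} ∧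
  ∀ s : ℂ, 0 < s.re → F s = intertwining μ (Φ s) g

end Metaplectic

end

open MeasureTheory
open scoped MatrixGroups

noncomputable section

namespace Metaplectic

/-! ### Square classes of `ℚ₂` -/

/-! Write i = `γ (h (-1))`. Since (-1, -1) = -1 over ℚ₂, genuineness forces i² = -1, and the
extension of γ to the torus becomes a function χ on ℚ₂ˣ with χ(ab) = (a, b) χ(a) χ(b)
(`torusChar_mul`). The group law on the cover rests on bilinearity of the Hilbert symbol, reduced to
a finite table of square classes, and on the Steinberg relation applied to c₁₂ c₂₃ = c₂ c₁₂₃ + c₁ c₃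
for lower left entries (`kubota_mul`).

The vectors are written down explicitly. Up to the sign `twist`, `phiFun` is a function of the
bottom row (c, d) of the matrix: one formula when c/d ∈ 4ℤ₂, another when d/c ∈ ℤ₂, and zero when
|c| = |d|/2. These are the three double cosets of the Borel subgroup and K₀, represented by 1, w(1)
and `lower 2`. Equivariance under the Borel subgroup on the left and under K₀ on the right
(`phiFun_borel`, `phiFun_mul_of_mem_K₀`) follows from symbol identities; uniqueness is the Iwasawa
decomposition.

M(s)φ has the same two equivariances with s replaced by -s, so three values determine it
(`intertwining_eq_smul`). At `lower 2` it vanishes, because x(1) acts trivially on the left but is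
conjugated into K₀ with character value different from 1. At 1 and w(1) the integral is cut into
shells |u| = 2ⁿ. For odd n, χ(-u) integrates to 0 because (2, 5) = -1; for even n, pairing u with -u
gives (1 + i) 2ⁿ / 4. The tails are geometric series in q = 2^{-2s}, and for a vector with value d
at 1 and ζ/√2 = (1 + i)/2 at w(1), M(s)φ(1) = (1 + i)/2 · (1 + (d/2) q/(1 - q)) and M(s)φ(w(1)) =
(i/4)(d + 1/(1 - q)). Proportionality to (d, (1 + i)/2) amounts to d² + d - 2 = 0, independently of
s; hence d = 1 or d = -2. The continuation is then visible on the formulas, the value of `phiFun` at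
a fixed g being entire in s. -/

lemma norm_two : ‖(2 : ℚ_[2])‖ = 1 / 2 := by
  have := Padic.norm_p (p := 2)
  norm_num at this ⊢
  exact this

/-- Hensel's lemma for X² - v at the approximate root 1: |1 - v| ≤ 1/8 is smaller than |2|² = 1/4.
-/
lemma exists_sq_of_norm_sub_one_le {v : ℚ_[2]} (hv : ‖v - 1‖ ≤ 1 / 8) :
    ∃ r : ℚ_[2], r ≠ 0 ∧ v = r ^ 2 := by
  have hv1 : ‖v‖ ≤ 1 := by
    have := Padic.nonarchimedean (v - 1) 1
    simp only [sub_add_cancel, norm_one] at this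
    exact this.trans (max_le (by linarith) le_rfl)
  have hv0 : v ≠ 0 := by
    rintro rfl
    norm_num at hv
  let V : ℤ_[2] := ⟨v, hv1⟩
  have key := hensels_lemma (p := 2) (R := ℤ_[2]) (F := (Polynomial.X ^ 2 - Polynomial.C V))
    (a := 1) (by
      simp only [map_sub, map_pow, Polynomial.aeval_X, Polynomial.aeval_C,
        Polynomial.derivative_X_pow, Polynomial.derivative_C, one_pow]
      rw [PadicInt.norm_def, PadicInt.norm_def]
      have h1 : (((1 : ℤ_[2]) - (algebraMap ℤ_[2] ℤ_[2]) V : ℤ_[2]) : ℚ_[2]) = -(v - 1) := by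
        rw [neg_sub]; rfl
      rw [h1, norm_neg]
      have h2 : ‖((((Polynomial.aeval (1 : ℤ_[2])) (Polynomial.C ((2 : ℕ) : ℤ_[2]) *
        Polynomial.X ^ (2 - 1)) -
        (Polynomial.aeval (1 : ℤ_[2])) (0 : Polynomial ℤ_[2]) : ℤ_[2])) : ℚ_[2])‖ = 1 / 2 := by
        rw [← norm_two]
        simp
        try rfl
      rw [h2]
      exact lt_of_le_of_lt hv (by norm_num))
  obtain ⟨z, hz, -⟩ := key
  simp only [map_sub, map_pow, Polynomial.aeval_X, Polynomial.aeval_C] at hz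
  have hz' : v = (z : ℚ_[2]) ^ 2 := by
    have := congrArg (fun y : ℤ_[2] => (y : ℚ_[2])) hz
    simp only [PadicInt.coe_sub, PadicInt.coe_pow, PadicInt.coe_zero, sub_eq_zero] at this
    exact this.symm
  refine ⟨z, ?_, hz'⟩
  rintro h0
  rw [h0] at hz'
  simp [hv0] at hz'

lemma exists_nat_norm_sub_le {v : ℚ_[2]} (hv : ‖v‖ ≤ 1) (n : ℕ) :
    ∃ m : ℕ, m < 2 ^ n ∧ ‖v - (m : ℚ_[2])‖ ≤ (1 / 2) ^ n := by
  let V : ℤ_[2] := ⟨v, hv⟩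
  refine ⟨V.appr n, V.appr_lt n, ?_⟩
  have h := V.appr_spec n
  have h2 := (PadicInt.norm_le_pow_iff_mem_span_pow (V - (V.appr n : ℤ_[2])) n).2 h
  rw [PadicInt.norm_def] at h2
  have e : (((V - (V.appr n : ℤ_[2]) : ℤ_[2])) : ℚ_[2]) = v - (V.appr n : ℚ_[2]) := rfl
  rw [e] at h2
  refine h2.trans (le_of_eq ?_)
  simp

lemma norm_odd {m : ℤ} (hm : m % 2 = 1) : ‖(m : ℚ_[2])‖ = 1 := by
  rw [Padic.norm_intCast_eq_one_iff]
  refine Int.isCoprime_iff_gcd_eq_one.2 ?_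
  rw [Int.gcd_comm]
  have := Int.isCoprime_iff_gcd_eq_one.1 (show IsCoprime m 2 from ⟨1, -(m/2), by omega⟩)
  simpa [Int.gcd_comm] using this

lemma norm_int_le {m : ℤ} (n : ℕ) (hm : (2 ^ n : ℤ) ∣ m) : ‖(m : ℚ_[2])‖ ≤ (1 / 2) ^ n := by
  have := (Padic.norm_int_le_pow_iff_dvd (p := 2) m n).2 (by exact_mod_cast hm)
  refine this.trans (le_of_eq ?_)
  simp

/-- An odd integer `m ≡ v mod 8` represents the square class of the unit `v`. -/
lemma exists_sq_of_norm_sub_int_le {v : ℚ_[2]} {m : ℤ} (hm : m % 2 = 1)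
    (hv : ‖v - m‖ ≤ 1 / 8) : ∃ r : ℚ_[2], r ≠ 0 ∧ v = m * r ^ 2 := by
  have h1 := norm_odd hm
  have h0 : (m : ℚ_[2]) ≠ 0 := by
    intro h
    simp [h] at h1
  obtain ⟨r, hr, h⟩ := exists_sq_of_norm_sub_one_le (v := v / m) (by
    rw [div_sub_one h0, norm_div, h1]
    simpa using hv)
  exact ⟨r, hr, by rw [← h]; field_simp⟩

lemma norm_eq_one_odd {v : ℚ_[2]} (hv : ‖v‖ = 1) :
    ∃ m : ℕ, m < 8 ∧ m % 2 = 1 ∧ ‖v - (m : ℚ_[2])‖ ≤ 1 / 8 := by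
  obtain ⟨m, hm, h⟩ := exists_nat_norm_sub_le hv.le 3
  norm_num at h hm
  refine ⟨m, hm, ?_, by norm_num; exact h⟩
  by_contra hodd
  have h2 : ‖(m : ℚ_[2])‖ ≤ 1 / 2 := by
    simpa using norm_int_le (m := m) 1 (by omega)
  have := Padic.nonarchimedean (v - (m : ℚ_[2])) m
  rw [sub_add_cancel, hv] at this
  rcases le_max_iff.1 this with h' | h' <;> linarith

/-- The integer `(-1)ⁱ 5ʲ 2ᵏ`; these represent the square classes of `ℚ₂`. -/
def rep (i j k : ℕ) : ℤ := (-1) ^ i * 5 ^ j * 2 ^ k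

lemma rep_ne_zero (i j k : ℕ) : ((rep i j k : ℤ) : ℚ_[2]) ≠ 0 := by
  simp [rep]

lemma exists_rep_unit {v : ℚ_[2]} (hv : ‖v‖ = 1) :
    ∃ i j : ℕ, ∃ r : ℚ_[2], r ≠ 0 ∧ v = rep i j 0 * r ^ 2 := by
  obtain ⟨m, hm8, hm, h⟩ := norm_eq_one_odd hv
  have key : ∀ i j : ℕ, (8 : ℤ) ∣ m - rep i j 0 → rep i j 0 % 2 = 1 →
      ∃ i j : ℕ, ∃ r : ℚ_[2], r ≠ 0 ∧ v = rep i j 0 * r ^ 2 := by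
    intro i j hd ho
    refine ⟨i, j, exists_sq_of_norm_sub_int_le ho ?_⟩
    have h3 := norm_int_le 3 hd
    have := Padic.nonarchimedean (v - (m : ℚ_[2])) ((m - rep i j 0 : ℤ) : ℚ_[2])
    have e : v - m + ((m - rep i j 0 : ℤ) : ℚ_[2]) = v - rep i j 0 := by push_cast; ring
    rw [e] at this
    exact this.trans (max_le h (by norm_num at h3 ⊢; exact h3))
  have : m = 1 ∨ m = 3 ∨ m = 5 ∨ m = 7 := by omega
  -- Modulo 8 the classes 1, 3, 5, 7 are those of 1, -5, 5, -1.
  rcases this with rfl | rfl | rfl | rfl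
  · exact key 0 0 (by decide) (by decide)
  · exact key 1 1 (by decide) (by decide)
  · exact key 0 1 (by decide) (by decide)
  · exact key 1 0 (by decide) (by decide)

lemma norm_mul_two_zpow {a : ℚ_[2]} (ha : a ≠ 0) : ‖a * 2 ^ (-a.valuation)‖ = 1 := by
  rw [norm_mul, Padic.norm_eq_zpow_neg_valuation ha, norm_zpow, norm_two]
  rw [one_div, inv_zpow, Nat.cast_ofNat]
  exact mul_inv_cancel₀ (by positivity)

lemma exists_rep {a : ℚ_[2]} (ha : a ≠ 0) :
    ∃ i j k : ℕ, ∃ r : ℚ_[2], r ≠ 0 ∧ a = rep i j k * r ^ 2 := by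
  obtain ⟨i, j, r, hr, h⟩ := exists_rep_unit (norm_mul_two_zpow ha)
  obtain ⟨e, he⟩ : ∃ e : ℤ, a.valuation = 2 * e + (a.valuation % 2).toNat :=
    ⟨a.valuation / 2, by omega⟩
  have h2 : (2 : ℚ_[2]) ≠ 0 := two_ne_zero
  refine ⟨i, j, (a.valuation % 2).toNat, r * 2 ^ e, mul_ne_zero hr (zpow_ne_zero _ h2), ?_⟩
  generalize (a.valuation % 2).toNat = k at he ⊢
  have : a = a * 2 ^ (-a.valuation) * 2 ^ a.valuation := by
    rw [mul_assoc, ← zpow_add₀ h2]; simp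
  have h3 : (2 : ℚ_[2]) ^ a.valuation = (2 ^ e) ^ 2 * 2 ^ k := by
    rw [he, zpow_add₀ h2, zpow_natCast, mul_comm 2 e, zpow_mul, zpow_ofNat]
  rw [this, h, h3]
  simp only [rep]
  push_cast
  ring

/-! ### The Hilbert symbol of `ℚ₂` -/

lemma hilbert_comm (a b : ℚ_[2]) : hilbert a b = hilbert b a := by
  unfold hilbert
  congr 1
  refine propext ⟨?_, ?_⟩ <;>
  · rintro ⟨x, y, z, h, e⟩
    exact ⟨y, x, z, by tauto, by rw [e]; ring⟩

lemma hilbert_eq_one_of {a b x y z : ℚ_[2]} (h : x ≠ 0 ∨ y ≠ 0 ∨ z ≠ 0)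
    (e : z ^ 2 = a * x ^ 2 + b * y ^ 2) : hilbert a b = 1 := if_pos ⟨x, y, z, h, e⟩

lemma hilbert_mul_sq_left (a b : ℚ_[2]) {r : ℚ_[2]} (hr : r ≠ 0) :
    hilbert (a * r ^ 2) b = hilbert a b := by
  unfold hilbert
  congr 1
  refine propext ⟨?_, ?_⟩
  · rintro ⟨x, y, z, h, e⟩
    refine ⟨r * x, y, z, ?_, by rw [e]; ring⟩
    simpa [hr] using h
  · rintro ⟨x, y, z, h, e⟩
    refine ⟨r⁻¹ * x, y, z, ?_, by rw [e]; field_simp⟩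
    simpa [hr] using h

lemma hilbert_mul_sq_right (a b : ℚ_[2]) {r : ℚ_[2]} (hr : r ≠ 0) :
    hilbert a (b * r ^ 2) = hilbert a b := by
  rw [hilbert_comm, hilbert_mul_sq_left _ _ hr, hilbert_comm]

/-- A primitive solution of a ternary form exists as soon as there is a solution. -/
lemma exists_primitive {a b : ℚ_[2]}
    (h : ∃ x y z : ℚ_[2], (x ≠ 0 ∨ y ≠ 0 ∨ z ≠ 0) ∧ z ^ 2 = a * x ^ 2 + b * y ^ 2) :
    ∃ x y z : ℚ_[2], ‖x‖ ≤ 1 ∧ ‖y‖ ≤ 1 ∧ ‖z‖ ≤ 1 ∧ (‖x‖ = 1 ∨ ‖y‖ = 1 ∨ ‖z‖ = 1) ∧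
      z ^ 2 = a * x ^ 2 + b * y ^ 2 := by
  obtain ⟨x, y, z, h0, e⟩ := h
  obtain ⟨m, hm0, hx, hy, hz, hm⟩ : ∃ m : ℚ_[2], m ≠ 0 ∧ ‖x‖ ≤ ‖m‖ ∧ ‖y‖ ≤ ‖m‖ ∧ ‖z‖ ≤ ‖m‖ ∧
      (x = m ∨ y = m ∨ z = m) := by
    rcases le_total ‖x‖ ‖y‖ with h1 | h1 <;> rcases le_total ‖x‖ ‖z‖ with h2 | h2 <;>
      rcases le_total ‖y‖ ‖z‖ with h3 | h3
    · refine ⟨z, ?_, h2, h3, le_rfl, by simp⟩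
      rintro rfl
      clear e
      simp_all
    · refine ⟨y, ?_, h1, le_rfl, h3, by simp⟩
      rintro rfl
      clear e
      simp_all
    · refine ⟨z, ?_, h1.trans h3, h3, le_rfl, by simp⟩
      rintro rfl
      clear e
      simp_all
    · refine ⟨y, ?_, h1, le_rfl, h3, by simp⟩
      rintro rfl
      clear e
      simp_all
    · refine ⟨z, ?_, h2, h3, le_rfl, by simp⟩
      rintro rfl
      clear e
      simp_all
    · refine ⟨x, ?_, le_rfl, h1, h3.trans h1, by simp⟩
      rintro rfl
      clear e
      simp_all
    · refine ⟨x, ?_, le_rfl, h1, h2, by simp⟩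
      rintro rfl
      clear e
      simp_all
    · refine ⟨x, ?_, le_rfl, h1, h2, by simp⟩
      rintro rfl
      clear e
      simp_all
  have hpos : 0 < ‖m‖ := norm_pos_iff.2 hm0
  refine ⟨x / m, y / m, z / m, ?_, ?_, ?_, ?_, ?_⟩
  · rw [norm_div]; exact div_le_one_of_le₀ hx hpos.le
  · rw [norm_div]; exact div_le_one_of_le₀ hy hpos.le
  · rw [norm_div]; exact div_le_one_of_le₀ hz hpos.le
  · rcases hm with rfl | rfl | rfl <;> simp [hm0]
  · rw [div_pow, div_pow, div_pow, e]; ring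

lemma exists_sq_mod_sixteen {x : ℚ_[2]} (hx : ‖x‖ ≤ 1) :
    ∃ S ∈ ({0, 1, 4, 9} : Finset ℤ), ‖x ^ 2 - S‖ ≤ 1 / 16 ∧ (‖x‖ = 1 → S % 2 = 1) := by
  obtain ⟨m, hm8, h⟩ := exists_nat_norm_sub_le hx 3
  -- Knowing x modulo 8 determines x² modulo 16: in (x - m)((x - m) + 2m) the second factor is even.
  have hsq : ‖x ^ 2 - (m : ℚ_[2]) ^ 2‖ ≤ 1 / 16 := by
    have e : x ^ 2 - (m : ℚ_[2]) ^ 2 = (x - (m : ℚ_[2])) * ((x - (m : ℚ_[2])) + 2 * m) := by ring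
    have h2 : ‖(x - (m : ℚ_[2])) + 2 * (m : ℚ_[2])‖ ≤ 1 / 2 := by
      refine (Padic.nonarchimedean _ _).trans (max_le (h.trans (by norm_num)) ?_)
      rw [norm_mul, norm_two]
      have := Padic.norm_int_le_one (p := 2) m
      simp only [Int.cast_natCast] at this
      linarith
    rw [e, norm_mul]
    calc _ ≤ (1 / 2 : ℝ) ^ 3 * (1 / 2) := by gcongr
      _ = _ := by norm_num
  have key : ∀ S : ℤ, S ∈ ({0, 1, 4, 9} : Finset ℤ) → (16 : ℤ) ∣ m ^ 2 - S →
      ((m : ℤ) % 2 = 1 → S % 2 = 1) →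
      ∃ S ∈ ({0, 1, 4, 9} : Finset ℤ), ‖x ^ 2 - S‖ ≤ 1 / 16 ∧ (‖x‖ = 1 → S % 2 = 1) := by
    intro S hS hd ho
    refine ⟨S, hS, ?_, fun h1 => ho ?_⟩
    · have h4 := norm_int_le 4 hd
      have := Padic.nonarchimedean (x ^ 2 - (m : ℚ_[2]) ^ 2) ((m ^ 2 - S : ℤ) : ℚ_[2])
      have e : x ^ 2 - (m : ℚ_[2]) ^ 2 + ((m ^ 2 - S : ℤ) : ℚ_[2]) = x ^ 2 - S := by
        push_cast; ring
      rw [e] at this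
      exact this.trans (max_le hsq (by norm_num at h4 ⊢; exact h4))
    · by_contra hodd
      have h2 : ‖(m : ℚ_[2])‖ ≤ 1 / 2 := by
        simpa using norm_int_le (m := m) 1 (by omega)
      have := Padic.nonarchimedean (x - (m : ℚ_[2])) m
      rw [sub_add_cancel, h1] at this
      norm_num at h
      rcases le_max_iff.1 this with h' | h' <;> linarith
  norm_num at hm8
  interval_cases m
  · exact key 0 (by decide) (by decide) (by decide)
  · exact key 1 (by decide) (by decide) (by decide)
  · exact key 4 (by decide) (by decide) (by decide)
  · exact key 9 (by decide) (by decide) (by decide)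
  · exact key 0 (by decide) (by decide) (by decide)
  · exact key 9 (by decide) (by decide) (by decide)
  · exact key 4 (by decide) (by decide) (by decide)
  · exact key 1 (by decide) (by decide) (by decide)

/-- If a form with integral coefficients has a nontrivial zero, it has a primitive zero
modulo `16`. -/
lemma exists_solution_mod_sixteen {a b : ℤ} (h : hilbert a b = 1) :
    ∃ X ∈ ({0, 1, 4, 9} : Finset ℤ), ∃ Y ∈ ({0, 1, 4, 9} : Finset ℤ),
      ∃ Z ∈ ({0, 1, 4, 9} : Finset ℤ), (X % 2 = 1 ∨ Y % 2 = 1 ∨ Z % 2 = 1) ∧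
        (a * X + b * Y - Z) % 16 = 0 := by
  have h' : ∃ x y z : ℚ_[2], (x ≠ 0 ∨ y ≠ 0 ∨ z ≠ 0) ∧ z ^ 2 = a * x ^ 2 + b * y ^ 2 := by
    by_contra hn
    rw [hilbert, if_neg hn] at h
    exact absurd h (by decide)
  obtain ⟨x, y, z, hx, hy, hz, hp, e⟩ := exists_primitive h'
  obtain ⟨X, hX, hX1, hX2⟩ := exists_sq_mod_sixteen hx
  obtain ⟨Y, hY, hY1, hY2⟩ := exists_sq_mod_sixteen hy
  obtain ⟨Z, hZ, hZ1, hZ2⟩ := exists_sq_mod_sixteen hz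
  refine ⟨X, hX, Y, hY, Z, hZ, by tauto, ?_⟩
  have hn : ‖((a * X + b * Y - Z : ℤ) : ℚ_[2])‖ ≤ 1 / 16 := by
    have e2 : ((a * X + b * Y - Z : ℤ) : ℚ_[2]) =
        (z ^ 2 - Z) + (-(a * (x ^ 2 - X)) + -(b * (y ^ 2 - Y))) := by
      push_cast; rw [e]; ring
    rw [e2]
    refine (Padic.nonarchimedean _ _).trans (max_le hZ1 ((Padic.nonarchimedean _ _).trans
      (max_le ?_ ?_)))
    · rw [norm_neg, norm_mul]
      have := Padic.norm_int_le_one (p := 2) a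
      nlinarith [norm_nonneg (x ^ 2 - (X : ℚ_[2]))]
    · rw [norm_neg, norm_mul]
      have := Padic.norm_int_le_one (p := 2) b
      nlinarith [norm_nonneg (y ^ 2 - (Y : ℚ_[2]))]
  have := (Padic.norm_int_le_pow_iff_dvd (p := 2) (a * X + b * Y - Z) 4).1
    (hn.trans (by norm_num))
  norm_num at this
  omega

/-- The form takes the value 4^m (1 + 8q), which is a square in ℚ₂. This turns solvability into a
congruence that can be decided. -/
lemma hilbert_eq_one_of_int {a b x y : ℤ} (m : ℕ)
    (h : (a * x ^ 2 + b * y ^ 2) % (8 * 4 ^ m) = 4 ^ m) : hilbert a b = 1 := by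
  obtain ⟨q, hq⟩ : ∃ q : ℤ, a * x ^ 2 + b * y ^ 2 = 4 ^ m * (1 + 8 * q) :=
    ⟨(a * x ^ 2 + b * y ^ 2) / (8 * 4 ^ m), by
      have := Int.emod_add_mul_ediv (a * x ^ 2 + b * y ^ 2) (8 * 4 ^ m)
      rw [h] at this
      linarith⟩
  obtain ⟨r, hr, e⟩ := exists_sq_of_norm_sub_one_le (v := ((1 + 8 * q : ℤ) : ℚ_[2])) (by
    have := norm_int_le (m := 8 * q) 3 ⟨q, by ring⟩
    norm_num at this
    push_cast
    norm_num
    exact this)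
  refine hilbert_eq_one_of (x := x) (y := y) (z := 2 ^ m * r)
    (Or.inr (Or.inr (mul_ne_zero (pow_ne_zero _ two_ne_zero) hr))) ?_
  have := congrArg (fun z : ℤ => (z : ℚ_[2])) hq
  rw [Int.cast_mul, e] at this
  push_cast at this
  rw [this, mul_pow, ← pow_mul, mul_comm m 2, pow_mul]
  norm_num

/-- A certificate for each of the 64 pairs of square classes. When the exponent is even there is a
small integral solution, or the form is hyperbolic; when it is odd there is no primitive solution
modulo 16. -/
lemma hilbert_rep_table : ∀ i j k i' j' k' : Fin 2,
    ((i * i' + j * k' + k * j' : ℕ) % 2 = 0 ∧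
      ((∃ x y : Fin 4, ∃ m : Fin 3, (rep i j k * x ^ 2 + rep i' j' k' * y ^ 2 : ℤ) %
        (8 * 4 ^ (m : ℕ)) = 4 ^ (m : ℕ)) ∨ rep i j k + rep i' j' k' = 0)) ∨
    ((i * i' + j * k' + k * j' : ℕ) % 2 = 1 ∧
      ¬ ∃ X ∈ ({0, 1, 4, 9} : Finset ℤ), ∃ Y ∈ ({0, 1, 4, 9} : Finset ℤ),
      ∃ Z ∈ ({0, 1, 4, 9} : Finset ℤ), (X % 2 = 1 ∨ Y % 2 = 1 ∨ Z % 2 = 1) ∧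
        (rep i j k * X + rep i' j' k' * Y - Z) % 16 = 0) := by
  decide +kernel

lemma hilbert_rep_fin (i j k i' j' k' : Fin 2) :
    hilbert (rep i j k) (rep i' j' k') = (-1) ^ (i * i' + j * k' + k * j' : ℕ) := by
  rcases hilbert_rep_table i j k i' j' k' with ⟨hp, h⟩ | ⟨hp, h⟩
  · rw [Even.neg_one_pow (Nat.even_iff.2 hp)]
    rcases h with ⟨x, y, m, h⟩ | h
    · exact hilbert_eq_one_of_int m h
    · refine hilbert_eq_one_of (x := 1) (y := 1) (z := 0) (by simp) ?_
      have := congrArg (fun z : ℤ => (z : ℚ_[2])) h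
      push_cast at this
      linear_combination -this
  · rw [Odd.neg_one_pow (Nat.odd_iff.2 hp)]
    rcases Int.units_eq_one_or (hilbert (rep i j k) (rep i' j' k')) with h' | h'
    · exact absurd (exists_solution_mod_sixteen h') h
    · exact h'

lemma rep_add_two (i j k : ℕ) (i' j' k' : ℕ) :
    ((rep (i + 2 * i') (j + 2 * j') (k + 2 * k') : ℤ) : ℚ_[2]) =
      rep i j k * (rep i' j' k' : ℚ_[2]) ^ 2 := by
  simp only [rep]
  push_cast
  ring

lemma rep_mod_two (i j k : ℕ) :
    ((rep i j k : ℤ) : ℚ_[2]) =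
      rep (i % 2) (j % 2) (k % 2) * (rep (i / 2) (j / 2) (k / 2) : ℚ_[2]) ^ 2 := by
  rw [← rep_add_two, Nat.mod_add_div, Nat.mod_add_div, Nat.mod_add_div]

/-- On exponents the symbol is a bilinear form over 𝔽₂. Bilinearity of the symbol and all the
special values used later are read off from it. -/
lemma hilbert_rep (i j k i' j' k' : ℕ) :
    hilbert (rep i j k) (rep i' j' k') = (-1) ^ (i * i' + j * k' + k * j') := by
  rw [rep_mod_two i j k, rep_mod_two i' j' k', hilbert_mul_sq_left _ _ (rep_ne_zero _ _ _),
    hilbert_mul_sq_right _ _ (rep_ne_zero _ _ _)]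
  have h := hilbert_rep_fin ⟨i % 2, Nat.mod_lt _ two_pos⟩ ⟨j % 2, Nat.mod_lt _ two_pos⟩
    ⟨k % 2, Nat.mod_lt _ two_pos⟩ ⟨i' % 2, Nat.mod_lt _ two_pos⟩ ⟨j' % 2, Nat.mod_lt _ two_pos⟩
    ⟨k' % 2, Nat.mod_lt _ two_pos⟩
  rw [h, Int.units_pow_eq_pow_mod_two, Int.units_pow_eq_pow_mod_two _ (i * i' + j * k' + k * j')]
  congr 1
  simp [Nat.add_mod, Nat.mul_mod]

lemma rep_mul (i j k i' j' k' : ℕ) :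
    ((rep i j k : ℤ) : ℚ_[2]) * (rep i' j' k' : ℤ) = (rep (i + i') (j + j') (k + k') : ℤ) := by
  simp only [rep]
  push_cast
  ring

lemma hilbert_mul_left {a a' b : ℚ_[2]} (ha : a ≠ 0) (ha' : a' ≠ 0) (hb : b ≠ 0) :
    hilbert (a * a') b = hilbert a b * hilbert a' b := by
  obtain ⟨i, j, k, r, hr, rfl⟩ := exists_rep ha
  obtain ⟨i', j', k', r', hr', rfl⟩ := exists_rep ha'
  obtain ⟨i'', j'', k'', r'', hr'', rfl⟩ := exists_rep hb
  have e : (rep i j k : ℚ_[2]) * r ^ 2 * ((rep i' j' k' : ℚ_[2]) * r' ^ 2) =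
      rep (i + i') (j + j') (k + k') * (r * r') ^ 2 := by
    rw [← rep_mul]; ring
  rw [e]
  simp only [hilbert_mul_sq_right _ _ hr'', hilbert_mul_sq_left _ _ hr,
    hilbert_mul_sq_left _ _ hr', hilbert_mul_sq_left _ _ (mul_ne_zero hr hr'), hilbert_rep]
  rw [← pow_add]
  congr 1
  ring

lemma hilbert_mul_right {a b b' : ℚ_[2]} (ha : a ≠ 0) (hb : b ≠ 0) (hb' : b' ≠ 0) :
    hilbert a (b * b') = hilbert a b * hilbert a b' := by
  rw [hilbert_comm, hilbert_mul_left hb hb' ha, hilbert_comm b, hilbert_comm b']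

lemma hilbert_neg_self (a : ℚ_[2]) : hilbert a (-a) = 1 :=
  hilbert_eq_one_of (x := 1) (y := 1) (z := 0) (by simp) (by ring)

lemma hilbert_of_add_eq_one {a b : ℚ_[2]} (h : a + b = 1) : hilbert a b = 1 :=
  hilbert_eq_one_of (x := 1) (y := 1) (z := 1) (by simp) (by linear_combination -h)

lemma hilbert_sq_left (r : ℚ_[2]) (b : ℚ_[2]) : hilbert (r ^ 2) b = 1 :=
  hilbert_eq_one_of (x := 1) (y := 0) (z := r) (by simp) (by ring)

lemma hilbert_one_left (b : ℚ_[2]) : hilbert 1 b = 1 := by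
  simpa using hilbert_sq_left 1 b

lemma hilbert_one_right (b : ℚ_[2]) : hilbert b 1 = 1 := by
  rw [hilbert_comm, hilbert_one_left]

lemma hilbert_self {a : ℚ_[2]} (ha : a ≠ 0) : hilbert a a = hilbert a (-1) := by
  have := hilbert_mul_right ha (neg_ne_zero.2 ha) (neg_ne_zero.2 one_ne_zero)
  rw [hilbert_neg_self] at this
  simpa using this

lemma hilbert_inv_left (a b : ℚ_[2]) : hilbert a⁻¹ b = hilbert a b := by
  rcases eq_or_ne a 0 with rfl | ha
  · simp
  · rw [← hilbert_mul_sq_left a⁻¹ b ha]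
    congr 1
    field_simp

lemma hilbert_inv_right (a b : ℚ_[2]) : hilbert a b⁻¹ = hilbert a b := by
  rw [hilbert_comm, hilbert_inv_left, hilbert_comm]

/-- The quotients B/A and C/A add up to 1, and they differ from BA and CA by the square A². -/
lemma hilbert_steinberg_mul {A B C : ℚ_[2]} (hA : A ≠ 0) (h : A = B + C) :
    hilbert (B * A) (C * A) = 1 := by
  have := hilbert_of_add_eq_one (a := B / A) (b := C / A) (by rw [← add_div, ← h, div_self hA])
  rw [← hilbert_mul_sq_left _ _ hA, ← hilbert_mul_sq_right _ _ hA] at this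
  convert this using 2 <;> field_simp

/-- The Steinberg relation in the form used for the cocycle identity. -/
lemma hilbert_steinberg {A B C : ℚ_[2]} (hA : A ≠ 0) (hB : B ≠ 0) (hC : C ≠ 0) (h : A = B + C) :
    hilbert A (-(B * C)) * hilbert B C = 1 := by
  have h1 := hilbert_steinberg_mul hA h
  rw [hilbert_mul_left hB hA (mul_ne_zero hC hA), hilbert_mul_right hB hC hA,
    hilbert_mul_right hA hC hA, hilbert_self hA, hilbert_comm B A] at h1
  rw [show -(B * C) = B * C * (-1) by ring, hilbert_mul_right hA (mul_ne_zero hB hC) (by simp),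
    hilbert_mul_right hA hB hC, ← h1]
  ac_rfl

lemma hilbert_neg_one_neg_one : hilbert (-1) (-1) = -1 := by
  simpa [rep] using hilbert_rep 1 0 0 1 0 0

lemma hilbert_two_five : hilbert 2 5 = -1 := by
  simpa [rep] using hilbert_rep 0 0 1 0 1 0

lemma hilbert_two_two : hilbert 2 2 = 1 := by
  simpa [rep] using hilbert_rep 0 0 1 0 0 1

lemma exists_rep_of_norm_sub_one_le {u : ℚ_[2]} (hu : ‖u - 1‖ ≤ 1 / 4) :
    ∃ j : ℕ, ∃ r : ℚ_[2], r ≠ 0 ∧ u = rep 0 j 0 * r ^ 2 := by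
  have hu1 : ‖u‖ = 1 := by
    have := Padic.norm_eq_of_norm_sub_lt_right (z1 := u) (z2 := 1) (by
      rw [norm_one]; linarith)
    simpa using this
  obtain ⟨m, hm8, hm, h⟩ := norm_eq_one_odd hu1
  have h4 : (4 : ℤ) ∣ m - 1 := by
    have := Padic.nonarchimedean (u - 1) (-(u - (m : ℚ_[2])))
    have e : u - 1 + -(u - (m : ℚ_[2])) = ((m - 1 : ℤ) : ℚ_[2]) := by push_cast; ring
    rw [e, norm_neg] at this
    have h5 := (Padic.norm_int_le_pow_iff_dvd (p := 2) (m - 1 : ℤ) 2).1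
      (this.trans (max_le (hu.trans (by norm_num)) (h.trans (by norm_num))))
    simpa using h5
  have h15 : m = 1 ∨ m = 5 := by omega
  rcases h15 with rfl | rfl
  · obtain ⟨r, hr, e⟩ := exists_sq_of_norm_sub_int_le (m := 1) (by decide) (by simpa using h)
    exact ⟨0, r, hr, by simpa [rep] using e⟩
  · obtain ⟨r, hr, e⟩ := exists_sq_of_norm_sub_int_le (m := 5) (by decide) (by simpa using h)
    exact ⟨1, r, hr, by simpa [rep] using e⟩

/-- Up to squares u is a power of 5, and 5 pairs nontrivially only with classes of odd valuation. -/
lemma hilbert_unit_eq_one {u v : ℚ_[2]} (hu : ‖u - 1‖ ≤ 1 / 4) (hv : ‖v‖ = 1) :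
    hilbert u v = 1 := by
  obtain ⟨j, r, hr, rfl⟩ := exists_rep_of_norm_sub_one_le hu
  obtain ⟨i', j', r', hr', rfl⟩ := exists_rep_unit hv
  rw [hilbert_mul_sq_left _ _ hr, hilbert_mul_sq_right _ _ hr', hilbert_rep]
  simp

/-- A unit is congruent to `1` or to `-1` modulo `4`. -/
lemma norm_sub_one_or_add_one {v : ℚ_[2]} (hv : ‖v‖ = 1) :
    ‖v - 1‖ ≤ 1 / 4 ∨ ‖v + 1‖ ≤ 1 / 4 := by
  obtain ⟨m, hm8, hm, h⟩ := norm_eq_one_odd hv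
  have : m % 4 = 1 ∨ m % 4 = 3 := by omega
  rcases this with h4 | h4
  · left
    have := Padic.nonarchimedean (v - (m : ℚ_[2])) ((m - 1 : ℤ) : ℚ_[2])
    have e : v - (m : ℚ_[2]) + ((m - 1 : ℤ) : ℚ_[2]) = v - 1 := by push_cast; ring
    rw [e] at this
    refine this.trans (max_le (h.trans (by norm_num)) ?_)
    have := norm_int_le (m := m - 1) 2 (by omega)
    norm_num at this ⊢
    exact this
  · right
    have := Padic.nonarchimedean (v - (m : ℚ_[2])) ((m + 1 : ℤ) : ℚ_[2])
    have e : v - (m : ℚ_[2]) + ((m + 1 : ℤ) : ℚ_[2]) = v + 1 := by push_cast; ring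
    rw [e] at this
    refine this.trans (max_le (h.trans (by norm_num)) ?_)
    have := norm_int_le (m := m + 1) 2 (by omega)
    norm_num at this ⊢
    exact this

lemma not_norm_sub_one_of_norm_add_one {v : ℚ_[2]} (hv : ‖v + 1‖ ≤ 1 / 4) :
    ¬ ‖v - 1‖ ≤ 1 / 4 := by
  intro h
  have := Padic.nonarchimedean (v + 1) (-(v - 1))
  rw [show v + 1 + -(v - 1) = 2 by ring, norm_neg, norm_two] at this
  rcases le_max_iff.1 this with h' | h' <;> linarith

/-- `(e, 1 + b e) = 1` for `e ∈ 4ℤ₂` and `b ∈ ℤ₂`. -/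
lemma hilbert_one_add_mul {e b : ℚ_[2]} (he : ‖e‖ ≤ 1 / 4) (hb : ‖b‖ ≤ 1) (he0 : e ≠ 0) :
    hilbert e (1 + b * e) = 1 := by
  -- Either 1 + be is a square, or |e| is exactly 1/4; in that case e is a unit up to the square 4,
  -- and 1 + be ∈ 1 + 4ℤ₂ pairs trivially with units.
  rcases le_or_gt ‖b * e‖ (1 / 8) with h | h
  · obtain ⟨r, hr, hv⟩ := exists_sq_of_norm_sub_one_le (v := 1 + b * e) (by simpa using h)
    rw [hv, hilbert_comm, hilbert_sq_left]
  · have he4 : ‖e‖ = 1 / 4 := by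
      refine le_antisymm he ?_
      have h1 : 1 / 8 < ‖e‖ := by
        rw [norm_mul] at h
        nlinarith [norm_nonneg e]
      have hv := Padic.norm_eq_zpow_neg_valuation he0
      rw [hv] at h1 ⊢
      have h2 : (2 : ℝ) ^ (-3 : ℤ) < 2 ^ (-e.valuation) := by
        norm_num at h1 ⊢; exact h1
      have h3 := (zpow_lt_zpow_iff_right₀ (by norm_num : (1 : ℝ) < 2)).1 h2
      calc (1 / 4 : ℝ) = 2 ^ (-2 : ℤ) := by norm_num
        _ ≤ _ := by
          rw [Nat.cast_ofNat]
          exact zpow_le_zpow_right₀ (by norm_num) (by omega)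
    have hu : ‖e * (1 / 2) ^ 2‖ = 1 := by
      rw [norm_mul, norm_pow, norm_div, norm_two, he4, norm_one]
      norm_num
    rw [← hilbert_mul_sq_left e _ (r := 1 / 2) (by simp), hilbert_comm]
    refine hilbert_unit_eq_one ?_ hu
    rw [add_sub_cancel_left, norm_mul]
    nlinarith [norm_nonneg b, norm_nonneg e]

/-! ### The group structure on the cover -/

lemma mul_one_zero (g g' : SL(2, ℚ_[2])) :
    (g * g') 1 0 = g 1 0 * g' 0 0 + g 1 1 * g' 1 0 := by
  simp [Matrix.mul_apply, Fin.sum_univ_two]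

lemma mul_one_one (g g' : SL(2, ℚ_[2])) :
    (g * g') 1 1 = g 1 0 * g' 0 1 + g 1 1 * g' 1 1 := by
  simp [Matrix.mul_apply, Fin.sum_univ_two]

lemma mul_zero_zero (g g' : SL(2, ℚ_[2])) :
    (g * g') 0 0 = g 0 0 * g' 0 0 + g 0 1 * g' 1 0 := by
  simp [Matrix.mul_apply, Fin.sum_univ_two]

lemma mul_zero_one (g g' : SL(2, ℚ_[2])) :
    (g * g') 0 1 = g 0 0 * g' 0 1 + g 0 1 * g' 1 1 := by
  simp [Matrix.mul_apply, Fin.sum_univ_two]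

lemma det_eq (g : SL(2, ℚ_[2])) : g 0 0 * g 1 1 - g 0 1 * g 1 0 = 1 := by
  rw [← Matrix.det_fin_two]; exact g.2

lemma xEntry_of_ne {g : SL(2, ℚ_[2])} (h : g 1 0 ≠ 0) : xEntry g = g 1 0 := if_pos h

lemma xEntry_of_eq {g : SL(2, ℚ_[2])} (h : g 1 0 = 0) : xEntry g = g 1 1 := if_neg (by simpa using h)

lemma one_one_ne_zero {g : SL(2, ℚ_[2])} (h : g 1 0 = 0) : g 1 1 ≠ 0 := by
  intro h1
  have := det_eq g
  simp [h, h1] at this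

lemma xEntry_ne_zero (g : SL(2, ℚ_[2])) : xEntry g ≠ 0 := by
  by_cases h : g 1 0 = 0
  · rw [xEntry_of_eq h]; exact one_one_ne_zero h
  · rwa [xEntry_of_ne h]

lemma xEntry_mul_of_left {g : SL(2, ℚ_[2])} (g' : SL(2, ℚ_[2])) (h : g 1 0 = 0) :
    xEntry (g * g') = g 1 1 * xEntry g' := by
  have hd := one_one_ne_zero h
  by_cases h' : g' 1 0 = 0
  · rw [xEntry_of_eq h', xEntry_of_eq (by simp [mul_one_zero, h, h']), mul_one_one, h]
    ring
  · rw [xEntry_of_ne h', xEntry_of_ne (by simp [mul_one_zero, h, h', hd]), mul_one_zero, h]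
    ring

lemma xEntry_mul_of_right (g : SL(2, ℚ_[2])) {g' : SL(2, ℚ_[2])} (h : g' 1 0 = 0) :
    ∃ r : ℚ_[2], r ≠ 0 ∧ xEntry (g * g') = xEntry g * xEntry g' * r ^ 2 := by
  have hd := one_one_ne_zero h
  have hdet : g' 0 0 * g' 1 1 = 1 := by simpa [h] using det_eq g'
  have ha : g' 0 0 ≠ 0 := left_ne_zero_of_mul_eq_one hdet
  by_cases h' : g 1 0 = 0
  · refine ⟨1, one_ne_zero, ?_⟩
    rw [xEntry_mul_of_left _ h', xEntry_of_eq h']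
    ring
  · refine ⟨g' 0 0, ha, ?_⟩
    rw [xEntry_of_ne h', xEntry_of_eq h, xEntry_of_ne (by simp [mul_one_zero, h, h', ha]),
      mul_one_zero, h]
    linear_combination - (g 1 0 * g' 0 0) * hdet

/-- Kubota's cocycle. -/
def kubota (g₁ g₂ : SL(2, ℚ_[2])) : ℤˣ :=
  hilbert (xEntry (g₁ * g₂) * xEntry g₁) (xEntry (g₁ * g₂) * xEntry g₂)

lemma cocycle_eq (g₁ g₂ : SL(2, ℚ_[2])) :
    cocycle g₁ g₂ = kubota g₁ g₂ * sSign g₁ * sSign g₂ * sSign (g₁ * g₂) := rfl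

lemma units_mul_eq_iff {a b : ℤˣ} : a = b ↔ a * b = 1 := by
  rcases Int.units_eq_one_or a with rfl | rfl <;> rcases Int.units_eq_one_or b with rfl | rfl <;>
    decide

/-- This lemma and the next two are degenerate forms of `hilbert_steinberg`. They replace it when
one of the lower left entries in the cocycle identity is zero. -/
lemma hilbert_relation_of_sq_left {A B C r : ℚ_[2]} (hB : B ≠ 0) (hC : C ≠ 0) (hr : r ≠ 0)
    (h : A = B * r ^ 2) : hilbert A (-(B * C)) * hilbert B C = 1 := by
  rw [h, hilbert_mul_sq_left _ _ hr, show -(B * C) = -B * C by ring,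
    hilbert_mul_right hB (neg_ne_zero.2 hB) hC, hilbert_neg_self, one_mul, Int.units_mul_self]

lemma hilbert_relation_of_sq_right {A B C r : ℚ_[2]} (hB : B ≠ 0) (hC : C ≠ 0) (hr : r ≠ 0)
    (h : A = C * r ^ 2) : hilbert A (-(B * C)) * hilbert B C = 1 := by
  rw [mul_comm B C, hilbert_comm B C]
  exact hilbert_relation_of_sq_left hC hB hr h

lemma hilbert_relation_of_neg {A B C : ℚ_[2]} (h : B = -C) :
    hilbert A (-(B * C)) * hilbert B C = 1 := by
  rw [h, hilbert_comm (-C), hilbert_neg_self, hilbert_comm, show -(-C * C) = C ^ 2 by ring,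
    hilbert_sq_left, one_mul]

/-- Expanding everything by bilinearity reduces the cocycle identity to one relation in A = x₁₂ x₂₃,
B = x₂ x, C = x₁ x₃, of Steinberg shape. -/
lemma kubota_relation {x₁ x₂ x₃ x₁₂ x₂₃ x : ℚ_[2]} (h₁ : x₁ ≠ 0) (h₂ : x₂ ≠ 0) (h₃ : x₃ ≠ 0)
    (h₁₂ : x₁₂ ≠ 0) (h₂₃ : x₂₃ ≠ 0) (h : x ≠ 0)
    (hs : hilbert (x₁₂ * x₂₃) (-(x₂ * x * (x₁ * x₃))) * hilbert (x₂ * x) (x₁ * x₃) = 1) :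
    hilbert (x₁₂ * x₁) (x₁₂ * x₂) * hilbert (x * x₁₂) (x * x₃) =
      hilbert (x₂₃ * x₂) (x₂₃ * x₃) * hilbert (x * x₁) (x * x₂₃) := by
  rw [units_mul_eq_iff, ← hs, show -(x₂ * x * (x₁ * x₃)) = -1 * (x₂ * x * (x₁ * x₃)) by ring]
  have hn : (-1 : ℚ_[2]) ≠ 0 := by simp
  simp only [hilbert_mul_left, hilbert_mul_right, hilbert_self, ne_eq, mul_eq_zero, h₁, h₂, h₃,
    h₁₂, h₂₃, h, hn, not_false_eq_true, or_self]
  rw [hilbert_comm x₁ x₁₂, hilbert_comm x₁₂ x, hilbert_comm x₂ x₂₃, hilbert_comm x₁ x,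
    hilbert_comm x₁ x₂₃, hilbert_comm x₂ x₁, hilbert_comm x x₂₃]
  refine Eq.trans ?_ (mul_one _)
  rw [← Int.units_mul_self (hilbert x (-1))]
  ac_rfl

lemma kubota_mul (g₁ g₂ g₃ : SL(2, ℚ_[2])) :
    kubota g₁ g₂ * kubota (g₁ * g₂) g₃ = kubota g₂ g₃ * kubota g₁ (g₂ * g₃) := by
  unfold kubota
  rw [← mul_assoc g₁ g₂ g₃]
  have hx₁ := xEntry_ne_zero g₁
  have hx₂ := xEntry_ne_zero g₂
  have hx₃ := xEntry_ne_zero g₃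
  have hx₁₂ := xEntry_ne_zero (g₁ * g₂)
  have hx₂₃ := xEntry_ne_zero (g₂ * g₃)
  have hx := xEntry_ne_zero (g₁ * g₂ * g₃)
  refine kubota_relation hx₁ hx₂ hx₃ hx₁₂ hx₂₃ hx ?_
  by_cases h₁ : g₁ 1 0 = 0
  · refine hilbert_relation_of_sq_left (r := 1) (by positivity) (by positivity) one_ne_zero ?_
    rw [mul_assoc g₁, xEntry_mul_of_left _ h₁, xEntry_mul_of_left _ h₁]
    ring
  by_cases h₃ : g₃ 1 0 = 0
  · obtain ⟨r, hr, e⟩ := xEntry_mul_of_right g₂ h₃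
    obtain ⟨r', hr', e'⟩ := xEntry_mul_of_right (g₁ * g₂) h₃
    refine hilbert_relation_of_sq_left (r := r / r') (by positivity) (by positivity)
      (by positivity) ?_
    rw [e, e']
    field_simp
  by_cases h₂ : g₂ 1 0 = 0
  · obtain ⟨r, hr, e⟩ := xEntry_mul_of_right g₁ h₂
    refine hilbert_relation_of_sq_right (r := xEntry g₂ * r) (by positivity) (by positivity)
      (by positivity) ?_
    rw [e, xEntry_mul_of_left _ h₂, ← xEntry_of_eq h₂]
    ring
  -- With all three lower left entries nonzero, this identity, a consequence of det g₂ = 1, is the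
  -- relation A = B + C. If an entry of a product vanishes it gives B = -C or A = C instead.
  have key : (g₁ * g₂) 1 0 * (g₂ * g₃) 1 0 =
      g₂ 1 0 * (g₁ * g₂ * g₃) 1 0 + g₁ 1 0 * g₃ 1 0 := by
    simp only [mul_one_zero, mul_one_one]
    linear_combination (g₁ 1 0 * g₃ 1 0) * det_eq g₂
  rw [xEntry_of_ne h₁, xEntry_of_ne h₂, xEntry_of_ne h₃]
  rw [xEntry_of_ne h₁] at hx₁
  rw [xEntry_of_ne h₂] at hx₂
  rw [xEntry_of_ne h₃] at hx₃
  by_cases h₁₂ : (g₁ * g₂) 1 0 = 0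
  · have h : (g₁ * g₂ * g₃) 1 0 ≠ 0 := by
      rw [mul_one_zero _ g₃, h₁₂]
      simpa [h₃] using one_one_ne_zero h₁₂
    refine hilbert_relation_of_neg ?_
    rw [xEntry_of_ne h]
    linear_combination -key + (g₂ * g₃) 1 0 * h₁₂
  by_cases h₂₃ : (g₂ * g₃) 1 0 = 0
  · have h : (g₁ * g₂ * g₃) 1 0 ≠ 0 := by
      intro h0
      rw [h₂₃, h0] at key
      simp [h₁, h₃] at key
    refine hilbert_relation_of_neg ?_
    rw [xEntry_of_ne h]
    linear_combination -key + (g₁ * g₂) 1 0 * h₂₃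
  rw [xEntry_of_ne h₁₂, xEntry_of_ne h₂₃]
  by_cases h : (g₁ * g₂ * g₃) 1 0 = 0
  · refine hilbert_relation_of_sq_right (r := 1) (by positivity) (by positivity) one_ne_zero ?_
    rw [key, h]
    ring
  · rw [xEntry_of_ne h] at hx ⊢
    exact hilbert_steinberg (by positivity) (by positivity) (by positivity) key

/-- The cocycle σ differs from Kubota's by the coboundary of `sSign`. -/
lemma cocycle_mul (g₁ g₂ g₃ : SL(2, ℚ_[2])) :
    cocycle g₁ g₂ * cocycle (g₁ * g₂) g₃ = cocycle g₂ g₃ * cocycle g₁ (g₂ * g₃) := by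
  simp only [cocycle_eq]
  have h := kubota_mul g₁ g₂ g₃
  calc _ = (kubota g₁ g₂ * kubota (g₁ * g₂) g₃) * (sSign (g₁ * g₂) * sSign (g₁ * g₂)) *
        (sSign g₁ * sSign g₂ * sSign g₃ * sSign (g₁ * g₂ * g₃)) := by ac_rfl
    _ = (kubota g₂ g₃ * kubota g₁ (g₂ * g₃)) * (sSign (g₂ * g₃) * sSign (g₂ * g₃)) *
        (sSign g₁ * sSign g₂ * sSign g₃ * sSign (g₁ * (g₂ * g₃))) := by
      rw [h, Int.units_mul_self, Int.units_mul_self, mul_assoc g₁]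
    _ = _ := by ac_rfl

lemma Mp.mul_mat (g g' : Mp) : (g * g').mat = g.mat * g'.mat := rfl

lemma Mp.mul_sign (g g' : Mp) : (g * g').sign = g.sign * g'.sign * cocycle g.mat g'.mat := rfl

lemma sSign_of_eq {g : SL(2, ℚ_[2])} (h : g 1 0 = 0) : sSign g = 1 :=
  if_neg (by simp [h])

lemma sSign_of_even {g : SL(2, ℚ_[2])} (h : Even (g 1 0).valuation) : sSign g = 1 :=
  if_neg (fun h' => (Int.not_odd_iff_even.2 h) h'.2)

lemma sSign_one : sSign 1 = 1 := sSign_of_eq (by simp)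

lemma xEntry_one : xEntry 1 = 1 := by
  rw [xEntry_of_eq (by simp)]; simp

lemma cocycle_one_left (g : SL(2, ℚ_[2])) : cocycle 1 g = 1 := by
  rw [cocycle_eq, kubota, one_mul, xEntry_one, ← sq, hilbert_comm, hilbert_sq_left, sSign_one]
  simp [Int.units_mul_self]

lemma cocycle_one_right (g : SL(2, ℚ_[2])) : cocycle g 1 = 1 := by
  rw [cocycle_eq, kubota, mul_one, xEntry_one, ← sq, hilbert_sq_left, sSign_one]
  simp [Int.units_mul_self]

instance : Group Mp where
  mul_assoc g₁ g₂ g₃ := by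
    refine Mp.ext (mul_assoc _ _ _) ?_
    simp only [Mp.mul_sign, Mp.mul_mat]
    have := cocycle_mul g₁.mat g₂.mat g₃.mat
    calc _ = g₁.sign * g₂.sign * g₃.sign *
          (cocycle g₁.mat g₂.mat * cocycle (g₁.mat * g₂.mat) g₃.mat) := by ac_rfl
      _ = _ := by rw [this]; ac_rfl
  one := ⟨1, 1⟩
  one_mul g := Mp.ext (one_mul _) (by
    change 1 * g.sign * cocycle 1 g.mat = g.sign
    rw [cocycle_one_left]; simp)
  mul_one g := Mp.ext (mul_one _) (by
    change g.sign * 1 * cocycle g.mat 1 = g.sign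
    rw [cocycle_one_right]; simp)
  inv g := ⟨g.mat⁻¹, g.sign * cocycle g.mat⁻¹ g.mat⟩
  inv_mul_cancel g := Mp.ext (inv_mul_cancel _) (by
    change g.sign * cocycle g.mat⁻¹ g.mat * g.sign * cocycle g.mat⁻¹ g.mat = 1
    calc _ = (g.sign * g.sign) * (cocycle g.mat⁻¹ g.mat * cocycle g.mat⁻¹ g.mat) := by ac_rfl
      _ = 1 := by rw [Int.units_mul_self, Int.units_mul_self, one_mul])

lemma Mp.one_mat : (1 : Mp).mat = 1 := rfl

lemma Mp.one_sign : (1 : Mp).sign = 1 := rfl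

lemma Mp.inv_mat (g : Mp) : (g⁻¹).mat = g.mat⁻¹ := rfl

lemma mu_mul (ε : ℤˣ) (g : Mp) : mu ε * g = ⟨g.mat, ε * g.sign⟩ :=
  Mp.ext (one_mul _) (by
    change ε * g.sign * cocycle 1 g.mat = _
    rw [cocycle_one_left, mul_one])

lemma mul_mu (ε : ℤˣ) (g : Mp) : g * mu ε = ⟨g.mat, ε * g.sign⟩ :=
  Mp.ext (mul_one _) (by
    change g.sign * ε * cocycle g.mat 1 = _
    rw [cocycle_one_right, mul_one, mul_comm])

lemma mu_comm (ε : ℤˣ) (g : Mp) : mu ε * g = g * mu ε := by rw [mu_mul, mul_mu]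

lemma mk_eq_mu_mul (g : SL(2, ℚ_[2])) (ε : ℤˣ) : (⟨g, ε⟩ : Mp) = mu ε * sec g := by
  rw [mu_mul]; simp [sec]

lemma mu_one : mu 1 = 1 := rfl

lemma mu_mul_mu (ε ε' : ℤˣ) : mu ε * mu ε' = mu (ε * ε') := mu_mul _ _

lemma eq_mu_mul_of_mat_eq {g g' : Mp} (h : g.mat = g'.mat) : g = mu (g.sign * g'.sign) * g' := by
  rw [mu_mul]
  refine Mp.ext h ?_
  simp [mul_assoc, Int.units_mul_self]

lemma sec_mul_sec (g g' : SL(2, ℚ_[2])) : sec g * sec g' = mu (cocycle g g') * sec (g * g') := by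
  rw [mu_mul]
  refine Mp.ext rfl ?_
  simp [Mp.mul_sign, sec]

/-! ### The genuine character of the torus -/

/-- A sign, seen as a complex number. -/
def cs (ε : ℤˣ) : ℂ := ((ε : ℤ) : ℂ)

lemma cs_mul (ε ε' : ℤˣ) : cs (ε * ε') = cs ε * cs ε' := by simp [cs]

lemma cs_one : cs 1 = 1 := by simp [cs]

lemma cs_neg_one : cs (-1) = -1 := by simp [cs]

lemma cs_mul_self (ε : ℤˣ) : cs ε * cs ε = 1 := by
  rw [← cs_mul, Int.units_mul_self, cs_one]

lemma norm_cs (ε : ℤˣ) : ‖cs ε‖ = 1 := by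
  rcases Int.units_eq_one_or ε with rfl | rfl <;> simp [cs]

lemma cs_pow_four (ε : ℤˣ) : cs ε ^ 4 = 1 := by
  rcases Int.units_eq_one_or ε with rfl | rfl <;> norm_num [cs]

open scoped Classical in
/-- The function on units which is `1` on `1 + 4ℤ₂` and `i` on `-1 + 4ℤ₂`. -/
def unitChar (i : ℂ) (v : ℚ_[2]) : ℂ := if ‖v - 1‖ ≤ 1 / 4 then 1 else i

lemma unitChar_of_one (i : ℂ) {v : ℚ_[2]} (hv : ‖v - 1‖ ≤ 1 / 4) : unitChar i v = 1 := if_pos hv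

lemma unitChar_of_neg_one (i : ℂ) {v : ℚ_[2]} (hv : ‖v + 1‖ ≤ 1 / 4) : unitChar i v = i :=
  if_neg (not_norm_sub_one_of_norm_add_one hv)

/-- The genuine character of the torus, as a function of `a ∈ ℚ₂ˣ`, with value `i` at `-1`. -/
def torusChar (i : ℂ) (a : ℚ_[2]) : ℂ :=
  cs (hilbert (2 ^ a.valuation) (a * 2 ^ (-a.valuation))) * unitChar i (a * 2 ^ (-a.valuation))

lemma valuation_eq_zero {v : ℚ_[2]} (hv : ‖v‖ = 1) : v.valuation = 0 := by
  have hv0 : v ≠ 0 := by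
    rintro rfl
    simp at hv
  rw [Padic.norm_eq_zpow_neg_valuation hv0] at hv
  have := (zpow_eq_one_iff_right₀ (by norm_num) (by norm_num)).1 hv
  omega

lemma ne_zero_of_norm_eq_one {v : ℚ_[2]} (hv : ‖v‖ = 1) : v ≠ 0 := by
  rintro rfl
  simp at hv

lemma valuation_two_zpow_mul (n : ℤ) {v : ℚ_[2]} (hv : ‖v‖ = 1) :
    ((2 : ℚ_[2]) ^ n * v).valuation = n := by
  have h2 : (2 : ℚ_[2]).valuation = 1 := Padic.valuation_p (p := 2)
  rw [Padic.valuation_mul (zpow_ne_zero _ two_ne_zero) (ne_zero_of_norm_eq_one hv),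
    Padic.valuation_zpow, h2, valuation_eq_zero hv]
  simp

lemma exists_eq_two_zpow_mul {a : ℚ_[2]} (ha : a ≠ 0) :
    ∃ (n : ℤ) (v : ℚ_[2]), ‖v‖ = 1 ∧ a = 2 ^ n * v := by
  refine ⟨a.valuation, a * 2 ^ (-a.valuation), norm_mul_two_zpow ha, ?_⟩
  rw [mul_comm a, ← mul_assoc, ← zpow_add₀ two_ne_zero]
  simp

lemma norm_two_zpow_mul (n : ℤ) {v : ℚ_[2]} (hv : ‖v‖ = 1) :
    ‖(2 : ℚ_[2]) ^ n * v‖ = 2 ^ (-n) := by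
  rw [norm_mul, hv, norm_zpow, norm_two, one_div, inv_zpow, mul_one, zpow_neg]

lemma torusChar_two_zpow_mul (i : ℂ) (n : ℤ) {v : ℚ_[2]} (hv : ‖v‖ = 1) :
    torusChar i (2 ^ n * v) = cs (hilbert (2 ^ n) v) * unitChar i v := by
  have e : (2 : ℚ_[2]) ^ n * v * 2 ^ (-n) = v := by
    rw [mul_comm, ← mul_assoc, ← zpow_add₀ two_ne_zero]
    simp
  rw [torusChar, valuation_two_zpow_mul n hv, e]

lemma torusChar_unit (i : ℂ) {v : ℚ_[2]} (hv : ‖v‖ = 1) : torusChar i v = unitChar i v := by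
  have := torusChar_two_zpow_mul i 0 hv
  simpa [hilbert_one_left, cs_one] using this

lemma norm_eq_one_of_norm_sub_one {v : ℚ_[2]} (hv : ‖v - 1‖ ≤ 1 / 4) : ‖v‖ = 1 := by
  have := Padic.norm_eq_of_norm_sub_lt_right (z1 := v) (z2 := 1) (by
    rw [norm_one]; linarith)
  simpa using this

lemma norm_eq_one_of_norm_add_one {v : ℚ_[2]} (hv : ‖v + 1‖ ≤ 1 / 4) : ‖v‖ = 1 := by
  rw [← norm_neg]
  refine norm_eq_one_of_norm_sub_one ?_
  rwa [← norm_neg, neg_sub, sub_neg_eq_add, add_comm]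

lemma torusChar_of_one (i : ℂ) {v : ℚ_[2]} (hv : ‖v - 1‖ ≤ 1 / 4) : torusChar i v = 1 := by
  rw [torusChar_unit i (norm_eq_one_of_norm_sub_one hv), unitChar_of_one i hv]

lemma torusChar_of_neg_one (i : ℂ) {v : ℚ_[2]} (hv : ‖v + 1‖ ≤ 1 / 4) : torusChar i v = i := by
  rw [torusChar_unit i (norm_eq_one_of_norm_add_one hv), unitChar_of_neg_one i hv]

lemma torusChar_one (i : ℂ) : torusChar i 1 = 1 := torusChar_of_one i (by simp)

lemma torusChar_neg_one (i : ℂ) : torusChar i (-1) = i := torusChar_of_neg_one i (by simp)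

lemma norm_mul_sub_one_le {u v : ℚ_[2]} (hu : ‖u - 1‖ ≤ 1 / 4) (hv : ‖v - 1‖ ≤ 1 / 4) :
    ‖u * v - 1‖ ≤ 1 / 4 := by
  rw [show u * v - 1 = u * (v - 1) + (u - 1) by ring]
  refine (Padic.nonarchimedean _ _).trans (max_le ?_ hu)
  rw [norm_mul, norm_eq_one_of_norm_sub_one hu, one_mul]
  exact hv

lemma norm_neg_sub_one {u : ℚ_[2]} : ‖-u - 1‖ = ‖u + 1‖ := by
  rw [← norm_neg]; congr 1; ring

lemma norm_neg_add_one {u : ℚ_[2]} : ‖-u + 1‖ = ‖u - 1‖ := by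
  rw [← norm_neg]; congr 1; ring

lemma hilbert_units_neg_one {u v : ℚ_[2]} (hu : ‖u + 1‖ ≤ 1 / 4) (hv : ‖v + 1‖ ≤ 1 / 4) :
    hilbert u v = -1 := by
  have hu' := norm_eq_one_of_norm_add_one hu
  have hv' := norm_eq_one_of_norm_add_one hv
  have hu0 := ne_zero_of_norm_eq_one hu'
  have hv0 := ne_zero_of_norm_eq_one hv'
  rw [← norm_neg_sub_one] at hu hv
  have h1 := hilbert_unit_eq_one hu hv'
  have h2 := hilbert_unit_eq_one hv (v := -1) (by simp)
  have e1 := hilbert_mul_left (a := -u) (a' := -1) (b := v) (by simpa) (by simp) hv0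
  have e2 := hilbert_mul_left (a := -v) (a' := -1) (b := -1) (by simpa) (by simp) (by simp)
  rw [h2, hilbert_neg_one_neg_one] at e2
  rw [h1, hilbert_comm (-1)] at e1
  simp only [mul_neg, mul_one, neg_neg, one_mul] at e1 e2
  rw [e1, e2]

/-- The symbol is nontrivial only when both units are -1 modulo 4, and there i² = -1 compensates for
it. -/
lemma unitChar_mul {i : ℂ} (hi : i ^ 2 = -1) {u v : ℚ_[2]} (hu : ‖u‖ = 1) (hv : ‖v‖ = 1) :
    unitChar i (u * v) = cs (hilbert u v) * (unitChar i u * unitChar i v) := by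
  rcases norm_sub_one_or_add_one hu with h1 | h1 <;> rcases norm_sub_one_or_add_one hv with h2 | h2
  · rw [unitChar_of_one i h1, unitChar_of_one i h2, hilbert_unit_eq_one h1 hv, cs_one,
      unitChar_of_one i (norm_mul_sub_one_le h1 h2)]
    simp
  · have := norm_mul_sub_one_le h1 (v := -v) (by rwa [norm_neg_sub_one])
    rw [mul_neg, norm_neg_sub_one] at this
    rw [unitChar_of_one i h1, unitChar_of_neg_one i h2, hilbert_unit_eq_one h1 hv, cs_one,
      unitChar_of_neg_one i this]
    simp
  · have := norm_mul_sub_one_le h2 (v := -u) (by rwa [norm_neg_sub_one])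
    rw [mul_neg, norm_neg_sub_one, mul_comm] at this
    rw [unitChar_of_one i h2, unitChar_of_neg_one i h1, hilbert_comm, hilbert_unit_eq_one h2 hu,
      cs_one, unitChar_of_neg_one i this]
    simp
  · have := norm_mul_sub_one_le (u := -u) (v := -v) (by rwa [norm_neg_sub_one])
      (by rwa [norm_neg_sub_one])
    rw [neg_mul_neg] at this
    rw [unitChar_of_neg_one i h2, unitChar_of_neg_one i h1, hilbert_units_neg_one h1 h2,
      cs_neg_one, unitChar_of_one i this]
    linear_combination hi

/-- Because (2, 2) = 1, the cover splits over the powers of 2, so the value 1 may be prescribed at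
all of them. -/
lemma hilbert_two_zpow (m n : ℤ) : hilbert (2 ^ m) (2 ^ n) = 1 := by
  have key : ∀ m : ℤ, ∃ r : ℚ_[2], r ≠ 0 ∧ ((2 : ℚ_[2]) ^ m = 1 * r ^ 2 ∨ (2 : ℚ_[2]) ^ m = 2 * r ^ 2) := by
    intro m
    refine ⟨2 ^ (m / 2), zpow_ne_zero _ two_ne_zero, ?_⟩
    have e : ((2 : ℚ_[2]) ^ (m / 2)) ^ 2 = 2 ^ (2 * (m / 2)) := by
      rw [mul_comm, zpow_mul, zpow_ofNat]
    rw [e]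
    rcases Int.emod_two_eq_zero_or_one m with h | h
    · left
      rw [one_mul]
      congr 1
      omega
    · right
      nth_rewrite 2 [← zpow_one (2 : ℚ_[2])]
      rw [← zpow_add₀ two_ne_zero]
      congr 1
      omega
  obtain ⟨r, hr, h | h⟩ := key m <;> obtain ⟨r', hr', h' | h'⟩ := key n <;>
    rw [h, h', hilbert_mul_sq_left _ _ hr, hilbert_mul_sq_right _ _ hr'] <;>
    simp [hilbert_one_left, hilbert_one_right, hilbert_two_two]

/-- For a = 2ⁿu and b = 2ᵐv, the cross terms (2ⁿ, v) and (2ᵐ, u) in (2ⁿ⁺ᵐ, uv), together with the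
symbol (u, v) from the units, make up (a, b). -/
lemma torusChar_mul {i : ℂ} (hi : i ^ 2 = -1) {a b : ℚ_[2]} (ha : a ≠ 0) (hb : b ≠ 0) :
    torusChar i (a * b) = cs (hilbert a b) * (torusChar i a * torusChar i b) := by
  obtain ⟨n, u, hu, rfl⟩ := exists_eq_two_zpow_mul ha
  obtain ⟨m, v, hv, rfl⟩ := exists_eq_two_zpow_mul hb
  have h2n : ∀ n : ℤ, (2 : ℚ_[2]) ^ n ≠ 0 := fun n => zpow_ne_zero _ two_ne_zero
  have hu0 := ne_zero_of_norm_eq_one hu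
  have hv0 := ne_zero_of_norm_eq_one hv
  have e : (2 : ℚ_[2]) ^ n * u * (2 ^ m * v) = 2 ^ (n + m) * (u * v) := by
    rw [zpow_add₀ two_ne_zero]; ring
  rw [e, torusChar_two_zpow_mul i _ (by rw [norm_mul, hu, hv, one_mul]),
    torusChar_two_zpow_mul i _ hu, torusChar_two_zpow_mul i _ hv, unitChar_mul hi hu hv,
    zpow_add₀ two_ne_zero, hilbert_mul_left (h2n _) (h2n _) (mul_ne_zero hu0 hv0),
    hilbert_mul_right (h2n _) hu0 hv0, hilbert_mul_right (h2n _) hu0 hv0,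
    hilbert_mul_left (h2n _) hu0 (mul_ne_zero (h2n _) hv0),
    hilbert_mul_right (h2n _) (h2n _) hv0, hilbert_mul_right hu0 (h2n _) hv0, hilbert_two_zpow,
    hilbert_comm u (2 ^ m)]
  simp only [cs_mul, cs_one]
  have h1 := cs_mul_self (hilbert (2 ^ n) v)
  ring

lemma torusChar_sq {i : ℂ} (hi : i ^ 2 = -1) {a : ℚ_[2]} (ha : a ≠ 0) :
    torusChar i a * torusChar i a = cs (hilbert a (-1)) := by
  obtain ⟨n, u, hu, rfl⟩ := exists_eq_two_zpow_mul ha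
  have h2n : ∀ n : ℤ, (2 : ℚ_[2]) ^ n ≠ 0 := fun n => zpow_ne_zero _ two_ne_zero
  have hu0 := ne_zero_of_norm_eq_one hu
  have h1 : hilbert ((2 : ℚ_[2]) ^ n) (-1) = 1 := by
    rw [← hilbert_self (h2n n), hilbert_two_zpow]
  rw [torusChar_two_zpow_mul i _ hu, hilbert_mul_left (h2n _) hu0 (by simp), h1, one_mul]
  have h2 := cs_mul_self (hilbert (2 ^ n) u)
  rcases norm_sub_one_or_add_one hu with h | h
  · rw [unitChar_of_one i h, hilbert_unit_eq_one h (by simp), cs_one]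
    linear_combination h2
  · rw [unitChar_of_neg_one i h, hilbert_units_neg_one h (by simp), cs_neg_one]
    linear_combination i ^ 2 * h2 + hi

lemma torusChar_inv {i : ℂ} (hi : i ^ 2 = -1) {a : ℚ_[2]} (ha : a ≠ 0) :
    torusChar i a⁻¹ = torusChar i a := by
  have h := torusChar_mul hi ha (inv_ne_zero ha)
  rw [mul_inv_cancel₀ ha, torusChar_one, hilbert_inv_right, hilbert_self ha] at h
  have h2 := torusChar_sq hi ha
  have h3 := cs_mul_self (hilbert a (-1))
  linear_combination (-torusChar i a) * h - (cs (hilbert a (-1)) * torusChar i a⁻¹) * h2 -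
    torusChar i a⁻¹ * h3

lemma torusChar_pow_four {i : ℂ} (hi : i ^ 2 = -1) {a : ℚ_[2]} (ha : a ≠ 0) :
    torusChar i a ^ 4 = 1 := by
  have h2 := torusChar_sq hi ha
  have h3 := cs_mul_self (hilbert a (-1))
  rw [← h2] at h3
  linear_combination h3

lemma norm_torusChar {i : ℂ} (hi : i ^ 2 = -1) {a : ℚ_[2]} (ha : a ≠ 0) : ‖torusChar i a‖ = 1 := by
  have := congrArg norm (torusChar_pow_four hi ha)
  rw [norm_pow, norm_one] at this
  exact (pow_eq_one_iff_of_nonneg (norm_nonneg _) (by norm_num)).1 this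

/-! ### The central character and its extensions -/

lemma neg_entry (g : SL(2, ℚ_[2])) (i j : Fin 2) : (-g) i j = -(g i j) := by
  rw [Matrix.SpecialLinearGroup.coe_neg, Matrix.neg_apply]

lemma xEntry_neg (g : SL(2, ℚ_[2])) : xEntry (-g) = -xEntry g := by
  by_cases hc : g 1 0 = 0
  · rw [xEntry_of_eq hc, xEntry_of_eq (by rw [neg_entry, hc, neg_zero]), neg_entry]
  · rw [xEntry_of_ne hc, xEntry_of_ne (by rwa [neg_entry, neg_ne_zero]), neg_entry]

lemma h_neg_one_mat : (h (-1)).mat = -1 := by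
  ext i j
  fin_cases i <;> fin_cases j <;> simp [h, sec]

lemma cocycle_neg_one_neg_one : cocycle (-1) (-1) = -1 := by
  have hx : xEntry (-1) = -1 := by
    rw [xEntry_of_eq (by simp)]; simp
  have hs : sSign (-1) = 1 := sSign_of_eq (by simp)
  rw [cocycle_eq, kubota, hx, neg_mul_neg, one_mul, xEntry_one, hs, sSign_one]
  simp [hilbert_neg_one_neg_one]

lemma mu_mem_M (ε : ℤˣ) : mu ε ∈ M := Or.inl rfl

lemma h_neg_one_mem_M : h (-1) ∈ M := Or.inr h_neg_one_mat

lemma gamma_mu {γ : Mp → ℂ} (hγ : IsGenuineCentralCharacter γ) (ε : ℤˣ) : γ (mu ε) = cs ε := by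
  rcases Int.units_eq_one_or ε with rfl | rfl
  · have := hγ.1 _ (mu_mem_M (-1)) _ (mu_mem_M (-1))
    rw [mu_mul_mu, hγ.2] at this
    simpa [cs_one] using this
  · rw [hγ.2, cs_neg_one]

/-- In the cover h(-1)² is the nontrivial element of μ₂, since the cocycle at (-1, -1) is the symbol
(-1, -1) = -1. -/
lemma gamma_h_neg_one_sq {γ : Mp → ℂ} (hγ : IsGenuineCentralCharacter γ) : γ (h (-1)) ^ 2 = -1 := by
  have h1 := hγ.1 _ h_neg_one_mem_M _ h_neg_one_mem_M
  have h2 : h (-1) * h (-1) = mu (-1) := by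
    refine Mp.ext ?_ ?_
    · rw [Mp.mul_mat, h_neg_one_mat]; simp [mu]
    · rw [Mp.mul_sign, h_neg_one_mat, cocycle_neg_one_neg_one]; simp [mu, h, sec]
  rw [h2, hγ.2] at h1
  rw [sq, h1]

lemma norm_zero_zero_eq_one {k : Mp} (hk : k ∈ K₀) : ‖k.mat 0 0‖ = 1 ∧ ‖k.mat 1 1‖ = 1 := by
  obtain ⟨hK, hc⟩ := hk
  have hd := det_eq k.mat
  have h1 : ‖k.mat 0 0 * k.mat 1 1‖ = 1 := by
    have := Padic.norm_eq_of_norm_sub_lt_right (z1 := k.mat 0 0 * k.mat 1 1) (z2 := 1) (by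
      rw [show k.mat 0 0 * k.mat 1 1 - 1 = k.mat 0 1 * k.mat 1 0 by linear_combination hd,
        norm_mul, norm_one]
      nlinarith [hK 0 1, norm_nonneg (k.mat 0 1), norm_nonneg (k.mat 1 0)])
    simpa using this
  rw [norm_mul] at h1
  have h2 := hK 0 0
  have h3 := hK 1 1
  constructor <;> nlinarith [norm_nonneg (k.mat 0 0), norm_nonneg (k.mat 1 1)]

/-- Independence of the choice in `charK₀`: the upper left entry modulo 4 fixes the matrix ±1 of the
central factor, and then the sign is fixed because elements of K₁ have sign 1. -/
lemma charK₀_eq {γ : Mp → ℂ} {k m k₁ : Mp} (hm : m ∈ M) (hk₁ : k₁ ∈ K₁) (h : m * k₁ = k) :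
    charK₀ γ k = γ m := by
  have hex : ∃ m : Mp, m ∈ M ∧ ∃ k₁ ∈ K₁, m * k₁ = k := ⟨m, hm, k₁, hk₁, h⟩
  rw [charK₀, dif_pos hex]
  obtain ⟨hm', k₁', hk₁', h'⟩ := hex.choose_spec
  generalize hex.choose = m' at hm' h'
  have hmat : m'.mat * k₁'.mat = m.mat * k₁.mat := by
    rw [← Mp.mul_mat, ← Mp.mul_mat, h, h']
  have key : k₁'.mat = k₁.mat := by
    obtain ⟨-, ha, -⟩ := hk₁
    obtain ⟨-, ha', -⟩ := hk₁'
    rcases hm with hm | hm <;> rcases hm' with hm' | hm' <;> rw [hm, hm'] at hmat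
    · simpa using hmat
    · exfalso
      rw [one_mul, neg_one_mul] at hmat
      rw [← hmat] at ha
      simp only [Matrix.SpecialLinearGroup.coe_neg, Matrix.neg_apply, norm_neg_sub_one] at ha
      exact not_norm_sub_one_of_norm_add_one ha ha'
    · exfalso
      rw [one_mul, neg_one_mul] at hmat
      rw [hmat] at ha'
      simp only [Matrix.SpecialLinearGroup.coe_neg, Matrix.neg_apply, norm_neg_sub_one] at ha'
      exact not_norm_sub_one_of_norm_add_one ha' ha
    · simpa using hmat
  have : k₁' = k₁ := Mp.ext key (hk₁'.2.2.2.trans hk₁.2.2.2.symm)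
  rw [this, ← h] at h'
  rw [mul_right_cancel h']

lemma charK₀_of_one {γ : Mp → ℂ} (hγ : IsGenuineCentralCharacter γ)
    {k : Mp} (hk : k ∈ K₀) (ha : ‖k.mat 0 0 - 1‖ ≤ 1 / 4) :
    charK₀ γ k = cs k.sign := by
  rw [← gamma_mu hγ]
  refine charK₀_eq (mu_mem_M _) (k₁ := sec k.mat) ⟨hk.1, ha, hk.2, rfl⟩ ?_
  rw [← mk_eq_mu_mul]

lemma charK₀_of_neg_one {γ : Mp → ℂ} (hγ : IsGenuineCentralCharacter γ)
    {k : Mp} (hk : k ∈ K₀) (ha : ‖k.mat 0 0 + 1‖ ≤ 1 / 4) :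
    charK₀ γ k = cs (k.sign * cocycle (-1) (-k.mat)) * γ (h (-1)) := by
  rw [← gamma_mu hγ, ← hγ.1 _ (mu_mem_M _) _ h_neg_one_mem_M]
  refine charK₀_eq (Or.inr ?_) (k₁ := sec (-k.mat)) ⟨?_, ?_, ?_, rfl⟩ ?_
  · rw [mu_mul, h_neg_one_mat]
  · intro i j
    simpa [sec] using hk.1 i j
  · simpa [sec, norm_neg_sub_one] using ha
  · simpa [sec] using hk.2
  · rw [mul_assoc]
    have : h (-1) = sec (-1) := Mp.ext h_neg_one_mat rfl
    rw [this, sec_mul_sec, ← mul_assoc, mu_mul_mu, mul_assoc, Int.units_mul_self, mul_one,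
      neg_mul_neg, one_mul, ← mk_eq_mu_mul]

lemma norm_unit_inv_sub {v : ℚ_[2]} (ε : ℚ_[2]) (hv : ‖v‖ = 1) (hε : ε * ε = 1) :
    ‖v⁻¹ - ε‖ = ‖v - ε‖ := by
  have hv0 := ne_zero_of_norm_eq_one hv
  have hε1 : ‖ε‖ = 1 := by
    have := congrArg norm hε
    rw [norm_mul, norm_one] at this
    nlinarith [norm_nonneg ε]
  have e : v⁻¹ - ε = -(v⁻¹ * ε * (v - ε)) := by
    field_simp
    linear_combination -hε
  rw [e, norm_neg, norm_mul, norm_mul, norm_inv, hv, hε1]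
  simp

/-- The extension of `γ` to the torus. -/
lemma charT_eq {γ : Mp → ℂ} (hγ : IsGenuineCentralCharacter γ) (t : ℚ_[2]ˣ) :
    charT γ t = torusChar (γ (h (-1))) t := by
  have ht : (t : ℚ_[2]) ≠ 0 := t.ne_zero
  have hv := norm_mul_two_zpow ht
  have e2 : ∀ n : ℤ, ((two ^ n : ℚ_[2]ˣ) : ℚ_[2]) = 2 ^ n := by
    intro n
    rw [Units.val_zpow_eq_zpow_val]
    rfl
  rw [charT, torusChar]
  have ev : ((t * (two ^ (t : ℚ_[2]).valuation)⁻¹ : ℚ_[2]ˣ) : ℚ_[2]) =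
      t * 2 ^ (-(t : ℚ_[2]).valuation) := by
    rw [Units.val_mul, ← zpow_neg, e2]
  generalize t * (two ^ (t : ℚ_[2]).valuation)⁻¹ = v at ev
  rw [e2, ← ev]
  rw [← ev] at hv
  congr 1
  have hK : h v ∈ K₀ := by
    constructor
    · intro i j
      fin_cases i <;> fin_cases j <;> simp [h, sec, hv]
    · simp [h, sec]
  rcases norm_sub_one_or_add_one hv with h1 | h1
  · rw [charK₀_of_one hγ hK (by simpa [h, sec] using h1), unitChar_of_one _ h1]
    simp [h, sec, cs_one]
  · rw [charK₀_of_neg_one hγ hK (by simpa [h, sec] using h1), unitChar_of_neg_one _ h1]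
    have hc : cocycle (-1) (-(h v).mat) = 1 := by
      have hx : xEntry (-1) = -1 := by
        rw [xEntry_of_eq (by simp)]; simp
      have hx'' : xEntry (h v).mat = (v : ℚ_[2])⁻¹ := by
        rw [xEntry_of_eq (by simp [h, sec])]; simp [h, sec]
      have hx' : xEntry (-(h v).mat) = -(v : ℚ_[2])⁻¹ := by rw [xEntry_neg, hx'']
      rw [cocycle_eq, kubota, neg_mul_neg, one_mul, hx, hx', hx'', sSign_of_eq (g := -1) (by simp),
        sSign_of_eq (by rw [neg_entry]; simp [h, sec]), sSign_of_eq (by simp [h, sec])]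
      have hv' : ‖(v : ℚ_[2])⁻¹‖ = 1 := by simp [hv]
      have : (v : ℚ_[2])⁻¹ * -1 = -(v : ℚ_[2])⁻¹ := by ring
      rw [this, hilbert_unit_eq_one _ (by simp [hv])]
      · simp
      · rw [norm_neg_sub_one, ← sub_neg_eq_add, norm_unit_inv_sub _ hv (by ring)]
        simpa using h1
    rw [hc]
    simp [h, sec, cs_one]

/-! ### Explicit vectors in the principal series -/

/-- The sign by which an element of the cover differs from the section normalized by Kubota's
cocycle. -/
def twist (g : Mp) : ℂ := cs (g.sign * sSign g.mat)

lemma twist_mul (g k : Mp) :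
    twist (g * k) = cs (kubota g.mat k.mat) * (twist g * twist k) := by
  simp only [twist, Mp.mul_sign, Mp.mul_mat, cocycle_eq, cs_mul]
  linear_combination (cs (kubota g.mat k.mat) * cs g.sign * cs (sSign g.mat) * cs k.sign *
    cs (sSign k.mat)) * cs_mul_self (sSign (g.mat * k.mat))

lemma norm_twist (g : Mp) : ‖twist g‖ = 1 := norm_cs _

open scoped Classical in
/-- An explicit function of the bottom row. -/
def rowFun (i e d s : ℂ) (g : SL(2, ℚ_[2])) : ℂ :=
  -- The cases are the cosets of 1, of w(1) and of `lower 2`. In the first, the symbol is (cd, d)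
  -- for c ≠ 0 and trivial for c = 0. It undoes the Kubota sign in the factorization of g into an
  -- upper triangular matrix with lower right entry d and the lower unipotent matrix of c/d.
  if ‖g 1 0‖ ≤ ‖g 1 1‖ / 4 then
    d * cs (hilbert (xEntry g * g 1 1) (g 1 1)) * torusChar i (g 1 1) *
      ((‖g 1 1‖ : ℝ) : ℂ) ^ (-(s + 1))
  else if ‖g 1 1‖ ≤ ‖g 1 0‖ then
    e * torusChar i (g 1 0) * ((‖g 1 0‖ : ℝ) : ℂ) ^ (-(s + 1))
  else 0

/-- The vector in the principal series with bottom row function `rowFun`. -/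
def phiFun (i e d s : ℂ) (g : Mp) : ℂ := twist g * rowFun i e d s g.mat

lemma phiFun_mul (i e d s : ℂ) (g k : Mp) :
    phiFun i e d s (g * k) =
      cs (kubota g.mat k.mat) * (twist g * twist k) * rowFun i e d s (g.mat * k.mat) := by
  rw [phiFun, twist_mul, Mp.mul_mat]

lemma rowFun_small (i e d s : ℂ) {g : SL(2, ℚ_[2])} (hg : ‖g 1 0‖ ≤ ‖g 1 1‖ / 4) :
    rowFun i e d s g = d * cs (hilbert (xEntry g * g 1 1) (g 1 1)) * torusChar i (g 1 1) *
      ((‖g 1 1‖ : ℝ) : ℂ) ^ (-(s + 1)) := if_pos hg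

lemma small_ne_zero {g : SL(2, ℚ_[2])} (hg : ‖g 1 0‖ ≤ ‖g 1 1‖ / 4) : g 1 1 ≠ 0 := by
  intro h0
  rw [h0, norm_zero, zero_div, norm_le_zero_iff] at hg
  exact one_one_ne_zero hg h0

lemma big_ne_zero {g : SL(2, ℚ_[2])} (hg : ‖g 1 1‖ ≤ ‖g 1 0‖) : g 1 0 ≠ 0 := by
  intro h0
  rw [h0, norm_zero, norm_le_zero_iff] at hg
  exact one_one_ne_zero h0 hg

lemma not_small_of_big {g : SL(2, ℚ_[2])} (hg : ‖g 1 1‖ ≤ ‖g 1 0‖) :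
    ¬ ‖g 1 0‖ ≤ ‖g 1 1‖ / 4 := by
  have := norm_pos_iff.2 (big_ne_zero hg)
  intro h
  linarith

lemma rowFun_big (i e d s : ℂ) {g : SL(2, ℚ_[2])} (hg : ‖g 1 1‖ ≤ ‖g 1 0‖) :
    rowFun i e d s g = e * torusChar i (g 1 0) * ((‖g 1 0‖ : ℝ) : ℂ) ^ (-(s + 1)) := by
  rw [rowFun, if_neg (not_small_of_big hg), if_pos hg]

lemma rowFun_mid (i e d s : ℂ) {g : SL(2, ℚ_[2])} (h₁ : ¬ ‖g 1 0‖ ≤ ‖g 1 1‖ / 4)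
    (h₂ : ¬ ‖g 1 1‖ ≤ ‖g 1 0‖) : rowFun i e d s g = 0 := by
  rw [rowFun, if_neg h₁, if_neg h₂]

lemma x_mat (u : ℚ_[2]) : (x u).mat 0 0 = 1 ∧ (x u).mat 0 1 = u ∧ (x u).mat 1 0 = 0 ∧
    (x u).mat 1 1 = 1 := by simp [x, sec]

lemma h_mat (t : ℚ_[2]ˣ) : (h t).mat 0 0 = t ∧ (h t).mat 0 1 = 0 ∧ (h t).mat 1 0 = 0 ∧
    (h t).mat 1 1 = (t : ℚ_[2])⁻¹ := by simp [h, sec]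

lemma w_mat : (w 1).mat 0 0 = 0 ∧ (w 1).mat 0 1 = 1 ∧ (w 1).mat 1 0 = -1 ∧
    (w 1).mat 1 1 = 0 := by simp [w, sec]

/-- Lower triangular unipotent elements. -/
def lower (c : ℚ_[2]) : Mp := sec ⟨!![1, 0; c, 1], by simp [Matrix.det_fin_two]⟩

lemma lower_mat (c : ℚ_[2]) : (lower c).mat 0 0 = 1 ∧ (lower c).mat 0 1 = 0 ∧
    (lower c).mat 1 0 = c ∧ (lower c).mat 1 1 = 1 := by simp [lower, sec]

lemma twist_of_upper {g : Mp} (hg : g.mat 1 0 = 0) : twist g = cs g.sign := by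
  rw [twist, sSign_of_eq hg, mul_one]

lemma twist_x (u : ℚ_[2]) : twist (x u) = 1 := by
  rw [twist_of_upper (x_mat u).2.2.1]; simp [x, sec, cs_one]

lemma twist_h (t : ℚ_[2]ˣ) : twist (h t) = 1 := by
  rw [twist_of_upper (h_mat t).2.2.1]; simp [h, sec, cs_one]

lemma twist_lower (c : ℚ_[2]) : twist (lower c) = 1 := by
  rw [twist, sSign]
  split_ifs
  · simp [lower, sec, hilbert_one_right, cs_one]
  · simp [lower, sec, cs_one]

lemma twist_w : twist (w 1) = 1 := by
  rw [twist, sSign, if_neg (by simp [w_mat])]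
  simp [w, sec, cs_one]

lemma kubota_of_left {g : SL(2, ℚ_[2])} (g' : SL(2, ℚ_[2])) (hg : g 1 0 = 0) :
    kubota g g' = hilbert (xEntry g') (g 1 1) := by
  have hd := one_one_ne_zero hg
  have hX := xEntry_ne_zero g'
  rw [kubota, xEntry_mul_of_left _ hg, xEntry_of_eq hg,
    show g 1 1 * xEntry g' * g 1 1 = xEntry g' * (g 1 1) ^ 2 by ring,
    show g 1 1 * xEntry g' * xEntry g' = g 1 1 * (xEntry g') ^ 2 by ring,
    hilbert_mul_sq_left _ _ hd, hilbert_mul_sq_right _ _ hX]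

lemma twist_of_upper_mul {b : Mp} (g : Mp) (hb : b.mat 1 0 = 0) :
    twist (b * g) = cs (hilbert (xEntry g.mat) (b.mat 1 1)) * (cs b.sign * twist g) := by
  rw [twist_mul, kubota_of_left _ hb, twist_of_upper hb]

/-- The leftover symbol is the Kubota sign of the product b g; it cancels against `twist` in
`phiFun_left`. -/
lemma rowFun_left {i : ℂ} (hi : i ^ 2 = -1) (e d s : ℂ) {b : SL(2, ℚ_[2])} (g : SL(2, ℚ_[2]))
    (hb : b 1 0 = 0) :
    rowFun i e d s (b * g) = cs (hilbert (xEntry g) (b 1 1)) *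
      (torusChar i (b 1 1) * ((‖b 1 1‖ : ℝ) : ℂ) ^ (-(s + 1)) * rowFun i e d s g) := by
  have ht := one_one_ne_zero hb
  have hX := xEntry_ne_zero g
  have hc : (b * g) 1 0 = b 1 1 * g 1 0 := by rw [mul_one_zero, hb]; ring
  have hd : (b * g) 1 1 = b 1 1 * g 1 1 := by rw [mul_one_one, hb]; ring
  have htn := norm_pos_iff.2 ht
  have e1 : ‖(b * g) 1 0‖ ≤ ‖(b * g) 1 1‖ / 4 ↔ ‖g 1 0‖ ≤ ‖g 1 1‖ / 4 := by
    rw [hc, hd, norm_mul, norm_mul, mul_div_assoc, mul_le_mul_iff_right₀ htn]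
  have e2 : ‖(b * g) 1 1‖ ≤ ‖(b * g) 1 0‖ ↔ ‖g 1 1‖ ≤ ‖g 1 0‖ := by
    rw [hc, hd, norm_mul, norm_mul, mul_le_mul_iff_right₀ htn]
  have hpow : ∀ y : ℚ_[2], ((‖b 1 1 * y‖ : ℝ) : ℂ) ^ (-(s + 1)) =
      ((‖b 1 1‖ : ℝ) : ℂ) ^ (-(s + 1)) * ((‖y‖ : ℝ) : ℂ) ^ (-(s + 1)) := by
    intro y
    rw [norm_mul, Complex.ofReal_mul, Complex.mul_cpow_ofReal_nonneg (norm_nonneg _) (norm_nonneg _)]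
  by_cases h1 : ‖g 1 0‖ ≤ ‖g 1 1‖ / 4
  · have hd0 := small_ne_zero h1
    rw [rowFun_small i e d s h1, rowFun_small i e d s (e1.2 h1), hd, hpow,
      torusChar_mul hi ht hd0, xEntry_mul_of_left _ hb,
      show b 1 1 * xEntry g * (b 1 1 * g 1 1) = xEntry g * g 1 1 * (b 1 1) ^ 2 by ring,
      hilbert_mul_sq_left _ _ ht, hilbert_mul_right (mul_ne_zero hX hd0) ht hd0,
      hilbert_mul_left (b := b 1 1) hX hd0 ht, hilbert_comm (g 1 1) (b 1 1)]
    simp only [cs_mul]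
    linear_combination (d * cs (hilbert (xEntry g) (b 1 1)) *
      cs (hilbert (xEntry g * g 1 1) (g 1 1)) * torusChar i (b 1 1) * torusChar i (g 1 1) *
      ((‖b 1 1‖ : ℝ) : ℂ) ^ (-(s + 1)) * ((‖g 1 1‖ : ℝ) : ℂ) ^ (-(s + 1))) *
      cs_mul_self (hilbert (b 1 1) (g 1 1))
  by_cases h2 : ‖g 1 1‖ ≤ ‖g 1 0‖
  · have hc0 := big_ne_zero h2
    rw [rowFun_big i e d s h2, rowFun_big i e d s (e2.2 h2), hc, hpow, torusChar_mul hi ht hc0,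
      xEntry_of_ne hc0, hilbert_comm (g 1 0)]
    ring
  · rw [rowFun_mid i e d s h1 h2, rowFun_mid i e d s (by rwa [e1]) (by rwa [e2])]
    simp

lemma phiFun_left {i : ℂ} (hi : i ^ 2 = -1) (e d s : ℂ) {b : Mp} (g : Mp) (hb : b.mat 1 0 = 0) :
    phiFun i e d s (b * g) = cs b.sign * torusChar i (b.mat 1 1) *
      ((‖b.mat 1 1‖ : ℝ) : ℂ) ^ (-(s + 1)) * phiFun i e d s g := by
  rw [phiFun, phiFun, twist_of_upper_mul _ hb, Mp.mul_mat, rowFun_left hi e d s _ hb]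
  linear_combination (cs b.sign * twist g * (torusChar i (b.mat 1 1) *
    ((‖b.mat 1 1‖ : ℝ) : ℂ) ^ (-(s + 1)) * rowFun i e d s g.mat)) *
    cs_mul_self (hilbert (xEntry g.mat) (b.mat 1 1))

lemma upper_mul_upper_sign {b b' : Mp} (hb : b.mat 1 0 = 0) (hb' : b'.mat 1 0 = 0) :
    (b * b').sign = b.sign * b'.sign * hilbert (b'.mat 1 1) (b.mat 1 1) := by
  have h0 : (b.mat * b'.mat) 1 0 = 0 := by rw [mul_one_zero, hb, hb']; ring
  rw [Mp.mul_sign, cocycle_eq, kubota_of_left _ hb, sSign_of_eq hb, sSign_of_eq hb',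
    sSign_of_eq h0, xEntry_of_eq hb']
  simp

lemma borel_mat_sign (ε : ℤˣ) (u : ℚ_[2]) (t : ℚ_[2]ˣ) :
    (mu ε * x u * h t).mat 0 0 = t ∧ (mu ε * x u * h t).mat 0 1 = u * (t : ℚ_[2])⁻¹ ∧
    (mu ε * x u * h t).mat 1 0 = 0 ∧ (mu ε * x u * h t).mat 1 1 = (t : ℚ_[2])⁻¹ ∧
    (mu ε * x u * h t).sign = ε := by
  have h1 : (mu ε * x u).mat = (x u).mat := one_mul _
  have h2 : (mu ε * x u).sign = ε := by rw [mu_mul]; simp [x, sec]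
  refine ⟨?_, ?_, ?_, ?_, ?_⟩
  · rw [Mp.mul_mat, h1, mul_zero_zero]; simp [x_mat, h_mat]
  · rw [Mp.mul_mat, h1, mul_zero_one]; simp [x_mat, h_mat]
  · rw [Mp.mul_mat, h1, mul_one_zero]; simp [x_mat, h_mat]
  · rw [Mp.mul_mat, h1, mul_one_one]; simp [x_mat, h_mat]
  · rw [upper_mul_upper_sign (by rw [h1]; simp [x_mat]) (by simp [h_mat]), h2, h1]
    simp [x_mat, h, sec, hilbert_one_right]

lemma phiFun_borel {i : ℂ} (hi : i ^ 2 = -1) (e d s : ℂ) (ε : ℤˣ) (u : ℚ_[2]) (t : ℚ_[2]ˣ)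
    (g : Mp) :
    phiFun i e d s (mu ε * x u * h t * g) =
      cs ε * torusChar i t * ((‖(t : ℚ_[2])‖ : ℝ) : ℂ) ^ (s + 1) * phiFun i e d s g := by
  obtain ⟨-, -, hc, hd, hs⟩ := borel_mat_sign ε u t
  rw [phiFun_left hi e d s g hc, hs, hd, torusChar_inv hi t.ne_zero, norm_inv, Complex.ofReal_inv,
    Complex.inv_cpow _ _ (by
      rw [Complex.arg_ofReal_of_nonneg (norm_nonneg _)]; exact Real.pi_ne_zero.symm),
    Complex.cpow_neg, inv_inv]

lemma norm_eq_of_norm_sub_lt {a b : ℚ_[2]} (hab : ‖b - a‖ < ‖a‖) : ‖b‖ = ‖a‖ :=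
  Padic.norm_eq_of_norm_sub_lt_right hab

lemma phiFun_mul_mu (i e d s : ℂ) (g : Mp) (ε : ℤˣ) :
    phiFun i e d s (g * mu ε) = cs ε * phiFun i e d s g := by
  rw [mul_mu, phiFun, phiFun, twist, twist]
  simp only [cs_mul]
  ring

lemma hilbert_self_of_one {v : ℚ_[2]} (hv : ‖v - 1‖ ≤ 1 / 4) : hilbert v v = 1 :=
  hilbert_unit_eq_one hv (norm_eq_one_of_norm_sub_one hv)

/-- Only d changes. In the coset of 1 it is multiplied by 1 + bq with q = c/d ∈ 4ℤ₂, and the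
resulting symbols disappear because (q, 1 + bq) = 1. In the other cases neither c nor the case
distinction is affected. -/
lemma phiFun_mul_x {i : ℂ} (hi : i ^ 2 = -1) (e d s : ℂ) (g : Mp) {b : ℚ_[2]} (hb : ‖b‖ ≤ 1) :
    phiFun i e d s (g * x b) = phiFun i e d s g := by
  obtain ⟨x1, x2, x3, x4⟩ := x_mat b
  have hc : (g.mat * (x b).mat) 1 0 = g.mat 1 0 := by rw [mul_one_zero, x1, x3]; ring
  have hd : (g.mat * (x b).mat) 1 1 = g.mat 1 1 + b * g.mat 1 0 := by
    rw [mul_one_one, x2, x4]; ring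
  have hX : xEntry (g.mat * (x b).mat) = xEntry g.mat := by
    by_cases h0 : g.mat 1 0 = 0
    · rw [xEntry_of_eq h0, xEntry_of_eq (by rw [hc, h0]), hd, h0]; ring
    · rw [xEntry_of_ne h0, xEntry_of_ne (by rwa [hc]), hc]
  have hk : kubota g.mat (x b).mat = 1 := by
    rw [kubota, hX, ← sq, hilbert_sq_left]
  rw [phiFun_mul, hk, cs_one, twist_x, one_mul, mul_one, phiFun]
  congr 1
  by_cases h1 : ‖g.mat 1 0‖ ≤ ‖g.mat 1 1‖ / 4
  · have hd0 := small_ne_zero h1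
    have hdn := norm_pos_iff.2 hd0
    obtain ⟨q, hq⟩ : ∃ q, g.mat 1 0 = q * g.mat 1 1 := ⟨g.mat 1 0 / g.mat 1 1, by field_simp⟩
    have hqn : ‖q‖ ≤ 1 / 4 := by
      rw [hq, norm_mul] at h1
      exact le_of_mul_le_mul_right (by linarith) hdn
    have hv : ‖(1 + b * q) - 1‖ ≤ 1 / 4 := by
      rw [add_sub_cancel_left, norm_mul]
      nlinarith [norm_nonneg b, norm_nonneg q]
    have hv1 := norm_eq_one_of_norm_sub_one hv
    have hd' : (g.mat * (x b).mat) 1 1 = g.mat 1 1 * (1 + b * q) := by rw [hd, hq]; ring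
    have hn : ‖(g.mat * (x b).mat) 1 1‖ = ‖g.mat 1 1‖ := by rw [hd', norm_mul, hv1, mul_one]
    rw [rowFun_small i e d s h1, rowFun_small i e d s (by rw [hc, hn]; exact h1), hn, hX, hd',
      torusChar_mul hi hd0 (ne_zero_of_norm_eq_one hv1), torusChar_of_one i hv]
    have hsym : hilbert (xEntry g.mat * (g.mat 1 1 * (1 + b * q))) (g.mat 1 1 * (1 + b * q)) *
        hilbert (g.mat 1 1) (1 + b * q) = hilbert (xEntry g.mat * g.mat 1 1) (g.mat 1 1) := by
      by_cases hq0 : q = 0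
      · simp [hq0, hilbert_one_right]
      have hv0 := ne_zero_of_norm_eq_one hv1
      have hX0 := xEntry_ne_zero g.mat
      have h3 := hilbert_one_add_mul hqn hb hq0
      have h4 := hilbert_self_of_one hv
      generalize 1 + b * q = v at *
      have h5 : hilbert (xEntry g.mat * g.mat 1 1) v = 1 := by
        rw [xEntry_of_ne (by rw [hq]; exact mul_ne_zero hq0 hd0), hq, mul_assoc, ← sq,
          hilbert_mul_sq_left _ _ hd0, h3]
      rw [← mul_assoc, hilbert_mul_left (mul_ne_zero hX0 hd0) hv0 (mul_ne_zero hd0 hv0),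
        hilbert_mul_right (mul_ne_zero hX0 hd0) hd0 hv0, hilbert_mul_right hv0 hd0 hv0, h4, h5,
        hilbert_comm v]
      simp [mul_assoc, Int.units_mul_self]
    rw [← hsym, cs_mul]
    ring
  by_cases h2 : ‖g.mat 1 1‖ ≤ ‖g.mat 1 0‖
  · have h2' : ‖(g.mat * (x b).mat) 1 1‖ ≤ ‖(g.mat * (x b).mat) 1 0‖ := by
      rw [hc, hd]
      refine (Padic.nonarchimedean _ _).trans (max_le h2 ?_)
      rw [norm_mul]
      nlinarith [norm_nonneg (g.mat 1 0)]
    rw [rowFun_big i e d s h2, rowFun_big i e d s h2', hc]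
  · have hn : ‖(g.mat * (x b).mat) 1 1‖ = ‖g.mat 1 1‖ := by
      refine norm_eq_of_norm_sub_lt ?_
      rw [hd, add_sub_cancel_left, norm_mul]
      nlinarith [norm_nonneg (g.mat 1 0)]
    rw [rowFun_mid i e d s h1 h2, rowFun_mid i e d s (by rwa [hc, hn]) (by rwa [hc, hn])]

lemma lower_zero : lower 0 = 1 := by
  refine Mp.ext ?_ rfl
  ext i j
  fin_cases i <;> fin_cases j <;> simp [lower, sec, Mp.one_mat]

/-- Only c changes. In the coset of w(1) it is multiplied by a unit 1 + qb congruent to 1 modulo 4,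
and (b, 1 + qb) = 1. In the coset of 1 the change is additive, which calls for the Steinberg
relation. -/
lemma phiFun_mul_lower {i : ℂ} (hi : i ^ 2 = -1) (e d s : ℂ) (g : Mp) {b : ℚ_[2]}
    (hb : ‖b‖ ≤ 1 / 4) : phiFun i e d s (g * lower b) = phiFun i e d s g := by
  rcases eq_or_ne b 0 with rfl | hb0
  · rw [lower_zero, mul_one]
  obtain ⟨x1, x2, x3, x4⟩ := lower_mat b
  have hc : (g.mat * (lower b).mat) 1 0 = g.mat 1 0 + g.mat 1 1 * b := by
    rw [mul_one_zero, x1, x3]; ring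
  have hd : (g.mat * (lower b).mat) 1 1 = g.mat 1 1 := by
    rw [mul_one_one, x2, x4]; ring
  have hXb : xEntry (lower b).mat = b := by rw [xEntry_of_ne (by rwa [x3]), x3]
  rw [phiFun_mul, twist_lower, mul_one, phiFun, kubota, hXb]
  by_cases h1 : ‖g.mat 1 0‖ ≤ ‖g.mat 1 1‖ / 4
  · have hd0 := small_ne_zero h1
    have h1' : ‖(g.mat * (lower b).mat) 1 0‖ ≤ ‖(g.mat * (lower b).mat) 1 1‖ / 4 := by
      rw [hc, hd]
      refine (Padic.nonarchimedean _ _).trans (max_le h1 ?_)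
      rw [norm_mul]
      nlinarith [norm_nonneg (g.mat 1 1)]
    rw [rowFun_small i e d s h1, rowFun_small i e d s h1', hd]
    have hX0 := xEntry_ne_zero g.mat
    have hX0' := xEntry_ne_zero (g.mat * (lower b).mat)
    -- Steinberg relation for the new entry c' = c + db. If c or c' vanishes, `xEntry` is d, and the
    -- symbol is trivial by the square or the (a, -a) rule.
    have key : hilbert (xEntry g.mat * xEntry (g.mat * (lower b).mat))
        (g.mat 1 1 * b * xEntry (g.mat * (lower b).mat)) = 1 := by
      by_cases hc0 : g.mat 1 0 = 0
      · rw [xEntry_of_eq hc0, xEntry_of_ne (by rw [hc, hc0]; simp [hd0, hb0]), hc, hc0,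
          zero_add, ← sq (g.mat 1 1 * b), hilbert_comm, hilbert_sq_left]
      by_cases hc0' : (g.mat * (lower b).mat) 1 0 = 0
      · rw [xEntry_of_eq hc0', xEntry_of_ne hc0, hd]
        have : g.mat 1 0 = -(g.mat 1 1 * b) := by linear_combination hc0' - hc
        rw [this, show -(g.mat 1 1 * b) * g.mat 1 1 = -(g.mat 1 1 * b * g.mat 1 1) by ring,
          hilbert_comm, hilbert_neg_self]
      · rw [xEntry_of_ne hc0, xEntry_of_ne hc0']
        exact hilbert_steinberg_mul hc0' hc
    generalize xEntry (g.mat * (lower b).mat) = X' at *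
    generalize xEntry g.mat = X at *
    have hsym : hilbert (X' * X) (X' * b) * hilbert (X' * g.mat 1 1) (g.mat 1 1) =
        hilbert (X * g.mat 1 1) (g.mat 1 1) := by
      rw [mul_comm X X', mul_assoc, hilbert_mul_right (mul_ne_zero hX0' hX0) hd0
        (mul_ne_zero hb0 hX0'), mul_comm b X', mul_comm] at key
      rw [units_mul_eq_iff, ← key, hilbert_mul_left hX0' hd0 hd0, hilbert_mul_left hX0 hd0 hd0,
        hilbert_mul_left (b := g.mat 1 1) hX0' hX0 hd0]
      calc _ = hilbert (X' * X) (X' * b) * (hilbert X' (g.mat 1 1) * hilbert X (g.mat 1 1)) *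
            (hilbert (g.mat 1 1) (g.mat 1 1) * hilbert (g.mat 1 1) (g.mat 1 1)) := by ac_rfl
        _ = _ := by rw [Int.units_mul_self, mul_one]
    rw [← hsym, cs_mul]
    ring
  by_cases h2 : ‖g.mat 1 1‖ ≤ ‖g.mat 1 0‖
  · have hc0 := big_ne_zero h2
    have hcn := norm_pos_iff.2 hc0
    obtain ⟨q, hq⟩ : ∃ q, g.mat 1 1 = q * g.mat 1 0 := ⟨g.mat 1 1 / g.mat 1 0, by field_simp⟩
    have hqn : ‖q‖ ≤ 1 := by
      rw [hq, norm_mul] at h2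
      exact le_of_mul_le_mul_right (by linarith) hcn
    have hv : ‖(1 + q * b) - 1‖ ≤ 1 / 4 := by
      rw [add_sub_cancel_left, norm_mul]
      nlinarith [norm_nonneg b, norm_nonneg q]
    have hv1 := norm_eq_one_of_norm_sub_one hv
    have hv0 := ne_zero_of_norm_eq_one hv1
    have hc' : (g.mat * (lower b).mat) 1 0 = g.mat 1 0 * (1 + q * b) := by rw [hc, hq]; ring
    have hn : ‖(g.mat * (lower b).mat) 1 0‖ = ‖g.mat 1 0‖ := by rw [hc', norm_mul, hv1, mul_one]
    have hc0' : (g.mat * (lower b).mat) 1 0 ≠ 0 := by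
      rw [hc']; exact mul_ne_zero hc0 hv0
    have h3 := hilbert_one_add_mul hb hqn hb0
    have h4 := hilbert_self_of_one hv
    rw [rowFun_big i e d s h2, rowFun_big i e d s (by rw [hd, hn]; exact h2), hn,
      xEntry_of_ne hc0', xEntry_of_ne hc0, hc', torusChar_mul hi hc0 hv0, torusChar_of_one i hv]
    generalize 1 + q * b = v at *
    have hsym : hilbert (g.mat 1 0 * v * g.mat 1 0) (g.mat 1 0 * v * b) * hilbert (g.mat 1 0) v
        = 1 := by
      rw [show g.mat 1 0 * v * g.mat 1 0 = v * g.mat 1 0 ^ 2 by ring, hilbert_mul_sq_left _ _ hc0,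
        hilbert_mul_right hv0 (mul_ne_zero hc0 hv0) hb0, hilbert_mul_right hv0 hc0 hv0, h4,
        hilbert_comm v b, h3, hilbert_comm v, mul_one, mul_one, Int.units_mul_self]
    have hsym' := congrArg cs hsym
    rw [cs_mul, cs_one] at hsym'
    linear_combination (twist g * (e * torusChar i (g.mat 1 0) *
      ((‖g.mat 1 0‖ : ℝ) : ℂ) ^ (-(s + 1)))) * hsym'
  · have hn : ‖(g.mat * (lower b).mat) 1 0‖ = ‖g.mat 1 0‖ := by
      refine norm_eq_of_norm_sub_lt ?_
      rw [hc, add_sub_cancel_left, norm_mul]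
      nlinarith [norm_nonneg (g.mat 1 1)]
    rw [rowFun_mid i e d s h1 h2, rowFun_mid i e d s (by rwa [hd, hn]) (by rwa [hd, hn])]
    simp

lemma phiFun_mul_h {i : ℂ} (hi : i ^ 2 = -1) (e d s : ℂ) (g : Mp) {t : ℚ_[2]ˣ}
    (ht : ‖(t : ℚ_[2])‖ = 1) :
    phiFun i e d s (g * h t) = torusChar i t * phiFun i e d s g := by
  obtain ⟨x1, x2, x3, x4⟩ := h_mat t
  have ht0 := t.ne_zero
  generalize ht' : (t : ℚ_[2]) = τ at *
  have hc : (g.mat * (h t).mat) 1 0 = g.mat 1 0 * τ := by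
    rw [mul_one_zero, x1, x3]; ring
  have hd : (g.mat * (h t).mat) 1 1 = g.mat 1 1 * τ⁻¹ := by
    rw [mul_one_one, x2, x4]; ring
  have hcn : ‖(g.mat * (h t).mat) 1 0‖ = ‖g.mat 1 0‖ := by rw [hc, norm_mul, ht, mul_one]
  have hdn : ‖(g.mat * (h t).mat) 1 1‖ = ‖g.mat 1 1‖ := by
    rw [hd, norm_mul, norm_inv, ht, inv_one, mul_one]
  have hX0 := xEntry_ne_zero g.mat
  have hτ : τ⁻¹ ≠ 0 := inv_ne_zero ht0
  have hk : kubota g.mat (h t).mat = hilbert τ (xEntry g.mat) := by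
    rw [kubota, xEntry_of_eq x3, x4]
    by_cases h0 : g.mat 1 0 = 0
    · rw [xEntry_of_eq h0, xEntry_of_eq (by rw [hc, h0, zero_mul]), hd]
      rw [xEntry_of_eq h0] at hX0
      rw [show g.mat 1 1 * τ⁻¹ * g.mat 1 1 = τ⁻¹ * g.mat 1 1 ^ 2 by ring, mul_assoc, ← sq,
        hilbert_mul_sq_left _ _ hX0, hilbert_mul_sq_right _ _ hτ, hilbert_inv_left]
    · rw [xEntry_of_ne h0, xEntry_of_ne (by rw [hc]; exact mul_ne_zero h0 ht0), hc]
      rw [show g.mat 1 0 * τ * g.mat 1 0 = τ * g.mat 1 0 ^ 2 by ring, mul_assoc,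
        mul_inv_cancel₀ ht0, mul_one, hilbert_mul_sq_left _ _ h0]
  rw [phiFun_mul, twist_h, mul_one, phiFun, hk]
  by_cases h1 : ‖g.mat 1 0‖ ≤ ‖g.mat 1 1‖ / 4
  · have hd0 := small_ne_zero h1
    have hsym : hilbert (xEntry (g.mat * (h t).mat) * (g.mat 1 1 * τ⁻¹)) (g.mat 1 1 * τ⁻¹) =
        hilbert (xEntry g.mat * g.mat 1 1) (g.mat 1 1) * (hilbert τ (xEntry g.mat) *
          hilbert (g.mat 1 1) τ) := by
      by_cases h0 : g.mat 1 0 = 0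
      · rw [xEntry_of_eq h0, xEntry_of_eq (by rw [hc, h0, zero_mul]), hd, ← sq, ← sq,
          hilbert_sq_left, hilbert_sq_left, hilbert_comm τ, Int.units_mul_self, mul_one]
      · rw [xEntry_of_ne h0, xEntry_of_ne (by rw [hc]; exact mul_ne_zero h0 ht0), hc,
          show g.mat 1 0 * τ * (g.mat 1 1 * τ⁻¹) = g.mat 1 0 * g.mat 1 1 by field_simp,
          hilbert_mul_right (mul_ne_zero h0 hd0) hd0 hτ, hilbert_inv_right,
          hilbert_mul_left (b := τ) h0 hd0 ht0, hilbert_comm τ]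
    rw [rowFun_small i e d s h1, rowFun_small i e d s (by rwa [hcn, hdn]), hdn, hd, hsym,
      torusChar_mul hi hd0 hτ, torusChar_inv hi ht0, hilbert_inv_right]
    simp only [cs_mul]
    have e1 := cs_mul_self (hilbert τ (xEntry g.mat))
    have e2 := cs_mul_self (hilbert (g.mat 1 1) τ)
    generalize cs (hilbert τ (xEntry g.mat)) = a1 at *
    generalize cs (hilbert (g.mat 1 1) τ) = a2 at *
    generalize cs (hilbert (xEntry g.mat * g.mat 1 1) (g.mat 1 1)) = a3 at *
    generalize ((‖g.mat 1 1‖ : ℝ) : ℂ) ^ (-(s + 1)) = a4 at *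
    linear_combination (twist g * d * a3 * a4 * torusChar i (g.mat 1 1) * torusChar i τ) *
      (a2 * a2 * e1 + e2)
  by_cases h2 : ‖g.mat 1 1‖ ≤ ‖g.mat 1 0‖
  · have hc0 := big_ne_zero h2
    rw [rowFun_big i e d s h2, rowFun_big i e d s (by rwa [hcn, hdn]), hcn, hc,
      xEntry_of_ne hc0, torusChar_mul hi hc0 ht0, hilbert_comm τ]
    linear_combination (twist g * e * torusChar i (g.mat 1 0) * torusChar i τ *
      ((‖g.mat 1 0‖ : ℝ) : ℂ) ^ (-(s + 1))) * cs_mul_self (hilbert (g.mat 1 0) τ)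
  · rw [rowFun_mid i e d s h1 h2, rowFun_mid i e d s (by rwa [hcn, hdn]) (by rwa [hcn, hdn])]
    simp

/-! ### Decompositions of the cover -/

lemma mat_ext {g g' : SL(2, ℚ_[2])} (h00 : g 0 0 = g' 0 0) (h01 : g 0 1 = g' 0 1)
    (h10 : g 1 0 = g' 1 0) (h11 : g 1 1 = g' 1 1) : g = g' := by
  ext i j
  fin_cases i <;> fin_cases j <;> assumption

lemma mul_borel_mat (u : ℚ_[2]) (t : ℚ_[2]ˣ) (g : Mp) :
    (x u * h t * g).mat 0 0 = t * g.mat 0 0 + u * (t : ℚ_[2])⁻¹ * g.mat 1 0 ∧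
    (x u * h t * g).mat 0 1 = t * g.mat 0 1 + u * (t : ℚ_[2])⁻¹ * g.mat 1 1 ∧
    (x u * h t * g).mat 1 0 = (t : ℚ_[2])⁻¹ * g.mat 1 0 ∧
    (x u * h t * g).mat 1 1 = (t : ℚ_[2])⁻¹ * g.mat 1 1 := by
  have hb := borel_mat_sign 1 u t
  rw [mu_one, one_mul] at hb
  obtain ⟨h1, h2, h3, h4, -⟩ := hb
  rw [Mp.mul_mat, mul_zero_zero, mul_zero_one, mul_one_zero, mul_one_one, h1, h2, h3, h4]
  simp

lemma exists_eq_mu_mul_mul {g g' : Mp} {u : ℚ_[2]} {t : ℚ_[2]ˣ}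
    (hg : g.mat = (x u * h t * g').mat) : ∃ ε : ℤˣ, g = mu ε * x u * h t * g' :=
  ⟨_, by rw [mul_assoc (mu _), mul_assoc (mu _)]; exact eq_mu_mul_of_mat_eq hg⟩

lemma exists_eq_lower {g : Mp} (hd : g.mat 1 1 ≠ 0) :
    ∃ ε : ℤˣ, g = mu ε * x (g.mat 0 1 / g.mat 1 1) * h (Units.mk0 _ hd)⁻¹ *
      lower (g.mat 1 0 / g.mat 1 1) := by
  have hdet := det_eq g.mat
  obtain ⟨e1, e2, e3, e4⟩ := mul_borel_mat (g.mat 0 1 / g.mat 1 1) (Units.mk0 _ hd)⁻¹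
    (lower (g.mat 1 0 / g.mat 1 1))
  obtain ⟨l1, l2, l3, l4⟩ := lower_mat (g.mat 1 0 / g.mat 1 1)
  rw [l1, l3] at e1
  rw [l2, l4] at e2
  rw [l3] at e3
  rw [l4] at e4
  refine exists_eq_mu_mul_mul (mat_ext ?_ ?_ ?_ ?_)
  · rw [e1]
    simp only [Units.val_inv_eq_inv_val, Units.val_mk0, inv_inv]
    field_simp
    linear_combination hdet
  · rw [e2]
    simp only [Units.val_inv_eq_inv_val, Units.val_mk0, inv_inv]
    field_simp
    ring
  · rw [e3]
    simp only [Units.val_inv_eq_inv_val, Units.val_mk0, inv_inv]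
    field_simp
  · rw [e4]
    simp

lemma w_mul_x_mat (u : ℚ_[2]) : (w 1 * x u).mat 0 0 = 0 ∧ (w 1 * x u).mat 0 1 = 1 ∧
    (w 1 * x u).mat 1 0 = -1 ∧ (w 1 * x u).mat 1 1 = -u := by
  obtain ⟨x1, x2, x3, x4⟩ := x_mat u
  obtain ⟨w1, w2, w3, w4⟩ := w_mat
  rw [Mp.mul_mat, mul_zero_zero, mul_zero_one, mul_one_zero, mul_one_one, x1, x2, x3, x4, w1, w2,
    w3, w4]
  simp

lemma exists_eq_w_mul_x {g : Mp} (hc : g.mat 1 0 ≠ 0) :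
    ∃ ε : ℤˣ, g = mu ε * x (g.mat 0 0 / g.mat 1 0) * h (-(Units.mk0 _ hc)⁻¹) *
      (w 1 * x (g.mat 1 1 / g.mat 1 0)) := by
  have hdet := det_eq g.mat
  obtain ⟨e1, e2, e3, e4⟩ := mul_borel_mat (g.mat 0 0 / g.mat 1 0) (-(Units.mk0 _ hc)⁻¹)
    (w 1 * x (g.mat 1 1 / g.mat 1 0))
  obtain ⟨l1, l2, l3, l4⟩ := w_mul_x_mat (g.mat 1 1 / g.mat 1 0)
  rw [l1, l3] at e1
  rw [l2, l4] at e2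
  rw [l3] at e3
  rw [l4] at e4
  refine exists_eq_mu_mul_mul (mat_ext ?_ ?_ ?_ ?_)
  · rw [e1]
    simp only [Units.val_neg, Units.val_inv_eq_inv_val, Units.val_mk0, inv_inv, inv_neg]
    field_simp
    ring
  · rw [e2]
    simp only [Units.val_neg, Units.val_inv_eq_inv_val, Units.val_mk0, inv_inv, inv_neg]
    field_simp
    linear_combination -hdet
  · rw [e3]
    simp
  · rw [e4]
    simp only [Units.val_neg, Units.val_inv_eq_inv_val, Units.val_mk0, inv_inv, inv_neg]
    field_simp

lemma x_mem_K₀ {u : ℚ_[2]} (hu : ‖u‖ ≤ 1) : x u ∈ K₀ := by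
  obtain ⟨x1, x2, x3, x4⟩ := x_mat u
  refine ⟨fun i j => ?_, by rw [x3]; simp⟩
  fin_cases i <;> fin_cases j <;> simp [x1, x2, x3, x4, hu]

lemma h_mem_K₀ {t : ℚ_[2]ˣ} (ht : ‖(t : ℚ_[2])‖ = 1) : h t ∈ K₀ := by
  obtain ⟨x1, x2, x3, x4⟩ := h_mat t
  refine ⟨fun i j => ?_, by rw [x3]; simp⟩
  fin_cases i <;> fin_cases j <;> simp [x1, x2, x3, x4, ht]

lemma lower_mem_K {c : ℚ_[2]} (hc : ‖c‖ ≤ 1) : lower c ∈ K := by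
  obtain ⟨x1, x2, x3, x4⟩ := lower_mat c
  intro i j
  fin_cases i <;> fin_cases j <;> simp [x1, x2, x3, x4, hc]

lemma lower_mem_K₀ {c : ℚ_[2]} (hc : ‖c‖ ≤ 1 / 4) : lower c ∈ K₀ :=
  ⟨lower_mem_K (by linarith), by rw [(lower_mat c).2.2.1]; exact hc⟩

lemma mu_mem_K₀ (ε : ℤˣ) : mu ε ∈ K₀ := by
  refine ⟨fun i j => ?_, by simp [mu]⟩
  fin_cases i <;> fin_cases j <;> simp [mu]

lemma mul_mem_K {k k' : Mp} (hk : k ∈ K) (hk' : k' ∈ K) : k * k' ∈ K := by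
  intro i j
  rw [Mp.mul_mat]
  have : (k.mat * k'.mat) i j = k.mat i 0 * k'.mat 0 j + k.mat i 1 * k'.mat 1 j := by
    simp [Matrix.mul_apply, Fin.sum_univ_two]
  rw [this]
  refine (Padic.nonarchimedean _ _).trans (max_le ?_ ?_) <;> rw [norm_mul]
  · exact mul_le_one₀ (hk i 0) (norm_nonneg _) (hk' 0 j)
  · exact mul_le_one₀ (hk i 1) (norm_nonneg _) (hk' 1 j)

lemma mul_mem_K₀ {k k' : Mp} (hk : k ∈ K₀) (hk' : k' ∈ K₀) : k * k' ∈ K₀ := by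
  refine ⟨mul_mem_K hk.1 hk'.1, ?_⟩
  rw [Mp.mul_mat, mul_one_zero]
  refine (Padic.nonarchimedean _ _).trans (max_le ?_ ?_) <;> rw [norm_mul]
  · nlinarith [hk.2, hk'.1 0 0, norm_nonneg (k.mat 1 0), norm_nonneg (k'.mat 0 0)]
  · nlinarith [hk'.2, hk.1 1 1, norm_nonneg (k.mat 1 1), norm_nonneg (k'.mat 1 0)]

lemma w_mem_K : w 1 ∈ K := by
  obtain ⟨x1, x2, x3, x4⟩ := w_mat
  intro i j
  fin_cases i <;> fin_cases j <;> simp [x1, x2, x3, x4]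

/-- The Iwasawa decomposition. -/
lemma exists_iwasawa (g : Mp) :
    ∃ (ε : ℤˣ) (u : ℚ_[2]) (t : ℚ_[2]ˣ) (k : Mp), k ∈ K ∧ g = mu ε * x u * h t * k := by
  rcases le_total ‖g.mat 1 0‖ ‖g.mat 1 1‖ with hcd | hcd
  · have hd : g.mat 1 1 ≠ 0 := by
      intro h0
      rw [h0, norm_zero, norm_le_zero_iff] at hcd
      exact one_one_ne_zero hcd h0
    obtain ⟨ε, e⟩ := exists_eq_lower hd
    refine ⟨ε, _, _, _, lower_mem_K ?_, e⟩
    rw [norm_div]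
    exact div_le_one_of_le₀ hcd (norm_nonneg _)
  · have hc := big_ne_zero hcd
    obtain ⟨ε, e⟩ := exists_eq_w_mul_x hc
    refine ⟨ε, _, _, _, mul_mem_K w_mem_K (x_mem_K₀ ?_).1, e⟩
    rw [norm_div]
    exact div_le_one_of_le₀ hcd (norm_nonneg _)

lemma exists_eq_of_mem_K₀ {k : Mp} (hk : k ∈ K₀) :
    ∃ (ε : ℤˣ) (u : ℚ_[2]) (t : ℚ_[2]ˣ) (c : ℚ_[2]), ‖u‖ ≤ 1 ∧ ‖(t : ℚ_[2])‖ = 1 ∧ ‖c‖ ≤ 1 / 4 ∧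
      k = mu ε * x u * h t * lower c := by
  have hd := (norm_zero_zero_eq_one hk).2
  obtain ⟨ε, e⟩ := exists_eq_lower (ne_zero_of_norm_eq_one hd)
  refine ⟨ε, _, _, _, ?_, ?_, ?_, e⟩
  · rw [norm_div, hd, div_one]; exact hk.1 0 1
  · simp [hd]
  · rw [norm_div, hd, div_one]; exact hk.2

/-! ### The explicit vectors on `K`, right equivariance under `K₀`, and uniqueness -/

lemma hilbert_of_even {c v : ℚ_[2]} (hc : c ≠ 0) (he : Even c.valuation) (hv : ‖v - 1‖ ≤ 1 / 4) :
    hilbert c v = 1 := by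
  obtain ⟨m, hm⟩ := he
  have h1 := norm_mul_two_zpow hc
  have h2 : c = c * 2 ^ (-c.valuation) * (2 ^ m) ^ 2 := by
    rw [hm, ← zpow_ofNat, ← zpow_mul, mul_assoc, ← zpow_add₀ two_ne_zero]
    rw [show -(m + m) + m * 2 = 0 by ring, zpow_zero, mul_one]
  rw [h2, hilbert_mul_sq_left _ _ (zpow_ne_zero _ two_ne_zero), hilbert_comm,
    hilbert_unit_eq_one hv h1]

lemma norm_one_one_sub_le {k : Mp} (hk : k ∈ K₀) {ε : ℚ_[2]} (hε : ε * ε = 1)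
    (ha : ‖k.mat 0 0 - ε‖ ≤ 1 / 4) : ‖k.mat 1 1 - ε‖ ≤ 1 / 4 := by
  have hn := norm_zero_zero_eq_one hk
  have ha0 := ne_zero_of_norm_eq_one hn.1
  have hdet := det_eq k.mat
  have e : k.mat 1 1 - ε = (k.mat 0 0)⁻¹ * (k.mat 0 1 * k.mat 1 0) + ((k.mat 0 0)⁻¹ - ε) := by
    field_simp
    linear_combination hdet
  rw [e]
  refine (Padic.nonarchimedean _ _).trans (max_le ?_ ?_)
  · rw [norm_mul, norm_mul, norm_inv, hn.1, inv_one, one_mul]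
    nlinarith [hk.1 0 1, hk.2, norm_nonneg (k.mat 0 1), norm_nonneg (k.mat 1 0)]
  · rwa [norm_unit_inv_sub _ hn.1 hε]

lemma sSign_eq_of_ne {g : SL(2, ℚ_[2])} (hc : g 1 0 ≠ 0) (hd : g 1 1 ≠ 0) :
    (Odd (g 1 0).valuation ∧ sSign g = hilbert (g 1 0) (g 1 1)) ∨
      (Even (g 1 0).valuation ∧ sSign g = 1) := by
  rcases Int.even_or_odd (g 1 0).valuation with he | ho
  · exact Or.inr ⟨he, sSign_of_even he⟩
  · exact Or.inl ⟨ho, if_pos ⟨mul_ne_zero hc hd, ho⟩⟩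

lemma phiFun_of_mem_K₀ (i e d s : ℂ) {k : Mp} (hk : k ∈ K₀) :
    phiFun i e d s k = d * (cs k.sign * cs (sSign k.mat) *
      cs (hilbert (xEntry k.mat * k.mat 1 1) (k.mat 1 1)) * torusChar i (k.mat 1 1)) := by
  have hd := (norm_zero_zero_eq_one hk).2
  rw [phiFun, rowFun_small i e d s (by rw [hd]; exact hk.2), hd, twist, cs_mul]
  simp only [Complex.ofReal_one, Complex.one_cpow]
  ring

/-- Here the factor s(g) of σ does its work. For d ∈ 1 + 4ℤ₂ the symbol in `rowFun` is (c, d): for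
odd ord(c) it is cancelled by `sSign`, and for even ord(c) it is already trivial. If d ∈ -1 + 4ℤ₂
the same argument applies to -k, and the sign of passing to -k is the cocycle in
`charK₀_of_neg_one`. -/
lemma phiFun_eq_charK₀ {γ : Mp → ℂ} (hγ : IsGenuineCentralCharacter γ) (e d s : ℂ) {k : Mp}
    (hk : k ∈ K₀) : phiFun (γ (h (-1))) e d s k = d * charK₀ γ k := by
  have hn := norm_zero_zero_eq_one hk
  have hd0 := ne_zero_of_norm_eq_one hn.2
  rw [phiFun_of_mem_K₀ _ _ _ _ hk]
  congr 1
  rcases norm_sub_one_or_add_one hn.1 with ha | ha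
  · have hd1 := norm_one_one_sub_le hk (ε := 1) (by ring) ha
    rw [charK₀_of_one hγ hk ha, torusChar_of_one _ hd1, mul_one, mul_assoc, ← cs_mul]
    have : sSign k.mat * hilbert (xEntry k.mat * k.mat 1 1) (k.mat 1 1) = 1 := by
      by_cases hc : k.mat 1 0 = 0
      · rw [sSign_of_eq hc, xEntry_of_eq hc, ← sq, hilbert_sq_left, one_mul]
      · rw [xEntry_of_ne hc, hilbert_mul_left hc hd0 hd0, hilbert_self_of_one hd1, mul_one]
        rcases sSign_eq_of_ne hc hd0 with ⟨-, hs⟩ | ⟨he, hs⟩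
        · rw [hs, Int.units_mul_self]
        · rw [hs, hilbert_of_even hc he hd1, one_mul]
    rw [this, cs_one, mul_one]
  · have hd1 := norm_one_one_sub_le hk (ε := -1) (by ring) (by simpa using ha)
    rw [sub_neg_eq_add] at hd1
    have hd2 : ‖-k.mat 1 1 - 1‖ ≤ 1 / 4 := by rwa [norm_neg_sub_one]
    rw [charK₀_of_neg_one hγ hk ha, torusChar_of_neg_one _ hd1, mul_assoc (cs k.sign), ← cs_mul,
      ← cs_mul]
    congr 3
    rw [cocycle_eq, kubota_of_left _ (by rw [neg_entry]; simp), neg_mul_neg, one_mul, xEntry_neg,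
      sSign_of_eq (g := -1) (by rw [neg_entry]; simp), mul_one, mul_comm, neg_entry]
    have h1 : (1 : SL(2, ℚ_[2])) 1 1 = 1 := by simp
    rw [h1]
    congr 1
    by_cases hc : k.mat 1 0 = 0
    · rw [xEntry_of_eq hc, ← sq, hilbert_sq_left, sSign_of_eq (by rw [neg_entry, hc, neg_zero]),
        hilbert_unit_eq_one hd2 (by simp), one_mul]
    · have hc' : -k.mat 1 0 ≠ 0 := neg_ne_zero.2 hc
      have hn1 : (-1 : ℚ_[2]) ≠ 0 := by simp
      have e1 : hilbert (k.mat 1 0 * k.mat 1 1) (k.mat 1 1) =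
          hilbert (-k.mat 1 0) (k.mat 1 1) := by
        have := hilbert_mul_left (mul_ne_zero hc hd0) (neg_ne_zero.2 hd0) hd0
        rw [hilbert_comm (-k.mat 1 1), hilbert_neg_self, mul_one] at this
        rw [← this, show k.mat 1 0 * k.mat 1 1 * -k.mat 1 1 = -k.mat 1 0 * k.mat 1 1 ^ 2 by ring,
          hilbert_mul_sq_left _ _ hd0]
      have e2 := hilbert_mul_right hc' hn1 (neg_ne_zero.2 hd0)
      rw [neg_mul_neg, one_mul] at e2
      rw [xEntry_of_ne hc, e1, e2]
      rcases sSign_eq_of_ne (g := -k.mat) (by rwa [neg_entry]) (by rwa [neg_entry, neg_ne_zero])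
        with ⟨-, hs⟩ | ⟨he, hs⟩
      · rw [hs, neg_entry, neg_entry]
      · rw [neg_entry] at he
        rw [hs, hilbert_of_even hc' he hd2]

lemma phiFun_one (i e d s : ℂ) : phiFun i e d s 1 = d := by
  have h1 : (1 : Mp) ∈ K₀ := mu_mem_K₀ 1
  rw [phiFun_of_mem_K₀ _ _ _ _ h1, Mp.one_mat, xEntry_one, sSign_one]
  have h2 : (1 : SL(2, ℚ_[2])) 1 1 = 1 := by simp
  rw [h2, hilbert_one_right, torusChar_one]
  simp [cs_one, Mp.one_sign]

lemma phiFun_mul_of_decomp {i : ℂ} (hi : i ^ 2 = -1) (e d s : ℂ) (g : Mp) {ε : ℤˣ} {u c : ℚ_[2]}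
    {t : ℚ_[2]ˣ} (hu : ‖u‖ ≤ 1) (ht : ‖(t : ℚ_[2])‖ = 1) (hc : ‖c‖ ≤ 1 / 4) :
    phiFun i e d s (g * (mu ε * x u * h t * lower c)) =
      cs ε * torusChar i t * phiFun i e d s g := by
  rw [← mul_assoc, ← mul_assoc, ← mul_assoc, phiFun_mul_lower hi _ _ _ _ hc,
    phiFun_mul_h hi _ _ _ _ ht, phiFun_mul_x hi _ _ _ _ hu, phiFun_mul_mu]
  ring

/-- Read off from the vector with e = 0 and d = 1: it restricts to `charK₀` on K₀, and its right
translates are already known. -/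
lemma charK₀_of_decomp {γ : Mp → ℂ} (hγ : IsGenuineCentralCharacter γ) {ε : ℤˣ} {u c : ℚ_[2]}
    {t : ℚ_[2]ˣ} (hu : ‖u‖ ≤ 1) (ht : ‖(t : ℚ_[2])‖ = 1) (hc : ‖c‖ ≤ 1 / 4) :
    charK₀ γ (mu ε * x u * h t * lower c) = cs ε * torusChar (γ (h (-1))) t := by
  have h1 := phiFun_mul_of_decomp (gamma_h_neg_one_sq hγ) 0 1 0 1 (ε := ε) hu ht hc
  rw [one_mul, phiFun_one, phiFun_eq_charK₀ hγ _ _ _ (mul_mem_K₀ (mul_mem_K₀ (mul_mem_K₀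
    (mu_mem_K₀ ε) (x_mem_K₀ hu)) (h_mem_K₀ ht)) (lower_mem_K₀ hc))] at h1
  simpa using h1

lemma phiFun_mul_of_mem_K₀ {γ : Mp → ℂ} (hγ : IsGenuineCentralCharacter γ) (e d s : ℂ) (g : Mp)
    {k : Mp} (hk : k ∈ K₀) :
    phiFun (γ (h (-1))) e d s (g * k) = charK₀ γ k * phiFun (γ (h (-1))) e d s g := by
  obtain ⟨ε, u, t, c, hu, ht, hc, rfl⟩ := exists_eq_of_mem_K₀ hk
  rw [phiFun_mul_of_decomp (gamma_h_neg_one_sq hγ) _ _ _ _ hu ht hc, charK₀_of_decomp hγ hu ht hc]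

/-- Multiplicativity on K₀ is inherited from the equivariance of the explicit vector, so the
splitting of the cover over K₁ needs no separate cocycle computation. -/
lemma charK₀_mul {γ : Mp → ℂ} (hγ : IsGenuineCentralCharacter γ) {k k' : Mp} (hk : k ∈ K₀)
    (hk' : k' ∈ K₀) : charK₀ γ (k * k') = charK₀ γ k * charK₀ γ k' := by
  have h1 := phiFun_mul_of_mem_K₀ hγ 0 1 0 k hk'
  rw [phiFun_eq_charK₀ hγ _ _ _ hk, phiFun_eq_charK₀ hγ _ _ _ (mul_mem_K₀ hk hk')] at h1
  linear_combination h1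

lemma charK₀_pow_four {γ : Mp → ℂ} (hγ : IsGenuineCentralCharacter γ) {k : Mp} (hk : k ∈ K₀) :
    charK₀ γ k ^ 4 = 1 := by
  obtain ⟨ε, u, t, c, hu, ht, hc, rfl⟩ := exists_eq_of_mem_K₀ hk
  rw [charK₀_of_decomp hγ hu ht hc, mul_pow, cs_pow_four,
    torusChar_pow_four (gamma_h_neg_one_sq hγ) t.ne_zero, one_mul]

lemma sSign_of_norm_eq_one {g : SL(2, ℚ_[2])} (hg : ‖g 1 0‖ = 1) : sSign g = 1 :=
  sSign_of_even (by rw [valuation_eq_zero hg]; exact Even.zero)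

lemma w_mul_x_sign (u : ℚ_[2]) : (w 1 * x u).sign = 1 := by
  obtain ⟨x1, x2, x3, x4⟩ := x_mat u
  obtain ⟨w1, w2, w3, w4⟩ := w_mat
  obtain ⟨y1, y2, y3, y4⟩ := w_mul_x_mat u
  rw [Mp.mul_mat] at y3
  have e1 : xEntry (w 1).mat = -1 := by rw [xEntry_of_ne (by rw [w3]; simp), w3]
  have e2 : xEntry ((w 1).mat * (x u).mat) = -1 := by rw [xEntry_of_ne (by rw [y3]; simp), y3]
  rw [Mp.mul_sign, cocycle_eq, kubota, sSign_of_norm_eq_one (by rw [w3]; simp),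
    sSign_of_norm_eq_one (g := (w 1).mat * (x u).mat) (by rw [y3]; simp), sSign_of_eq x3, e1, e2,
    neg_mul_neg, one_mul, hilbert_one_left]
  simp [w, x, sec]

lemma lower_mul_w (c : ℚ_[2]) : lower c * w 1 = w 1 * x (-c) := by
  obtain ⟨x1, x2, x3, x4⟩ := lower_mat c
  obtain ⟨w1, w2, w3, w4⟩ := w_mat
  obtain ⟨y1, y2, y3, y4⟩ := w_mul_x_mat (-c)
  have z3 : ((lower c).mat * (w 1).mat) 1 0 = -1 := by rw [mul_one_zero, x3, x4, w1, w3]; ring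
  refine Mp.ext (mat_ext ?_ ?_ ?_ ?_) ?_
  · rw [y1, Mp.mul_mat, mul_zero_zero, x1, x2, w1, w3]; ring
  · rw [y2, Mp.mul_mat, mul_zero_one, x1, x2, w2, w4]; ring
  · rw [y3, Mp.mul_mat, z3]
  · rw [y4, Mp.mul_mat, mul_one_one, x3, x4, w2, w4]; ring
  · have e1 : xEntry (w 1).mat = -1 := by rw [xEntry_of_ne (by rw [w3]; simp), w3]
    have e2 : xEntry ((lower c).mat * (w 1).mat) = -1 := by
      rw [xEntry_of_ne (by rw [z3]; simp), z3]
    have hs : sSign (lower c).mat = 1 := by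
      rw [sSign, x4, hilbert_one_right, ite_self]
    rw [w_mul_x_sign, Mp.mul_sign, cocycle_eq, kubota, sSign_of_norm_eq_one (g := (w 1).mat)
      (by rw [w3]; simp), sSign_of_norm_eq_one (g := (lower c).mat * (w 1).mat) (by rw [z3]; simp), hs, e1, e2,
      neg_mul_neg, one_mul, hilbert_one_right]
    simp [w, lower, sec]

lemma phiFun_w_mul_x (i e d s : ℂ) {u : ℚ_[2]} (hu : ‖u‖ ≤ 1) :
    phiFun i e d s (w 1 * x u) = e * torusChar i (-1) := by
  obtain ⟨y1, y2, y3, y4⟩ := w_mul_x_mat u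
  rw [phiFun, twist, w_mul_x_sign, sSign_of_norm_eq_one (by rw [y3]; simp),
    rowFun_big _ _ _ _ (by rw [y3, y4]; simpa using hu), y3]
  simp [cs_one]

/-- The coefficient of `phiFun` on the big cell. -/
def bigCoeff (γ : Mp → ℂ) : ℂ := -γ (h (-1)) * ((Real.sqrt 2 : ℂ)⁻¹ * zeta γ)

/-- The lower left entry of w(1) is -1, where `torusChar` takes the value i; the factor -i in
`bigCoeff` compensates for it. -/
lemma bigCoeff_mul {γ : Mp → ℂ} (hγ : IsGenuineCentralCharacter γ) :
    bigCoeff γ * torusChar (γ (h (-1))) (-1) = (Real.sqrt 2 : ℂ)⁻¹ * zeta γ := by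
  rw [torusChar_neg_one, bigCoeff]
  linear_combination (-((Real.sqrt 2 : ℂ)⁻¹ * zeta γ)) * gamma_h_neg_one_sq hγ

lemma isPhi_phiFun {γ : Mp → ℂ} (hγ : IsGenuineCentralCharacter γ) (s d : ℂ) :
    IsPhi γ s d (phiFun (γ (h (-1))) (bigCoeff γ) d s) := by
  have hi := gamma_h_neg_one_sq hγ
  refine ⟨⟨⟨2, fun k hk g => ?_⟩, fun ε u t g => ?_⟩, fun k hk => ?_, fun k hk k' hk' => ?_,
    fun k hk hk₀ hkw => ?_⟩
  -- Level 4 suffices for smoothness: on this subgroup the section lands in K₁, where the character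
  -- is trivial.
  · have hk' : sec k ∈ K₀ ∧ ‖(sec k).mat 0 0 - 1‖ ≤ 1 / 4 := by
      have h00 := hk 0 0
      have h10 := hk 1 0
      norm_num at h00 h10
      refine ⟨⟨fun i j => ?_, by norm_num [sec]; exact h10⟩, by norm_num [sec]; exact h00⟩
      have h1 := hk i j
      have h2 : ‖(1 : Matrix (Fin 2) (Fin 2) ℚ_[2]) i j‖ ≤ 1 := by
        rw [Matrix.one_apply]; split_ifs <;> simp
      have h3 := Padic.nonarchimedean (k i j - (1 : Matrix (Fin 2) (Fin 2) ℚ_[2]) i j)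
        ((1 : Matrix (Fin 2) (Fin 2) ℚ_[2]) i j)
      rw [sub_add_cancel] at h3
      exact h3.trans (max_le (h1.trans (by norm_num)) h2)
    rw [phiFun_mul_of_mem_K₀ hγ _ _ _ _ hk'.1, charK₀_of_one hγ hk'.1 hk'.2]
    simp [sec, cs_one]
  · rw [charT_eq hγ]
    exact phiFun_borel hi _ _ _ ε u t g
  · exact phiFun_eq_charK₀ hγ _ _ _ hk
  · rw [phiFun_mul_of_mem_K₀ hγ _ _ _ _ hk', charK₀_mul hγ hk hk']
    -- The upper triangular part of k comes out on the left, and the lower unipotent part passes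
    -- through w(1) to become an integral x(-c).
    obtain ⟨ε, u, t, c, hu, ht, hc, rfl⟩ := exists_eq_of_mem_K₀ hk
    rw [charK₀_of_decomp hγ hu ht hc, mul_assoc _ (lower c) (w 1), lower_mul_w,
      phiFun_borel hi, ht, phiFun_w_mul_x _ _ _ _ (by rw [norm_neg]; linarith), bigCoeff_mul hγ]
    simp only [Complex.ofReal_one, Complex.one_cpow]
    ring
  · by_cases h1 : ‖k.mat 1 0‖ ≤ ‖k.mat 1 1‖ / 4
    · exact absurd ⟨hk, by linarith [hk 1 1]⟩ hk₀
    by_cases h2 : ‖k.mat 1 1‖ ≤ ‖k.mat 1 0‖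
    · exfalso
      have hc := big_ne_zero h2
      -- The bottom row is primitive because the determinant is 1, and c is its larger entry.
      have hcn : ‖k.mat 1 0‖ = 1 := by
        refine le_antisymm (hk 1 0) ?_
        have h3 := Padic.nonarchimedean (k.mat 0 0 * k.mat 1 1) (-(k.mat 0 1 * k.mat 1 0))
        rw [← sub_eq_add_neg, det_eq, norm_neg, norm_mul, norm_mul, norm_one] at h3
        rcases le_max_iff.1 h3 with h4 | h4
        · nlinarith [hk 0 0, norm_nonneg (k.mat 1 1)]
        · nlinarith [hk 0 1, norm_nonneg (k.mat 1 0)]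
      obtain ⟨ε, e⟩ := exists_eq_w_mul_x hc
      rw [← mul_assoc] at e
      refine hkw ⟨_, mul_mem_K₀ (mul_mem_K₀ (mu_mem_K₀ ε) (x_mem_K₀ ?_)) (h_mem_K₀ ?_), _,
        x_mem_K₀ ?_, e⟩
      · rw [norm_div, hcn, div_one]; exact hk 0 0
      · simp [hcn]
      · rw [norm_div, hcn, div_one]; exact hk 1 1
    · rw [phiFun, rowFun_mid _ _ _ _ h1 h2, mul_zero]

lemma IsPhi.eq {γ : Mp → ℂ} {s d : ℂ} {φ φ' : Mp → ℂ} (hφ : IsPhi γ s d φ)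
    (hφ' : IsPhi γ s d φ') : φ = φ' := by
  have hK : ∀ k ∈ K, φ k = φ' k := by
    intro k hk
    by_cases h0 : k ∈ K₀
    · rw [hφ.2.1 k h0, hφ'.2.1 k h0]
    by_cases hw : ∃ k₀ ∈ K₀, ∃ k₀' ∈ K₀, k = k₀ * w 1 * k₀'
    · obtain ⟨k₀, hk₀, k₀', hk₀', rfl⟩ := hw
      rw [hφ.2.2.1 _ hk₀ _ hk₀', hφ'.2.2.1 _ hk₀ _ hk₀']
    · rw [hφ.2.2.2 k hk h0 hw, hφ'.2.2.2 k hk h0 hw]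
  funext g
  obtain ⟨ε, u, t, k, hk, rfl⟩ := exists_iwasawa g
  rw [hφ.1.2, hφ'.1.2, hK k hk]

lemma phi_eq {γ : Mp → ℂ} (hγ : IsGenuineCentralCharacter γ) (s d : ℂ) :
    phi γ s d = phiFun (γ (h (-1))) (bigCoeff γ) d s :=
  (Classical.epsilon_spec ⟨_, isPhi_phiFun hγ s d⟩ : IsPhi γ s d (phi γ s d)).eq
    (isPhi_phiFun hγ s d)

/-! ### Haar measure on `ℚ₂` -/

open scoped Pointwise in
-- Both sides are homomorphisms, so units and 2 suffice. Units preserve ℤ₂, while ℤ₂ is the disjoint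
-- union of 2ℤ₂ and a translate of it.
lemma distribHaarChar_eq_norm [MeasurableSpace ℚ_[2]] [BorelSpace ℚ_[2]] (t : ℚ_[2]ˣ) :
    distribHaarChar ℚ_[2] t = ‖(t : ℚ_[2])‖₊ := by
  let μ : Measure ℚ_[2] := Measure.addHaar
  have hball : ∀ t : ℚ_[2]ˣ, t • Metric.closedBall (0 : ℚ_[2]) 1 =
      Metric.closedBall (0 : ℚ_[2]) ‖(t : ℚ_[2])‖ := by
    intro t
    ext u
    have htn := norm_pos_iff.2 t.ne_zero
    rw [Set.mem_smul_set_iff_inv_smul_mem, Units.smul_def, smul_eq_mul, mem_closedBall_zero_iff,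
      mem_closedBall_zero_iff, norm_mul, Units.val_inv_eq_inv_val, norm_inv, inv_mul_le_one₀ htn]
  have h0 : μ (Metric.closedBall 0 1) ≠ 0 :=
    (Metric.measure_closedBall_pos μ _ one_pos).ne'
  have h1 : μ (Metric.closedBall 0 1) ≠ ⊤ := (isCompact_closedBall _ _).measure_lt_top.ne
  have hunit : ∀ v : ℚ_[2]ˣ, ‖(v : ℚ_[2])‖ = 1 → distribHaarChar ℚ_[2] v = 1 := by
    intro v hv
    refine distribHaarChar_eq_of_measure_smul_eq_mul (μ := μ) h0 h1 ?_
    rw [hball, hv]; simp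
  have htwo : distribHaarChar ℚ_[2] two = 1 / 2 := by
    refine distribHaarChar_eq_of_measure_smul_eq_mul (μ := μ) h0 h1 ?_
    have e2 : ‖(two : ℚ_[2])‖ = 1 / 2 := norm_two
    rw [hball, e2]
    have hu : Metric.closedBall (0 : ℚ_[2]) 1 =
        Metric.closedBall 0 (1 / 2) ∪ (fun u => u + 1) ⁻¹' Metric.closedBall 0 (1 / 2) := by
      ext u
      simp only [Set.mem_union, Set.mem_preimage, mem_closedBall_zero_iff]
      constructor
      · intro hu
        obtain ⟨m, hm, h⟩ := exists_nat_norm_sub_le hu 1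
        norm_num at hm h
        interval_cases m
        · left; simpa using h
        · right
          have := Padic.nonarchimedean (u - 1) 2
          rw [show u - 1 + 2 = u + 1 by ring, norm_two] at this
          exact this.trans (max_le (by simpa using h) le_rfl)
      · rintro (h | h)
        · linarith
        · have := Padic.nonarchimedean (u + 1) (-1)
          rw [show u + 1 + -1 = u by ring, norm_neg, norm_one] at this
          exact this.trans (max_le (by linarith) le_rfl)
    have hdisj : Disjoint (Metric.closedBall (0 : ℚ_[2]) (1 / 2))
        ((fun u => u + 1) ⁻¹' Metric.closedBall 0 (1 / 2)) := by
      rw [Set.disjoint_left]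
      intro u h h'
      simp only [Set.mem_preimage, mem_closedBall_zero_iff] at h h'
      have := Padic.nonarchimedean (u + 1) (-u)
      rw [show u + 1 + -u = 1 by ring, norm_neg, norm_one] at this
      rcases le_max_iff.1 this with h1 | h1 <;> linarith
    have hm := measure_union hdisj
      ((Metric.isClosed_closedBall.measurableSet).preimage (measurable_id.add_const 1)) (μ := μ)
    rw [← hu, measure_preimage_add_right, ← two_mul] at hm
    rw [hm, ← mul_assoc]
    have : ((1 / 2 : NNReal) : ENNReal) * 2 = 1 := by
      rw [← ENNReal.coe_ofNat, ← ENNReal.coe_mul]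
      simp
    rw [this, one_mul]
  obtain ⟨n, v, hv, e⟩ := exists_eq_two_zpow_mul t.ne_zero
  have hv0 := ne_zero_of_norm_eq_one hv
  have ht : t = two ^ n * Units.mk0 v hv0 := by
    ext
    rw [e, Units.val_mul, Units.val_zpow_eq_zpow_val]
    rfl
  rw [ht, map_mul, map_zpow, htwo, hunit _ hv, mul_one, Units.val_mul, Units.val_zpow_eq_zpow_val]
  ext
  push_cast
  rw [Units.val_mk0, norm_mul, hv, norm_zpow]
  have e2 : ‖(two : ℚ_[2])‖ = 1 / 2 := norm_two
  rw [e2, mul_one]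

lemma norm_eq_two_zpow {u : ℚ_[2]} (hu : u ≠ 0) : ∃ n : ℤ, ‖u‖ = 2 ^ n := by
  refine ⟨-u.valuation, ?_⟩
  rw [Padic.norm_eq_zpow_neg_valuation hu]
  norm_num

lemma norm_le_of_lt_two_zpow {u : ℚ_[2]} {n : ℤ} (hu : ‖u‖ < 2 ^ n) : ‖u‖ ≤ 2 ^ (n - 1) := by
  have := (Padic.norm_lt_pow_iff_norm_le_pow_sub_one u n).1 (by simpa using hu)
  simpa using this

/-! ### Local constancy of the torus character and its symmetries on shells -/

lemma torusChar_mul_sq {i : ℂ} (hi : i ^ 2 = -1) {a r : ℚ_[2]} (ha : a ≠ 0) (hr : r ≠ 0) :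
    torusChar i (a * r ^ 2) = torusChar i a := by
  have h1 := torusChar_sq hi hr
  rw [torusChar_mul hi ha (pow_ne_zero _ hr), hilbert_comm, hilbert_sq_left, cs_one, one_mul, sq,
    torusChar_mul hi hr hr, h1, ← cs_mul, hilbert_self hr, Int.units_mul_self, cs_one, mul_one]

/-- The function is locally constant: b/a is a square as soon as b is close enough to a. -/
lemma continuousAt_torusChar {i : ℂ} (hi : i ^ 2 = -1) {a : ℚ_[2]} (ha : a ≠ 0) :
    ContinuousAt (torusChar i) a := by
  have han := norm_pos_iff.2 ha
  refine (continuousAt_const (y := torusChar i a)).congr ?_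
  filter_upwards [Metric.closedBall_mem_nhds a (show 0 < ‖a‖ / 8 by positivity)] with b hb
  rw [mem_closedBall_iff_norm] at hb
  obtain ⟨r, hr, e⟩ := exists_sq_of_norm_sub_one_le (v := b / a) (by
    rw [div_sub_one ha, norm_div, div_le_iff₀ han]
    linarith)
  rw [← torusChar_mul_sq hi ha hr, ← e]
  congr 1
  field_simp

/-- For even valuation the power of 2 is a square, so only the unit part modulo 4 counts, and
exactly one of v, -v is 1 modulo 4. -/
lemma torusChar_add_neg {i : ℂ} {a : ℚ_[2]} {n : ℤ} (ha : ‖a‖ = 2 ^ n) (hn : Even n) :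
    torusChar i a + torusChar i (-a) = 1 + i := by
  have ha0 : a ≠ 0 := norm_pos_iff.1 (by rw [ha]; positivity)
  obtain ⟨m, v, hv, rfl⟩ := exists_eq_two_zpow_mul ha0
  rw [norm_two_zpow_mul m hv] at ha
  have hm : n = -m := (zpow_right_injective₀ (by norm_num) (by norm_num) ha).symm
  obtain ⟨k, hk⟩ : Even m := by simpa [hm] using hn
  have hsq : (2 : ℚ_[2]) ^ m = (2 ^ k) ^ 2 := by
    rw [hk, zpow_add₀ two_ne_zero, sq]
  rw [← mul_neg, torusChar_two_zpow_mul i m hv, torusChar_two_zpow_mul i m (by rwa [norm_neg]), hsq,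
    hilbert_sq_left, hilbert_sq_left, cs_one, one_mul, one_mul]
  rcases norm_sub_one_or_add_one hv with h1 | h1
  · rw [unitChar_of_one i h1, unitChar_of_neg_one i (by rwa [norm_neg_add_one])]
  · rw [unitChar_of_neg_one i h1, unitChar_of_one i (by rwa [norm_neg_sub_one]), add_comm]

lemma torusChar_five_mul {i : ℂ} (hi : i ^ 2 = -1) {a : ℚ_[2]} {n : ℤ} (ha : ‖a‖ = 2 ^ n)
    (hn : Odd n) : torusChar i (5 * a) = -torusChar i a := by
  have ha0 : a ≠ 0 := norm_pos_iff.1 (by rw [ha]; positivity)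
  obtain ⟨m, v, hv, rfl⟩ := exists_eq_two_zpow_mul ha0
  rw [norm_two_zpow_mul m hv] at ha
  have hm : n = -m := (zpow_right_injective₀ (by norm_num) (by norm_num) ha).symm
  obtain ⟨k, hk⟩ : Odd m := by simpa [hm] using hn
  have h5 : ‖(5 : ℚ_[2]) - 1‖ ≤ 1 / 4 := by
    rw [show (5 : ℚ_[2]) - 1 = 2 * 2 by norm_num, norm_mul, norm_two]; norm_num
  have h50 := ne_zero_of_norm_eq_one (norm_eq_one_of_norm_sub_one h5)
  have hsq : (2 : ℚ_[2]) ^ m = 2 * (2 ^ k) ^ 2 := by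
    rw [hk, zpow_add₀ two_ne_zero, zpow_one, mul_comm 2 k, zpow_mul, zpow_ofNat, mul_comm]
  have hk0 : (2 : ℚ_[2]) ^ k ≠ 0 := zpow_ne_zero _ two_ne_zero
  rw [torusChar_mul hi h50 ha0, torusChar_of_one i h5,
    hilbert_mul_right h50 (zpow_ne_zero _ two_ne_zero) (ne_zero_of_norm_eq_one hv),
    hilbert_unit_eq_one h5 hv, hsq, hilbert_mul_sq_right _ _ hk0, hilbert_comm, hilbert_two_five]
  simp [cs_neg_one]

lemma measure_ball_ne_top [MeasurableSpace ℚ_[2]] (μ : Measure ℚ_[2]) [μ.IsAddHaarMeasure] (r : ℝ) :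
    μ {u : ℚ_[2] | ‖u‖ ≤ r} ≠ ⊤ := by
  have : {u : ℚ_[2] | ‖u‖ ≤ r} = Metric.closedBall 0 r := by
    ext u; simp
  rw [this]
  exact (isCompact_closedBall _ _).measure_lt_top.ne

lemma measure_shell_ne_top [MeasurableSpace ℚ_[2]] (μ : Measure ℚ_[2])
    [μ.IsAddHaarMeasure] (r : ℝ) :
    μ {u : ℚ_[2] | ‖u‖ = r} ≠ ⊤ :=
  ne_top_of_le_ne_top (measure_ball_ne_top μ r) (measure_mono fun _ h => le_of_eq h)

section Haar

variable [MeasurableSpace ℚ_[2]] [BorelSpace ℚ_[2]]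

open scoped Pointwise in
lemma map_mul_left_eq (μ : Measure ℚ_[2]) [μ.IsAddHaarMeasure] (t : ℚ_[2]ˣ) :
    μ.map (fun u => (t : ℚ_[2]) * u) = ENNReal.ofReal ‖(t : ℚ_[2])‖⁻¹ • μ := by
  ext S hS
  rw [Measure.map_apply (measurable_const_mul _) hS, Measure.smul_apply, smul_eq_mul]
  have : (fun u => (t : ℚ_[2]) * u) ⁻¹' S = t⁻¹ • S := by
    ext u
    rw [Set.mem_smul_set_iff_inv_smul_mem, inv_inv]
    rfl
  rw [this, ← distribHaarChar_mul μ, distribHaarChar_eq_norm, Units.val_inv_eq_inv_val, nnnorm_inv]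
  congr 1
  rw [← coe_nnnorm, ← NNReal.coe_inv, ENNReal.ofReal_coe_nnreal]

lemma integral_comp_mul_left (μ : Measure ℚ_[2]) [μ.IsAddHaarMeasure] {t : ℚ_[2]} (ht : t ≠ 0)
    (f : ℚ_[2] → ℂ) : ∫ u, f (t * u) ∂μ = ((‖t‖⁻¹ : ℝ) : ℂ) * ∫ u, f u ∂μ := by
  have h1 := map_mul_left_eq μ (Units.mk0 t ht)
  have h2 := integral_map_equiv (μ := μ) (Homeomorph.mulLeft₀ t ht).toMeasurableEquiv f
  have h3 : (Homeomorph.mulLeft₀ t ht).toMeasurableEquiv = fun u => t * u := rfl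
  rw [h3] at h2
  rw [← h2]
  rw [Units.val_mk0] at h1
  rw [h1, integral_smul_measure, ENNReal.toReal_ofReal (by positivity), Complex.real_smul]

lemma integrable_comp_mul_left (μ : Measure ℚ_[2]) [μ.IsAddHaarMeasure] {t : ℚ_[2]} (ht : t ≠ 0)
    {f : ℚ_[2] → ℂ} (hf : Integrable f μ) : Integrable (fun u => f (t * u)) μ := by
  have h1 := map_mul_left_eq μ (Units.mk0 t ht)
  refine (integrable_map_equiv (μ := μ) (Homeomorph.mulLeft₀ t ht).toMeasurableEquiv f).1 ?_
  have h3 : (Homeomorph.mulLeft₀ t ht).toMeasurableEquiv = fun u => t * u := rfl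
  rw [h3]
  rw [Units.val_mk0] at h1
  rw [h1]
  exact hf.smul_measure ENNReal.ofReal_ne_top

open scoped Pointwise in
lemma measure_closedBall_zpow {μ : Measure ℚ_[2]} [μ.IsAddHaarMeasure]
    (hμ : μ {u : ℚ_[2] | ‖u‖ ≤ 1} = 1) (n : ℤ) :
    μ.real {u : ℚ_[2] | ‖u‖ ≤ 2 ^ n} = 2 ^ n := by
  have h2 : (2 : ℚ_[2]) ^ (-n) ≠ 0 := zpow_ne_zero _ two_ne_zero
  have e1 : ‖(2 : ℚ_[2]) ^ (-n)‖ = 2 ^ n := by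
    rw [norm_zpow, norm_two, one_div, inv_zpow, zpow_neg, inv_inv]
  have : {u : ℚ_[2] | ‖u‖ ≤ 2 ^ n} = Units.mk0 _ h2 • {u : ℚ_[2] | ‖u‖ ≤ 1} := by
    ext u
    rw [Set.mem_smul_set_iff_inv_smul_mem, Units.smul_def, smul_eq_mul, Set.mem_ofPred_eq,
      Set.mem_ofPred_eq, norm_mul, Units.val_inv_eq_inv_val, Units.val_mk0, norm_inv, e1,
      inv_mul_le_one₀ (by positivity)]
  rw [Measure.real, this, ← distribHaarChar_mul μ, hμ, mul_one, distribHaarChar_eq_norm]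
  simp only [Units.val_mk0, ENNReal.coe_toReal, coe_nnnorm, e1]

lemma measurableSet_ball (r : ℝ) : MeasurableSet {u : ℚ_[2] | ‖u‖ ≤ r} :=
  measurableSet_le measurable_norm measurable_const

lemma measurableSet_shell (r : ℝ) : MeasurableSet {u : ℚ_[2] | ‖u‖ = r} :=
  measurableSet_eq_fun measurable_norm measurable_const

lemma measure_shell {μ : Measure ℚ_[2]} [μ.IsAddHaarMeasure]
    (hμ : μ {u : ℚ_[2] | ‖u‖ ≤ 1} = 1) (n : ℤ) :
    μ.real {u : ℚ_[2] | ‖u‖ = 2 ^ n} = 2 ^ n / 2 := by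
  have hu : {u : ℚ_[2] | ‖u‖ ≤ 2 ^ n} = {u : ℚ_[2] | ‖u‖ ≤ 2 ^ (n - 1)} ∪ {u | ‖u‖ = 2 ^ n} := by
    ext u
    simp only [Set.mem_union, Set.mem_ofPred_eq]
    constructor
    · intro h
      rcases h.lt_or_eq with h | h
      · exact Or.inl (norm_le_of_lt_two_zpow h)
      · exact Or.inr h
    · rintro (h | h)
      · exact h.trans (zpow_le_zpow_right₀ (by norm_num) (by omega))
      · exact h.le
  have hlt : (2 : ℝ) ^ (n - 1) < 2 ^ n := zpow_lt_zpow_right₀ (by norm_num) (by omega)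
  have hd : Disjoint {u : ℚ_[2] | ‖u‖ ≤ 2 ^ (n - 1)} {u | ‖u‖ = 2 ^ n} := by
    rw [Set.disjoint_left]
    intro u h h'
    rw [Set.mem_ofPred_eq] at h h'
    linarith
  have hm := measureReal_union hd (measurableSet_shell _) (μ := μ) (measure_ball_ne_top μ _)
    (measure_shell_ne_top μ _)
  rw [← hu, measure_closedBall_zpow hμ, measure_closedBall_zpow hμ, zpow_sub_one₀ two_ne_zero] at hm
  linarith

lemma integrableOn_torusChar_neg {i : ℂ} (hi : i ^ 2 = -1) (μ : Measure ℚ_[2])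
    [μ.IsAddHaarMeasure] {r : ℝ} (hr : 0 < r) :
    IntegrableOn (fun u => torusChar i (-u)) {u : ℚ_[2] | ‖u‖ = r} μ := by
  have hne : ∀ u ∈ {u : ℚ_[2] | ‖u‖ = r}, u ≠ 0 := by
    rintro u hu rfl
    rw [Set.mem_ofPred_eq, norm_zero] at hu
    exact hr.ne hu
  refine IntegrableOn.of_bound (measure_shell_ne_top μ r).lt_top ?_ 1 ?_
  · refine ContinuousOn.aestronglyMeasurable (fun u hu => ?_) (measurableSet_shell r)
    exact ((continuousAt_torusChar hi (neg_ne_zero.2 (hne u hu))).comp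
      continuous_neg.continuousAt).continuousWithinAt
  · refine (ae_restrict_iff' (measurableSet_shell r)).2 (Filter.Eventually.of_forall fun u hu => ?_)
    rw [norm_torusChar hi (neg_ne_zero.2 (hne u hu))]

/-- The substitution u ↦ 5u preserves the shell and the measure but changes the sign of the
integrand, by (2, 5) = -1. -/
lemma setIntegral_torusChar_neg_odd {i : ℂ} (hi : i ^ 2 = -1) (μ : Measure ℚ_[2])
    [μ.IsAddHaarMeasure] {n : ℤ} (hn : Odd n) :
    ∫ u in {u : ℚ_[2] | ‖u‖ = 2 ^ n}, torusChar i (-u) ∂μ = 0 := by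
  have h5 : ‖(5 : ℚ_[2])‖ = 1 := norm_eq_one_of_norm_sub_one (by
    rw [show (5 : ℚ_[2]) - 1 = 2 * 2 by norm_num, norm_mul, norm_two]; norm_num)
  rw [← integral_indicator (measurableSet_shell _)]
  set f := Set.indicator {u : ℚ_[2] | ‖u‖ = 2 ^ n} (fun u => torusChar i (-u)) with hf
  have h1 := integral_comp_mul_left μ (ne_zero_of_norm_eq_one h5) f
  have h2 : ∀ u, f (5 * u) = -f u := by
    intro u
    by_cases hu : ‖u‖ = 2 ^ n
    · rw [hf, Set.indicator_of_mem (by rw [Set.mem_ofPred_eq, norm_mul, h5, one_mul, hu]),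
        Set.indicator_of_mem (by exact hu), ← mul_neg,
        torusChar_five_mul hi (by rwa [norm_neg]) hn]
    · rw [hf, Set.indicator_of_notMem (by rwa [Set.mem_ofPred_eq, norm_mul, h5, one_mul]),
        Set.indicator_of_notMem (by exact hu), neg_zero]
  simp only [h2, integral_neg, h5] at h1
  simp only [inv_one, Complex.ofReal_one, one_mul] at h1
  linear_combination (-1 / 2 : ℂ) * h1

/-- Pairing u with -u gives the average (1 + i)/2 on a shell of volume 2ⁿ/2. -/
lemma setIntegral_torusChar_neg_even {i : ℂ} (hi : i ^ 2 = -1) {μ : Measure ℚ_[2]}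
    [μ.IsAddHaarMeasure] (hμ : μ {u : ℚ_[2] | ‖u‖ ≤ 1} = 1) {n : ℤ} (hn : Even n) :
    ∫ u in {u : ℚ_[2] | ‖u‖ = 2 ^ n}, torusChar i (-u) ∂μ = (1 + i) / 4 * 2 ^ n := by
  have hint := integrableOn_torusChar_neg hi μ (r := 2 ^ n) (by positivity)
  have h1 : ∫ u in {u : ℚ_[2] | ‖u‖ = 2 ^ n}, torusChar i (-u) ∂μ =
      ∫ u in {u : ℚ_[2] | ‖u‖ = 2 ^ n}, torusChar i u ∂μ := by
    rw [← integral_indicator (measurableSet_shell _), ← integral_indicator (measurableSet_shell _),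
      ← integral_neg_eq_self]
    congr 1
    ext u
    by_cases hu : ‖u‖ = 2 ^ n
    · rw [Set.indicator_of_mem (by rwa [Set.mem_ofPred_eq, norm_neg]),
        Set.indicator_of_mem (by exact hu), neg_neg]
    · rw [Set.indicator_of_notMem (by rwa [Set.mem_ofPred_eq, norm_neg]),
        Set.indicator_of_notMem (by exact hu)]
  have h2 : ∫ u in {u : ℚ_[2] | ‖u‖ = 2 ^ n}, torusChar i u ∂μ =
      ∫ u in {u : ℚ_[2] | ‖u‖ = 2 ^ n}, ((1 + i) - torusChar i (-u)) ∂μ := by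
    refine setIntegral_congr_fun (measurableSet_shell _) fun u hu => ?_
    have := torusChar_add_neg (i := i) hu hn
    linear_combination this
  have hc : IntegrableOn (fun _ : ℚ_[2] => (1 + i)) {u : ℚ_[2] | ‖u‖ = 2 ^ n} μ :=
    integrableOn_const (measure_shell_ne_top μ _)
  rw [integral_sub hc hint, setIntegral_const, measure_shell hμ, Complex.real_smul] at h2
  rw [h2] at h1
  push_cast at h1
  linear_combination (1 / 2 : ℂ) * h1

end Haar

/-! ### Integration over shells -/

lemma cpow_two_zpow (n : ℤ) (s : ℂ) :
    (((2 : ℝ) ^ n : ℝ) : ℂ) ^ s = ((2 : ℂ) ^ s) ^ n := by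
  rw [Complex.cpow_def_of_ne_zero (by exact_mod_cast (by positivity : (2 : ℝ) ^ n ≠ 0)),
    Complex.cpow_def_of_ne_zero two_ne_zero, ← Complex.exp_int_mul, ← Complex.ofReal_log
      (by positivity), Real.log_zpow, show (2 : ℂ) = ((2 : ℝ) : ℂ) by norm_num,
    ← Complex.ofReal_log (by norm_num)]
  push_cast
  ring_nf

lemma compl_ball_eq_iUnion (m : ℤ) :
    {u : ℚ_[2] | ‖u‖ ≤ 2 ^ (m - 1)}ᶜ = ⋃ j : ℕ, {u : ℚ_[2] | ‖u‖ = 2 ^ (m + j)} := by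
  ext u
  simp only [Set.mem_compl_iff, Set.mem_ofPred_eq, Set.mem_iUnion, not_le]
  constructor
  · intro h
    obtain ⟨n, hn⟩ := norm_eq_two_zpow (norm_pos_iff.1 (lt_trans (by positivity) h))
    rw [hn] at h
    have := (zpow_lt_zpow_iff_right₀ (by norm_num)).1 h
    exact ⟨(n - m).toNat, by rw [hn]; congr 1; omega⟩
  · rintro ⟨j, hj⟩
    rw [hj]
    exact zpow_lt_zpow_right₀ (by norm_num) (by omega)

lemma pairwise_disjoint_shell (m : ℤ) :
    Pairwise (Function.onFun Disjoint fun j : ℕ => {u : ℚ_[2] | ‖u‖ = 2 ^ (m + j)}) := by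
  intro j j' hj
  refine Set.disjoint_left.2 fun u h h' => hj ?_
  rw [Set.mem_ofPred_eq] at h h'
  rw [h] at h'
  have := zpow_right_injective₀ (by norm_num : (0 : ℝ) < 2) (by norm_num) h'
  simpa using this

section

variable [MeasurableSpace ℚ_[2]] [BorelSpace ℚ_[2]] {μ : Measure ℚ_[2]} [μ.IsAddHaarMeasure]

/-- The tail starts at the even shell |u| = 2^{2k}. Odd shells contribute 0; the shell 2^{2(k+l)}
contributes D (1 + i)/4 times q^{k+l} with q = 2^{-2s}, since the factor 2ⁿ from the volume turns
2^{-(s+1)n} into 2^{-sn}. -/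
lemma integral_eq_ball_add_tail (hμ : μ {u : ℚ_[2] | ‖u‖ ≤ 1} = 1) {i : ℂ} (hi : i ^ 2 = -1)
    {s : ℂ} (hs : 0 < s.re) {F : ℚ_[2] → ℂ} (hF : Integrable F μ) (k : ℕ) (D : ℂ)
    (hD : ∀ u, (2 : ℝ) ^ (2 * k : ℤ) ≤ ‖u‖ →
      F u = D * torusChar i (-u) * ((‖u‖ : ℝ) : ℂ) ^ (-(s + 1))) :
    ∫ u, F u ∂μ = ∫ u in {u | ‖u‖ ≤ 2 ^ (2 * k - 1 : ℤ)}, F u ∂μ +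
      D * (1 + i) / 4 * ((2 : ℂ) ^ (-2 * s)) ^ k / (1 - (2 : ℂ) ^ (-2 * s)) := by
  rw [← integral_add_compl (measurableSet_ball _) hF, compl_ball_eq_iUnion]
  congr 1
  have h1 := hasSum_integral_iUnion (f := F) (μ := μ)
    (s := fun j : ℕ => {u : ℚ_[2] | ‖u‖ = 2 ^ ((2 * k : ℤ) + j)})
    (fun j => measurableSet_shell _) (pairwise_disjoint_shell _) hF.integrableOn
  refine h1.unique ?_
  have hterm : ∀ j : ℕ, ∫ u in {u : ℚ_[2] | ‖u‖ = 2 ^ ((2 * k : ℤ) + j)}, F u ∂μ =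
      D * ((2 : ℂ) ^ (-(s + 1))) ^ ((2 * k : ℤ) + j) *
        ∫ u in {u : ℚ_[2] | ‖u‖ = 2 ^ ((2 * k : ℤ) + j)}, torusChar i (-u) ∂μ := by
    intro j
    rw [← integral_const_mul]
    refine setIntegral_congr_fun (measurableSet_shell _) fun u hu => ?_
    rw [Set.mem_ofPred_eq] at hu
    rw [hD u (by rw [hu]; exact zpow_le_zpow_right₀ (by norm_num) (by omega)), hu, cpow_two_zpow]
    ring
  have hq : ‖(2 : ℂ) ^ (-2 * s)‖ < 1 := by
    have := Complex.norm_natCast_cpow_of_pos (n := 2) (by norm_num) (-2 * s)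
    rw [Nat.cast_ofNat] at this
    rw [this]
    refine Real.rpow_lt_one_of_one_lt_of_neg (by norm_num) ?_
    simpa using hs
  have h2 : (2 : ℂ) ^ (-(s + 1)) * 2 = (2 : ℂ) ^ (-s) := by
    rw [neg_add, Complex.cpow_add _ _ two_ne_zero, Complex.cpow_neg_one]
    field_simp
  have h3 : ((2 : ℂ) ^ (-s)) ^ 2 = (2 : ℂ) ^ (-2 * s) := by
    rw [← Complex.cpow_nat_mul]; congr 1; push_cast; ring
  have heven : HasSum (fun l : ℕ => ∫ u in {u : ℚ_[2] | ‖u‖ = 2 ^ ((2 * k : ℤ) + (2 * l : ℕ))},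
      F u ∂μ) (D * (1 + i) / 4 * ((2 : ℂ) ^ (-2 * s)) ^ k / (1 - (2 : ℂ) ^ (-2 * s))) := by
    have hg := (hasSum_geometric_of_norm_lt_one hq).mul_left
      (D * (1 + i) / 4 * ((2 : ℂ) ^ (-2 * s)) ^ k)
    rw [← div_eq_mul_inv] at hg
    refine hg.congr_fun fun l => ?_
    have e : (2 * k : ℤ) + (2 * l : ℕ) = ((2 * (k + l) : ℕ) : ℤ) := by push_cast; ring
    rw [hterm, e, setIntegral_torusChar_neg_even hi hμ (by simp), ← h3, ← h2]
    simp only [zpow_natCast]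
    generalize (2 : ℂ) ^ (-(s + 1)) = a
    rw [mul_assoc _ (((a * 2) ^ 2) ^ k), ← pow_add, ← pow_mul, mul_pow]
    ring
  have hodd : HasSum (fun l : ℕ => ∫ u in {u : ℚ_[2] | ‖u‖ = 2 ^ ((2 * k : ℤ) + (2 * l + 1 : ℕ))},
      F u ∂μ) 0 := by
    refine hasSum_zero.congr_fun fun l => ?_
    rw [hterm, setIntegral_torusChar_neg_odd hi μ ⟨k + l, by push_cast; ring⟩, mul_zero]
  have := HasSum.even_add_odd (f := fun j : ℕ =>
    ∫ u in {u : ℚ_[2] | ‖u‖ = 2 ^ ((2 * k : ℤ) + j)}, F u ∂μ) heven hodd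
  rwa [add_zero] at this

/-- The dominating function for absolute convergence. The shell |u| = 2^{j+1} contributes
2^{-σ(j+1)}/2, a convergent geometric series. -/
lemma integrable_max_rpow (hμ : μ {u : ℚ_[2] | ‖u‖ ≤ 1} = 1) {σ : ℝ} (hσ : 0 < σ) :
    Integrable (fun u : ℚ_[2] => max 1 ‖u‖ ^ (-(σ + 1))) μ := by
  have hcont : Continuous (fun u : ℚ_[2] => max 1 ‖u‖ ^ (-(σ + 1))) := by
    refine Continuous.rpow_const (by fun_prop) fun u => Or.inl ?_
    have : (1 : ℝ) ≤ max 1 ‖u‖ := le_max_left _ _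
    positivity
  have hball : IntegrableOn (fun u : ℚ_[2] => max 1 ‖u‖ ^ (-(σ + 1)))
      {u : ℚ_[2] | ‖u‖ ≤ 2 ^ ((1 : ℤ) - 1)} μ := by
    refine IntegrableOn.of_bound (measure_ball_ne_top μ _).lt_top
      hcont.aestronglyMeasurable 1 (Filter.Eventually.of_forall fun u => ?_)
    rw [Real.norm_of_nonneg (by positivity)]
    exact Real.rpow_le_one_of_one_le_of_nonpos (le_max_left _ _) (by linarith)
  have hval : ∀ j : ℕ, ∀ u ∈ {u : ℚ_[2] | ‖u‖ = 2 ^ ((1 : ℤ) + j)},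
      max 1 ‖u‖ ^ (-(σ + 1)) = ((2 : ℝ) ^ (j + 1)) ^ (-(σ + 1)) := by
    intro j u hu
    have e : (2 : ℝ) ^ ((1 : ℤ) + j) = 2 ^ (j + 1) := by
      rw [← zpow_natCast]; congr 1; push_cast; ring
    rw [Set.mem_ofPred_eq, e] at hu
    rw [hu, max_eq_right (one_le_pow₀ (by norm_num))]
  have htail : IntegrableOn (fun u : ℚ_[2] => max 1 ‖u‖ ^ (-(σ + 1)))
      (⋃ j : ℕ, {u : ℚ_[2] | ‖u‖ = 2 ^ ((1 : ℤ) + j)}) μ := by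
    refine integrableOn_iUnion_of_summable_integral_norm (fun j => ?_) ?_
    · refine IntegrableOn.of_bound (measure_shell_ne_top μ _).lt_top
        hcont.aestronglyMeasurable 1 (Filter.Eventually.of_forall fun u => ?_)
      rw [Real.norm_of_nonneg (by positivity)]
      exact Real.rpow_le_one_of_one_le_of_nonpos (le_max_left _ _) (by linarith)
    · have hr : (2 : ℝ) ^ (-σ) < 1 := Real.rpow_lt_one_of_one_lt_of_neg (by norm_num) (by linarith)
      refine ((summable_geometric_of_lt_one (by positivity) hr).mul_left
        ((2 : ℝ) ^ (-σ) / 2)).congr fun j => ?_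
      have e : (2 : ℝ) ^ ((1 : ℤ) + j) = 2 ^ (j + 1) := by
        rw [← zpow_natCast]; congr 1; push_cast; ring
      rw [setIntegral_congr_fun (g := fun _ => ((2 : ℝ) ^ (j + 1)) ^ (-(σ + 1)))
        (measurableSet_shell _) fun u hu => by
          simp only
          rw [Real.norm_of_nonneg (by positivity), hval j u hu]]
      rw [setIntegral_const, measure_shell hμ, smul_eq_mul, e, ← Real.rpow_natCast_mul (by norm_num),
        ← Real.rpow_natCast, ← Real.rpow_natCast, ← Real.rpow_mul (by norm_num)]
      rw [div_mul_eq_mul_div, div_mul_eq_mul_div, ← Real.rpow_add (by norm_num),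
        ← Real.rpow_add (by norm_num)]
      congr 2
      push_cast
      ring
  rw [← compl_ball_eq_iUnion] at htail
  rw [← integrableOn_univ, ← Set.union_compl_self {u : ℚ_[2] | ‖u‖ ≤ 2 ^ ((1 : ℤ) - 1)}]
  exact hball.union htail

end

/-! ### The intertwining operator -/

lemma x_mul_x (u v : ℚ_[2]) : x u * x v = x (u + v) := by
  obtain ⟨x1, x2, x3, x4⟩ := x_mat u
  obtain ⟨y1, y2, y3, y4⟩ := x_mat v
  obtain ⟨z1, z2, z3, z4⟩ := x_mat (u + v)
  refine Mp.ext (mat_ext ?_ ?_ ?_ ?_) ?_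
  · rw [Mp.mul_mat, mul_zero_zero, x1, x2, y1, y3, z1]; ring
  · rw [Mp.mul_mat, mul_zero_one, x1, x2, y2, y4, z2]; ring
  · rw [Mp.mul_mat, mul_one_zero, x3, x4, y1, y3, z3]; ring
  · rw [Mp.mul_mat, mul_one_one, x3, x4, y2, y4, z4]; ring
  · rw [upper_mul_upper_sign x3 y3, x4, y4, hilbert_one_left]; simp [x, sec]

lemma x_mul_h (v : ℚ_[2]) (t : ℚ_[2]ˣ) : x v * h t = h t * x (((t : ℚ_[2])⁻¹) ^ 2 * v) := by
  obtain ⟨x1, x2, x3, x4⟩ := x_mat v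
  obtain ⟨y1, y2, y3, y4⟩ := h_mat t
  obtain ⟨z1, z2, z3, z4⟩ := x_mat (((t : ℚ_[2])⁻¹) ^ 2 * v)
  have ht := t.ne_zero
  refine Mp.ext (mat_ext ?_ ?_ ?_ ?_) ?_
  · rw [Mp.mul_mat, Mp.mul_mat, mul_zero_zero, mul_zero_zero, x1, x2, y1, y2, y3, z1, z3]; ring
  · rw [Mp.mul_mat, Mp.mul_mat, mul_zero_one, mul_zero_one, x1, x2, y1, y2, y4, z2, z4]
    field_simp
    ring
  · rw [Mp.mul_mat, Mp.mul_mat, mul_one_zero, mul_one_zero, x3, x4, y1, y3, y4, z1, z3]; ring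
  · rw [Mp.mul_mat, Mp.mul_mat, mul_one_one, mul_one_one, x3, x4, y2, y3, y4, z2, z4]; ring
  · rw [upper_mul_upper_sign x3 y3, upper_mul_upper_sign y3 z3, x4, z4, y4, hilbert_one_left,
      hilbert_one_right]
    simp [x, h, sec]

lemma xEntry_w : xEntry (w 1).mat = -1 := by
  rw [xEntry_of_ne (by simp [w_mat]), w_mat.2.2.1]

lemma sSign_w : sSign (w 1).mat = 1 := sSign_of_norm_eq_one (by simp [w_mat])

/-- Both products carry the sign (t, -1), so the matrix identity lifts to the cover unchanged. -/
lemma w_mul_h (t : ℚ_[2]ˣ) : w 1 * h t = h t⁻¹ * w 1 := by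
  obtain ⟨w1, w2, w3, w4⟩ := w_mat
  obtain ⟨y1, y2, y3, y4⟩ := h_mat t
  obtain ⟨z1, z2, z3, z4⟩ := h_mat t⁻¹
  rw [Units.val_inv_eq_inv_val] at z1 z4
  rw [inv_inv] at z4
  have ht := t.ne_zero
  have hm : (w 1 * h t).mat = (h t⁻¹ * w 1).mat := by
    refine mat_ext ?_ ?_ ?_ ?_
    · rw [Mp.mul_mat, Mp.mul_mat, mul_zero_zero, mul_zero_zero, w1, w2, w3, y1, y3, z1, z2]; ring
    · rw [Mp.mul_mat, Mp.mul_mat, mul_zero_one, mul_zero_one, w1, w2, w4, y2, y4, z1, z2]; ring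
    · rw [Mp.mul_mat, Mp.mul_mat, mul_one_zero, mul_one_zero, w1, w3, w4, y1, y3, z3, z4]; ring
    · rw [Mp.mul_mat, Mp.mul_mat, mul_one_one, mul_one_one, w2, w3, w4, y2, y4, z3, z4]; ring
  refine Mp.ext hm ?_
  rw [Mp.mul_mat, Mp.mul_mat] at hm
  have hX : xEntry ((w 1).mat * (h t).mat) = -(t : ℚ_[2]) := by
    rw [hm, xEntry_mul_of_left _ z3, z4, xEntry_w]; ring
  have hs : sSign ((w 1).mat * (h t).mat) = 1 := by
    refine if_neg ?_
    rw [mul_one_one, w3, w4, y2, y4]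
    simp
  rw [Mp.mul_sign, Mp.mul_sign, cocycle_eq, cocycle_eq, kubota_of_left _ z3, ← hm, hs, kubota, hX,
    sSign_w, sSign_of_eq y3, sSign_of_eq z3, xEntry_w, xEntry_of_eq y3, y4, z4, neg_mul_neg,
    mul_one, neg_mul, mul_inv_cancel₀ ht, hilbert_comm]
  simp [w, h, sec]

/-- Conjugation of the integrand by the Borel subgroup. -/
lemma w_mul_x_mul_borel (ε : ℤˣ) (u u₀ : ℚ_[2]) (t : ℚ_[2]ˣ) (g : Mp) :
    w 1 * x u * (mu ε * x u₀ * h t * g) =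
      mu ε * x 0 * h t⁻¹ * (w 1 * x (((t : ℚ_[2])⁻¹) ^ 2 * (u + u₀)) * g) := by
  have hx0 : x 0 = 1 := by
    refine Mp.ext (mat_ext ?_ ?_ ?_ ?_) rfl <;> simp [x, sec, Mp.one_mat]
  calc _ = w 1 * (x u * mu ε) * x u₀ * h t * g := by group
    _ = mu ε * w 1 * ((x u * x u₀) * h t) * g := by
      rw [← mu_comm, ← mul_assoc (w 1), ← mu_comm]; group
    _ = mu ε * (w 1 * h t) * x (((t : ℚ_[2])⁻¹) ^ 2 * (u + u₀)) * g := by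
      rw [x_mul_x, x_mul_h]; group
    _ = _ := by rw [w_mul_h, hx0]; group

lemma integrand_borel {i : ℂ} (hi : i ^ 2 = -1) (e d s : ℂ) (ε : ℤˣ) (u u₀ : ℚ_[2]) (t : ℚ_[2]ˣ)
    (g : Mp) :
    integrand (phiFun i e d s) (mu ε * x u₀ * h t * g) u =
      cs ε * torusChar i t * ((‖(t : ℚ_[2])‖ : ℝ) : ℂ) ^ (-(s + 1)) *
        integrand (phiFun i e d s) g (((t : ℚ_[2])⁻¹) ^ 2 * (u + u₀)) := by
  rw [integrand, w_mul_x_mul_borel, phiFun_borel hi, integrand, Units.val_inv_eq_inv_val,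
    torusChar_inv hi t.ne_zero, norm_inv, Complex.ofReal_inv, Complex.inv_cpow _ _ (by
      rw [Complex.arg_ofReal_of_nonneg (norm_nonneg _)]; exact Real.pi_ne_zero.symm),
    Complex.cpow_neg]

lemma integrand_mul_of_mem_K₀ {γ : Mp → ℂ} (hγ : IsGenuineCentralCharacter γ) (e d s : ℂ) (g : Mp)
    {k : Mp} (hk : k ∈ K₀) (u : ℚ_[2]) :
    integrand (phiFun (γ (h (-1))) e d s) (g * k) u =
      charK₀ γ k * integrand (phiFun (γ (h (-1))) e d s) g u := by
  rw [integrand, ← mul_assoc, phiFun_mul_of_mem_K₀ hγ _ _ _ _ hk, integrand]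

/-- The conjugate of `x v` by `k`. -/
lemma conj_x_mat (k : Mp) (v : ℚ_[2]) :
    (k⁻¹ * x v * k).mat 0 0 = 1 + v * (k.mat 1 0 * k.mat 1 1) ∧
    (k⁻¹ * x v * k).mat 0 1 = v * k.mat 1 1 ^ 2 ∧
    (k⁻¹ * x v * k).mat 1 0 = -(v * k.mat 1 0 ^ 2) ∧
    (k⁻¹ * x v * k).mat 1 1 = 1 - v * (k.mat 1 0 * k.mat 1 1) := by
  obtain ⟨x1, x2, x3, x4⟩ := x_mat v
  have hdet := det_eq k.mat
  have i1 : (k.mat⁻¹) 0 0 = k.mat 1 1 := by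
    simp [Matrix.SpecialLinearGroup.coe_inv, Matrix.adjugate_fin_two]
  have i2 : (k.mat⁻¹) 0 1 = -k.mat 0 1 := by
    simp [Matrix.SpecialLinearGroup.coe_inv, Matrix.adjugate_fin_two]
  have i3 : (k.mat⁻¹) 1 0 = -k.mat 1 0 := by
    simp [Matrix.SpecialLinearGroup.coe_inv, Matrix.adjugate_fin_two]
  have i4 : (k.mat⁻¹) 1 1 = k.mat 0 0 := by
    simp [Matrix.SpecialLinearGroup.coe_inv, Matrix.adjugate_fin_two]
  simp only [Mp.mul_mat, Mp.inv_mat, mul_zero_zero, mul_zero_one, mul_one_zero, mul_one_one, x1, x2,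
    x3, x4, i1, i2, i3, i4]
  refine ⟨?_, ?_, ?_, ?_⟩
  · linear_combination hdet
  · ring
  · ring
  · linear_combination hdet

lemma conj_x_mem_K₀ {k : Mp} (hk : k ∈ K) {v : ℚ_[2]} (hv : ‖v‖ ≤ 1)
    (hv' : ‖v * k.mat 1 0 ^ 2‖ ≤ 1 / 4) : k⁻¹ * x v * k ∈ K₀ := by
  obtain ⟨y1, y2, y3, y4⟩ := conj_x_mat k v
  have hprod : ‖v * (k.mat 1 0 * k.mat 1 1)‖ ≤ 1 := by
    rw [norm_mul, norm_mul]
    exact mul_le_one₀ hv (by positivity) (mul_le_one₀ (hk 1 0) (norm_nonneg _) (hk 1 1))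
  refine ⟨?_, by rw [y3, norm_neg]; exact hv'⟩
  rw [K, Set.mem_ofPred_eq, Fin.forall_fin_two, Fin.forall_fin_two, Fin.forall_fin_two, y1, y2, y3,
    y4]
  refine ⟨⟨?_, ?_⟩, ?_, ?_⟩
  · exact (Padic.nonarchimedean _ _).trans (max_le (by simp) hprod)
  · rw [norm_mul, norm_pow]
    exact mul_le_one₀ hv (by positivity) (pow_le_one₀ (norm_nonneg _) (hk 1 1))
  · rw [norm_neg]; linarith
  · rw [sub_eq_add_neg]
    exact (Padic.nonarchimedean _ _).trans (max_le (by simp) (by rwa [norm_neg]))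

lemma continuous_integrand {γ : Mp → ℂ} (hγ : IsGenuineCentralCharacter γ) (e d s : ℂ) {k : Mp}
    (hk : k ∈ K) : Continuous (integrand (phiFun (γ (h (-1))) e d s) k) := by
  have hinv : ∀ u v : ℚ_[2], ‖v‖ ≤ 1 / 16 → integrand (phiFun (γ (h (-1))) e d s) k (u + v) =
      integrand (phiFun (γ (h (-1))) e d s) k u := by
    intro u v hv
    -- The conjugate of x(y) by k lies in K₀, but its character need not be 1. Writing v = 4y
    -- produces a fourth power, on which the character is trivial.
    obtain ⟨y, rfl⟩ : ∃ y, v = y + y + y + y := ⟨v / 4, by ring⟩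
    have h4 : ‖y + y + y + y‖ = 1 / 4 * ‖y‖ := by
      rw [show y + y + y + y = 2 * 2 * y by ring, norm_mul, norm_mul, norm_two]; ring
    rw [h4] at hv
    have hy : ‖y‖ ≤ 1 / 4 := by linarith
    have hmem : k⁻¹ * x y * k ∈ K₀ := by
      refine conj_x_mem_K₀ hk (by linarith) ?_
      rw [norm_mul, norm_pow]
      have := pow_le_one₀ (norm_nonneg _) (hk 1 0) (n := 2)
      nlinarith [norm_nonneg y]
    have hz : w 1 * x (u + (y + y + y + y)) * k = w 1 * x u * k * ((k⁻¹ * x y * k) *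
        (k⁻¹ * x y * k) * (k⁻¹ * x y * k) * (k⁻¹ * x y * k)) := by
      rw [← x_mul_x, ← x_mul_x, ← x_mul_x, ← x_mul_x]; group
    have h2 := mul_mem_K₀ hmem hmem
    have h3 := mul_mem_K₀ h2 hmem
    have h4 := charK₀_pow_four hγ hmem
    rw [integrand, hz, phiFun_mul_of_mem_K₀ hγ _ _ _ _ (mul_mem_K₀ h3 hmem), charK₀_mul hγ h3 hmem,
      charK₀_mul hγ h2 hmem, charK₀_mul hγ hmem hmem, integrand]
    linear_combination phiFun (γ (h (-1))) e d s (w 1 * x u * k) * h4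
  refine continuous_iff_continuousAt.2 fun u => ?_
  refine (continuousAt_const (y := integrand (phiFun (γ (h (-1))) e d s) k u)).congr ?_
  filter_upwards [Metric.closedBall_mem_nhds u (show (0 : ℝ) < 1 / 16 by norm_num)] with v hv
  rw [mem_closedBall_iff_norm] at hv
  rw [← hinv u (v - u) hv]
  congr 1
  ring

lemma norm_phiFun_le {i : ℂ} (hi : i ^ 2 = -1) (e d s : ℂ) (g : Mp) :
    ‖phiFun i e d s g‖ ≤ (‖d‖ + ‖e‖) * max ‖g.mat 1 0‖ ‖g.mat 1 1‖ ^ (-(s.re + 1)) := by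
  have hcpow : ∀ {r : ℝ}, 0 < r → ‖(r : ℂ) ^ (-(s + 1))‖ = r ^ (-(s.re + 1)) := by
    intro r hr
    rw [Complex.norm_cpow_eq_rpow_re_of_pos hr]
    simp
  have hpos : 0 ≤ max ‖g.mat 1 0‖ ‖g.mat 1 1‖ ^ (-(s.re + 1)) := by positivity
  rw [phiFun, norm_mul, norm_twist, one_mul]
  by_cases h1 : ‖g.mat 1 0‖ ≤ ‖g.mat 1 1‖ / 4
  · have hd0 := small_ne_zero h1
    rw [rowFun_small _ _ _ _ h1, norm_mul, norm_mul, norm_mul, norm_cs, norm_torusChar hi hd0,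
      hcpow (norm_pos_iff.2 hd0), mul_one, mul_one]
    rw [max_eq_right (by linarith [norm_nonneg (g.mat 1 1)])] at hpos ⊢
    nlinarith [norm_nonneg e]
  by_cases h2 : ‖g.mat 1 1‖ ≤ ‖g.mat 1 0‖
  · have hc0 := big_ne_zero h2
    rw [rowFun_big _ _ _ _ h2, norm_mul, norm_mul, norm_torusChar hi hc0,
      hcpow (norm_pos_iff.2 hc0), mul_one]
    rw [max_eq_left h2] at hpos ⊢
    nlinarith [norm_nonneg d]
  · rw [rowFun_mid _ _ _ _ h1 h2, norm_zero]
    positivity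

/-- The row (-1, -u) is recovered from its product with k by applying the integral matrix k⁻¹, which
does not increase the maximum norm. -/
lemma max_one_norm_le {k : Mp} (hk : k ∈ K) (u : ℚ_[2]) :
    max 1 ‖u‖ ≤ max ‖(w 1 * x u * k).mat 1 0‖ ‖(w 1 * x u * k).mat 1 1‖ := by
  obtain ⟨y1, y2, y3, y4⟩ := w_mul_x_mat u
  have hdet := det_eq k.mat
  have hc : (w 1 * x u * k).mat 1 0 = -k.mat 0 0 - u * k.mat 1 0 := by
    rw [Mp.mul_mat, mul_one_zero, y3, y4]; ring
  have hd : (w 1 * x u * k).mat 1 1 = -k.mat 0 1 - u * k.mat 1 1 := by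
    rw [Mp.mul_mat, mul_one_one, y3, y4]; ring
  have hle : ∀ a b p q : ℚ_[2], ‖p‖ ≤ 1 → ‖q‖ ≤ 1 → ‖a * p + b * q‖ ≤ max ‖a‖ ‖b‖ := by
    intro a b p q hp hq
    refine (Padic.nonarchimedean _ _).trans (max_le_max ?_ ?_) <;> rw [norm_mul]
    · exact mul_le_of_le_one_right (norm_nonneg _) hp
    · exact mul_le_of_le_one_right (norm_nonneg _) hq
  rw [hc, hd]
  refine max_le ?_ ?_
  · have := hle (-k.mat 0 0 - u * k.mat 1 0) (-k.mat 0 1 - u * k.mat 1 1) (-k.mat 1 1) (k.mat 1 0)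
      (by rw [norm_neg]; exact hk 1 1) (hk 1 0)
    rwa [show (-k.mat 0 0 - u * k.mat 1 0) * -k.mat 1 1 + (-k.mat 0 1 - u * k.mat 1 1) * k.mat 1 0
      = 1 by linear_combination hdet, norm_one] at this
  · have := hle (-k.mat 0 0 - u * k.mat 1 0) (-k.mat 0 1 - u * k.mat 1 1) (k.mat 0 1) (-k.mat 0 0)
      (hk 0 1) (by rw [norm_neg]; exact hk 0 0)
    rwa [show (-k.mat 0 0 - u * k.mat 1 0) * k.mat 0 1 + (-k.mat 0 1 - u * k.mat 1 1) * -k.mat 0 0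
      = u by linear_combination u * hdet] at this

section

variable [MeasurableSpace ℚ_[2]] [BorelSpace ℚ_[2]] {μ : Measure ℚ_[2]} [μ.IsAddHaarMeasure]

lemma integrable_integrand_of_mem_K (hμ : μ {u : ℚ_[2] | ‖u‖ ≤ 1} = 1) {γ : Mp → ℂ}
    (hγ : IsGenuineCentralCharacter γ) (e d : ℂ) {s : ℂ} (hs : 0 < s.re) {k : Mp} (hk : k ∈ K) :
    Integrable (integrand (phiFun (γ (h (-1))) e d s) k) μ := by
  refine ((integrable_max_rpow hμ hs).const_mul (‖d‖ + ‖e‖)).mono'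
    (continuous_integrand hγ e d s hk).aestronglyMeasurable (Filter.Eventually.of_forall fun u => ?_)
  refine (norm_phiFun_le (gamma_h_neg_one_sq hγ) e d s _).trans ?_
  refine mul_le_mul_of_nonneg_left ?_ (by positivity)
  exact Real.rpow_le_rpow_of_nonpos (by positivity) (max_one_norm_le hk u) (by linarith)

lemma integrable_integrand (hμ : μ {u : ℚ_[2] | ‖u‖ ≤ 1} = 1) {γ : Mp → ℂ}
    (hγ : IsGenuineCentralCharacter γ) (e d : ℂ) {s : ℂ} (hs : 0 < s.re) (g : Mp) :
    Integrable (integrand (phiFun (γ (h (-1))) e d s) g) μ := by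
  obtain ⟨ε, u₀, t, k, hk, rfl⟩ := exists_iwasawa g
  have h1 := integrable_integrand_of_mem_K hμ hγ e d hs hk
  have h2 := (integrable_comp_mul_left μ (t := ((t : ℚ_[2])⁻¹) ^ 2)
    (pow_ne_zero _ (inv_ne_zero t.ne_zero)) h1).comp_add_right u₀
  refine (h2.const_mul (cs ε * torusChar (γ (h (-1))) t *
    ((‖(t : ℚ_[2])‖ : ℝ) : ℂ) ^ (-(s + 1)))).congr (Filter.Eventually.of_forall fun u => ?_)
  exact (integrand_borel (gamma_h_neg_one_sq hγ) e d s ε u u₀ t k).symm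

/-- The change of variable u ↦ t⁻²(u + u₀) contributes |t|², and |t|^{-(s+1)+2} = |t|^{-s+1}: this
is how s becomes -s. -/
lemma intertwining_borel (μ : Measure ℚ_[2]) [μ.IsAddHaarMeasure] {i : ℂ} (hi : i ^ 2 = -1)
    (e d s : ℂ) (ε : ℤˣ) (u₀ : ℚ_[2]) (t : ℚ_[2]ˣ) (g : Mp) :
    intertwining μ (phiFun i e d s) (mu ε * x u₀ * h t * g) =
      cs ε * torusChar i t * ((‖(t : ℚ_[2])‖ : ℝ) : ℂ) ^ (-s + 1) *
        intertwining μ (phiFun i e d s) g := by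
  have htn := norm_pos_iff.2 t.ne_zero
  have htn' : ((‖(t : ℚ_[2])‖ : ℝ) : ℂ) ≠ 0 := by exact_mod_cast htn.ne'
  have ht0 := pow_ne_zero 2 (inv_ne_zero t.ne_zero)
  rw [intertwining]
  simp only [integrand_borel hi]
  rw [integral_const_mul, integral_add_right_eq_self (μ := μ) (fun u =>
    integrand (phiFun i e d s) g (((t : ℚ_[2])⁻¹) ^ 2 * u)) u₀, integral_comp_mul_left μ ht0,
    ← mul_assoc, intertwining]
  congr 1
  rw [mul_assoc]
  congr 1
  rw [norm_pow, norm_inv, ← inv_pow, inv_inv, show -s + 1 = -(s + 1) + (2 : ℕ) by push_cast; ring,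
    Complex.cpow_add _ _ htn', Complex.cpow_natCast]
  push_cast
  rfl

end

lemma intertwining_mul_of_mem_K₀ [MeasurableSpace ℚ_[2]] (μ : Measure ℚ_[2]) {γ : Mp → ℂ}
    (hγ : IsGenuineCentralCharacter γ) (e d s : ℂ) (g : Mp) {k : Mp} (hk : k ∈ K₀) :
    intertwining μ (phiFun (γ (h (-1))) e d s) (g * k) =
      charK₀ γ k * intertwining μ (phiFun (γ (h (-1))) e d s) g := by
  rw [intertwining]
  simp only [integrand_mul_of_mem_K₀ hγ e d s g hk]
  rw [integral_const_mul, intertwining]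

lemma lower_two_conj_mem_K₀ : (lower 2)⁻¹ * x 1 * lower 2 ∈ K₀ := by
  refine conj_x_mem_K₀ (lower_mem_K (by rw [norm_two]; norm_num)) (by simp) ?_
  rw [(lower_mat 2).2.2.1, one_mul, norm_pow, norm_two]
  norm_num

/-- The upper left entry of the conjugate is 3, which is -1 modulo 4, so the value is ±i. -/
lemma charK₀_lower_two_conj_ne_one {γ : Mp → ℂ} (hγ : IsGenuineCentralCharacter γ) :
    charK₀ γ ((lower 2)⁻¹ * x 1 * lower 2) ≠ 1 := by
  have hk := lower_two_conj_mem_K₀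
  have ha : ‖((lower 2)⁻¹ * x 1 * lower 2).mat 0 0 + 1‖ ≤ 1 / 4 := by
    obtain ⟨-, -, l3, l4⟩ := lower_mat 2
    rw [(conj_x_mat _ _).1, l3, l4, show (1 : ℚ_[2]) + 1 * (2 * 1) + 1 = 2 * 2 by norm_num, norm_mul,
      norm_two]
    norm_num
  rw [charK₀_of_neg_one hγ hk ha]
  intro h1
  have h2 := congrArg (· ^ 2) h1
  simp only [mul_pow, gamma_h_neg_one_sq hγ, sq (cs _), cs_mul_self] at h2
  norm_num at h2

/-- The element x(1) fixes the value when acting on the left; rewritten as a right factor in K₀ it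
multiplies the value by a number other than 1. -/
lemma intertwining_lower_two [MeasurableSpace ℚ_[2]] [BorelSpace ℚ_[2]] (μ : Measure ℚ_[2])
    [μ.IsAddHaarMeasure] {γ : Mp → ℂ}
    (hγ : IsGenuineCentralCharacter γ) (e d s : ℂ) :
    intertwining μ (phiFun (γ (h (-1))) e d s) (lower 2) = 0 := by
  have h1 := intertwining_borel μ (gamma_h_neg_one_sq hγ) e d s 1 1 1 (lower 2)
  have hh : h 1 = 1 := by
    refine Mp.ext (mat_ext ?_ ?_ ?_ ?_) rfl <;> simp [h, sec, Mp.one_mat]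
  rw [mu_one, one_mul, hh, mul_one, cs_one, Units.val_one, torusChar_one, norm_one,
    Complex.ofReal_one, Complex.one_cpow, one_mul, one_mul, one_mul,
    show x 1 * lower 2 = lower 2 * ((lower 2)⁻¹ * x 1 * lower 2) by group,
    intertwining_mul_of_mem_K₀ μ hγ _ _ _ _ lower_two_conj_mem_K₀] at h1
  have h2 := charK₀_lower_two_conj_ne_one hγ
  have h3 : (charK₀ γ ((lower 2)⁻¹ * x 1 * lower 2) - 1) *
      intertwining μ (phiFun (γ (h (-1))) e d s) (lower 2) = 0 := by linear_combination h1
  exact (mul_eq_zero.1 h3).resolve_left (sub_ne_zero.2 h2)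

/-! ### Values of the intertwining operator -/

lemma norm_two_cpow (s : ℂ) : ‖(2 : ℂ) ^ (-2 * s)‖ = 2 ^ (-2 * s.re) := by
  rw [show (2 : ℂ) = ((2 : ℝ) : ℂ) by norm_num, Complex.norm_cpow_eq_rpow_re_of_pos (by norm_num)]
  simp

lemma two_cpow_ne_one {s : ℂ} (hs : 0 < s.re) : (2 : ℂ) ^ (-2 * s) ≠ 1 := by
  intro h1
  have h2 := norm_two_cpow s
  rw [h1, norm_one] at h2
  exact (Real.rpow_lt_one_of_one_lt_of_neg one_lt_two (by linarith : -2 * s.re < 0)).ne h2.symm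

/-- The shape of the integrand below the tail: it is constant on a ball and zero on the one shell
where the bottom row lies in the coset of `lower 2`. -/
lemma setIntegral_ball_eq [MeasurableSpace ℚ_[2]] [BorelSpace ℚ_[2]] {μ : Measure ℚ_[2]}
    [μ.IsAddHaarMeasure] (hμ : μ {u : ℚ_[2] | ‖u‖ ≤ 1} = 1) {F : ℚ_[2] → ℂ} {n : ℤ} {C : ℂ}
    (h0 : ∀ u, ‖u‖ = 2 ^ n → F u = 0) (h1 : ∀ u, ‖u‖ ≤ 2 ^ (n - 1) → F u = C) :
    ∫ u in {u | ‖u‖ ≤ 2 ^ n}, F u ∂μ = 2 ^ (n - 1) * C := by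
  rw [setIntegral_eq_of_subset_of_forall_sdiff_eq_zero (s := {u : ℚ_[2] | ‖u‖ ≤ 2 ^ (n - 1)})
    (measurableSet_ball _)
    (fun u (hu : ‖u‖ ≤ 2 ^ (n - 1)) => hu.trans (zpow_le_zpow_right₀ one_le_two (by linarith)))
    (fun u hu => h0 u (le_antisymm hu.1 (not_lt.1 fun hlt => hu.2 (norm_le_of_lt_two_zpow hlt)))),
    setIntegral_congr_fun (measurableSet_ball _) h1, setIntegral_const, measure_closedBall_zpow hμ]
  simp

lemma twist_w_mul_x (u : ℚ_[2]) : twist (w 1 * x u) = 1 := by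
  rw [twist, w_mul_x_sign, sSign_of_norm_eq_one (by simp [w_mul_x_mat]), mul_one, cs_one]

lemma phiFun_w_mul_x_mid (i e d s : ℂ) {u : ℚ_[2]} (hu : ‖u‖ = 2) :
    phiFun i e d s (w 1 * x u) = 0 := by
  obtain ⟨y1, y2, y3, y4⟩ := w_mul_x_mat u
  rw [phiFun, rowFun_mid, mul_zero] <;> rw [y3, y4, norm_neg, norm_neg, norm_one, hu] <;> norm_num

lemma phiFun_w_mul_x_small (i e d s : ℂ) {u : ℚ_[2]} (hu : 4 ≤ ‖u‖) :
    phiFun i e d s (w 1 * x u) = d * torusChar i (-u) * ((‖u‖ : ℝ) : ℂ) ^ (-(s + 1)) := by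
  obtain ⟨y1, y2, y3, y4⟩ := w_mul_x_mat u
  rw [phiFun, twist_w_mul_x, rowFun_small _ _ _ _ (by
    rw [y3, y4, norm_neg, norm_neg, norm_one]; linarith), xEntry_of_ne (by rw [y3]; simp), y3, y4,
    neg_mul_neg, one_mul, one_mul, hilbert_neg_self, cs_one, norm_neg]
  ring

lemma w_mul_x_mul_w_mat (u : ℚ_[2]) :
    (w 1 * x u * w 1).mat 1 0 = u ∧ (w 1 * x u * w 1).mat 1 1 = -1 := by
  obtain ⟨y1, y2, y3, y4⟩ := w_mul_x_mat u
  obtain ⟨w1, w2, w3, w4⟩ := w_mat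
  rw [Mp.mul_mat, mul_one_zero, mul_one_one, y3, y4, w1, w2, w3, w4]
  simp

lemma twist_w_mul_x_mul_w (u : ℚ_[2]) :
    twist (w 1 * x u * w 1) = cs (hilbert (-xEntry (w 1 * x u * w 1).mat) (-1)) := by
  have hX : xEntry (w 1 * x u).mat = -1 := by
    rw [xEntry_of_ne (by simp [w_mul_x_mat]), (w_mul_x_mat u).2.2.1]
  rw [twist_mul, twist_w_mul_x, twist_w, kubota, xEntry_w, hX, ← Mp.mul_mat, mul_neg_one,
    hilbert_self (neg_ne_zero.2 (xEntry_ne_zero _)), mul_one, mul_one]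

/-- The bottom row is (u, -1). The sign of `twist` and the symbol in `rowFun` are equal and cancel;
expressed through `xEntry`, this includes u = 0. -/
lemma phiFun_w_mul_x_mul_w_small (i e d s : ℂ) {u : ℚ_[2]} (hu : ‖u‖ ≤ 1 / 4) :
    phiFun i e d s (w 1 * x u * w 1) = d * i := by
  obtain ⟨y3, y4⟩ := w_mul_x_mul_w_mat u
  rw [phiFun, twist_w_mul_x_mul_w, rowFun_small _ _ _ _ (by rw [y3, y4]; simpa using hu), y4,
    norm_neg, norm_one, Complex.ofReal_one, Complex.one_cpow, mul_neg_one, torusChar_neg_one]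
  linear_combination (d * i) * cs_mul_self (hilbert (-xEntry (w 1 * x u * w 1).mat) (-1))

lemma phiFun_w_mul_x_mul_w_mid (i e d s : ℂ) {u : ℚ_[2]} (hu : ‖u‖ = 1 / 2) :
    phiFun i e d s (w 1 * x u * w 1) = 0 := by
  obtain ⟨y3, y4⟩ := w_mul_x_mul_w_mat u
  rw [phiFun, rowFun_mid, mul_zero] <;> rw [y3, y4, norm_neg, norm_one, hu] <;> norm_num

lemma phiFun_w_mul_x_mul_w_big {i : ℂ} (hi : i ^ 2 = -1) (e d s : ℂ) {u : ℚ_[2]} (hu : 1 ≤ ‖u‖) :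
    phiFun i e d s (w 1 * x u * w 1) =
      e * torusChar i (-1) * torusChar i (-u) * ((‖u‖ : ℝ) : ℂ) ^ (-(s + 1)) := by
  obtain ⟨y3, y4⟩ := w_mul_x_mul_w_mat u
  have hu0 : u ≠ 0 := norm_pos_iff.1 (by linarith)
  have h1 := torusChar_mul hi (a := -u) (b := -1) (neg_ne_zero.2 hu0) (by simp)
  rw [neg_mul_neg, mul_one] at h1
  rw [phiFun, twist_w_mul_x_mul_w, rowFun_big _ _ _ _ (by rw [y3, y4]; simpa using hu),
    xEntry_of_ne (by rwa [y3]), y3, h1]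
  linear_combination (e * torusChar i (-1) * torusChar i (-u) * ((‖u‖ : ℝ) : ℂ) ^ (-(s + 1))) *
    cs_mul_self (hilbert (-u) (-1))

section

variable [MeasurableSpace ℚ_[2]] [BorelSpace ℚ_[2]] {μ : Measure ℚ_[2]} [μ.IsAddHaarMeasure]

/-- The row (-1, -u) is in the coset of w(1) for |u| ≤ 1, in that of `lower 2` for |u| = 2, and in
that of 1 from |u| = 4 on, so the tail begins at k = 1. -/
lemma intertwining_one (hμ : μ {u : ℚ_[2] | ‖u‖ ≤ 1} = 1) {γ : Mp → ℂ}
    (hγ : IsGenuineCentralCharacter γ) (e d : ℂ) {s : ℂ} (hs : 0 < s.re) :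
    intertwining μ (phiFun (γ (h (-1))) e d s) 1 =
      e * torusChar (γ (h (-1))) (-1) +
        d * (1 + γ (h (-1))) / 4 * (2 : ℂ) ^ (-2 * s) / (1 - (2 : ℂ) ^ (-2 * s)) := by
  have h1 := integral_eq_ball_add_tail hμ (gamma_h_neg_one_sq hγ) hs
    (integrable_integrand hμ hγ e d hs 1) 1 d (fun u hu => by
      rw [integrand, mul_one]
      exact phiFun_w_mul_x_small _ _ _ _ (by norm_num at hu; exact hu))
  rw [intertwining, h1, setIntegral_ball_eq hμ (C := e * torusChar (γ (h (-1))) (-1)), pow_one]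
  · norm_num
  · intro u hu
    rw [integrand, mul_one, phiFun_w_mul_x_mid]
    norm_num at hu
    exact hu
  · intro u hu
    rw [integrand, mul_one, phiFun_w_mul_x]
    norm_num at hu
    exact hu

/-- The row (u, -1) reverses the roles: 4ℤ₂, of volume 1/4, gives the constant term; |u| = 1/2 gives
zero; the tail begins at |u| = 1, that is, at k = 0. -/
lemma intertwining_w (hμ : μ {u : ℚ_[2] | ‖u‖ ≤ 1} = 1) {γ : Mp → ℂ}
    (hγ : IsGenuineCentralCharacter γ) (e d : ℂ) {s : ℂ} (hs : 0 < s.re) :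
    intertwining μ (phiFun (γ (h (-1))) e d s) (w 1) =
      d * γ (h (-1)) / 4 + e * torusChar (γ (h (-1))) (-1) * (1 + γ (h (-1))) / 4 /
        (1 - (2 : ℂ) ^ (-2 * s)) := by
  have h1 := integral_eq_ball_add_tail hμ (gamma_h_neg_one_sq hγ) hs
    (integrable_integrand hμ hγ e d hs (w 1)) 0 (e * torusChar (γ (h (-1))) (-1)) (fun u hu =>
      phiFun_w_mul_x_mul_w_big (gamma_h_neg_one_sq hγ) _ _ _ (by norm_num at hu; exact hu))
  rw [intertwining, h1, setIntegral_ball_eq hμ (C := d * γ (h (-1)))]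
  · norm_num
    ring
  · exact fun u hu => phiFun_w_mul_x_mul_w_mid _ _ _ _ (by norm_num at hu; rw [hu])
  · exact fun u hu => phiFun_w_mul_x_mul_w_small _ _ _ _ (by norm_num at hu; linarith)

end

/-! ### Comparison on representatives of the double cosets -/

lemma phiFun_w (i e d s : ℂ) : phiFun i e d s (w 1) = e * torusChar i (-1) := by
  have h1 := phiFun_w_mul_x i e d s (u := 0) (by simp)
  have hx0 : x 0 = 1 := by
    refine Mp.ext (mat_ext ?_ ?_ ?_ ?_) rfl <;> simp [x, sec, Mp.one_mat]
  rwa [hx0, mul_one] at h1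

lemma phiFun_lower_two (i e d s : ℂ) : phiFun i e d s (lower 2) = 0 := by
  obtain ⟨l1, l2, l3, l4⟩ := lower_mat 2
  rw [phiFun, rowFun_mid, mul_zero] <;> rw [l3, l4, norm_one, norm_two] <;> norm_num

lemma norm_sub_two_le {v : ℚ_[2]} (h1 : 1 / 4 < ‖v‖) (h2 : ‖v‖ < 1) : ‖v - 2‖ ≤ 1 / 4 := by
  obtain ⟨n, hn⟩ := norm_eq_two_zpow (norm_pos_iff.1 (by linarith : 0 < ‖v‖))
  have hv : ‖v‖ = 1 / 2 := by
    have hlt : n < 0 := by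
      by_contra! hle
      rw [hn] at h2
      exact absurd (one_le_zpow₀ one_le_two hle) (not_le.2 h2)
    have hgt : -2 < n := by
      by_contra! hle
      rw [hn] at h1
      have := zpow_le_zpow_right₀ (one_le_two : (1 : ℝ) ≤ 2) hle
      norm_num at this
      linarith
    rw [hn, show n = -1 by lia]
    norm_num
  obtain ⟨y, rfl⟩ : ∃ y, v = 2 * y := ⟨v / 2, by ring⟩
  rw [norm_mul, norm_two] at hv
  have hy : ‖y‖ = 1 := by linarith
  have hy1 : ‖y - 1‖ ≤ 1 / 2 := by
    rcases norm_sub_one_or_add_one hy with h | h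
    · linarith
    · rw [show y - 1 = (y + 1) + -2 by ring]
      refine (Padic.nonarchimedean _ _).trans (max_le (by linarith) ?_)
      rw [norm_neg, norm_two]
  rw [show 2 * y - 2 = 2 * (y - 1) by ring, norm_mul, norm_two]
  linarith

lemma lower_inv_mul_lower_mem_K₀ {a b : ℚ_[2]} (hab : ‖b - a‖ ≤ 1 / 4) :
    (lower a)⁻¹ * lower b ∈ K₀ := by
  have hm : ((lower a)⁻¹ * lower b).mat = (lower (b - a)).mat := by
    rw [Mp.mul_mat, Mp.inv_mat, inv_mul_eq_iff_eq_mul]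
    obtain ⟨a1, a2, a3, a4⟩ := lower_mat a
    obtain ⟨b1, b2, b3, b4⟩ := lower_mat b
    obtain ⟨c1, c2, c3, c4⟩ := lower_mat (b - a)
    refine mat_ext ?_ ?_ ?_ ?_
    · rw [mul_zero_zero, a1, a2, b1, c1]; ring
    · rw [mul_zero_one, a1, a2, b2, c2]; ring
    · rw [mul_one_zero, a3, a4, b3, c1, c3]; ring
    · rw [mul_one_one, a3, a4, b4, c2, c4]; ring
  have h1 := lower_mem_K₀ hab
  refine ⟨fun i j => ?_, ?_⟩ <;> rw [hm]
  · exact h1.1 i j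
  · exact h1.2

/-- The double cosets of the Borel subgroup and `K₀` are represented by `1`, `w 1` and
`lower 2`. -/
lemma exists_double_coset (g : Mp) :
    ∃ (ε : ℤˣ) (u : ℚ_[2]) (t : ℚ_[2]ˣ) (r k : Mp), (r = 1 ∨ r = w 1 ∨ r = lower 2) ∧ k ∈ K₀ ∧
      g = mu ε * x u * h t * (r * k) := by
  by_cases hbig : ‖g.mat 1 1‖ ≤ ‖g.mat 1 0‖
  · have hc := big_ne_zero hbig
    obtain ⟨ε, e⟩ := exists_eq_w_mul_x hc
    refine ⟨ε, _, _, w 1, _, by simp, x_mem_K₀ ?_, e⟩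
    rw [norm_div]
    exact div_le_one_of_le₀ hbig (norm_nonneg _)
  have hd : g.mat 1 1 ≠ 0 := fun h0 => hbig (by rw [h0, norm_zero]; exact norm_nonneg _)
  have hdn := norm_pos_iff.2 hd
  obtain ⟨ε, e⟩ := exists_eq_lower hd
  by_cases hsmall : ‖g.mat 1 0‖ ≤ ‖g.mat 1 1‖ / 4
  · refine ⟨ε, _, _, 1, _, by simp, lower_mem_K₀ (c := g.mat 1 0 / g.mat 1 1) ?_, by
      rw [one_mul]; exact e⟩
    rw [norm_div, div_le_iff₀ hdn]
    linarith
  · refine ⟨ε, _, _, lower 2, _, by simp, lower_inv_mul_lower_mem_K₀ (a := 2)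
      (b := g.mat 1 0 / g.mat 1 1) (norm_sub_two_le ?_ ?_), by rw [mul_inv_cancel_left]; exact e⟩
    · rw [norm_div, lt_div_iff₀ hdn]; linarith
    · rw [norm_div, div_lt_one hdn]; linarith

/-- Both sides transform alike under the Borel subgroup and under K₀, so agreement on the three
double coset representatives suffices. At `lower 2` both vanish. -/
lemma intertwining_eq_smul [MeasurableSpace ℚ_[2]] [BorelSpace ℚ_[2]] {μ : Measure ℚ_[2]}
    [μ.IsAddHaarMeasure] {γ : Mp → ℂ} (hγ : IsGenuineCentralCharacter γ) {e d s c : ℂ}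
    (h₁ : intertwining μ (phiFun (γ (h (-1))) e d s) 1 = c * d)
    (h₂ : intertwining μ (phiFun (γ (h (-1))) e d s) (w 1) =
      c * (e * torusChar (γ (h (-1))) (-1))) :
    intertwining μ (phiFun (γ (h (-1))) e d s) = c • phiFun (γ (h (-1))) e d (-s) := by
  have hi := gamma_h_neg_one_sq hγ
  funext g
  obtain ⟨ε, u, t, r, k, hr, hk, rfl⟩ := exists_double_coset g
  have hr' : intertwining μ (phiFun (γ (h (-1))) e d s) r =
      c * phiFun (γ (h (-1))) e d (-s) r := by
    rcases hr with rfl | rfl | rfl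
    · rw [h₁, phiFun_one]
    · rw [h₂, phiFun_w]
    · rw [intertwining_lower_two μ hγ, phiFun_lower_two, mul_zero]
  rw [intertwining_borel μ hi, intertwining_mul_of_mem_K₀ μ hγ _ _ _ _ hk, hr', Pi.smul_apply,
    smul_eq_mul, phiFun_borel hi, phiFun_mul_of_mem_K₀ hγ _ _ _ _ hk]
  ring

lemma zeta_div_sqrt_two (γ : Mp → ℂ) :
    (Real.sqrt 2 : ℂ)⁻¹ * zeta γ = (1 + γ (h (-1))) / 2 := by
  have h2 : (Real.sqrt 2 : ℂ) ^ 2 = 2 := by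
    exact_mod_cast Real.sq_sqrt (zero_le_two : (0 : ℝ) ≤ 2)
  have h0 : (Real.sqrt 2 : ℂ) ≠ 0 := fun h => by rw [h] at h2; norm_num at h2
  rw [zeta]
  field_simp
  rw [h2]
  ring

lemma scalarTwo_eq (γ : Mp → ℂ) (s : ℂ) : scalarTwo γ s = (1 + γ (h (-1))) / 2 *
    ((1 - 1 / 2 * (2 : ℂ) ^ (-2 * s)) / (1 - (2 : ℂ) ^ (-2 * s))) := by
  rw [scalarTwo, div_eq_inv_mul, zeta_div_sqrt_two]

lemma scalarNegOne_eq (γ : Mp → ℂ) (s : ℂ) : scalarNegOne γ s = -((1 + γ (h (-1))) / 4) *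
    ((1 - 2 * (2 : ℂ) ^ (-2 * s)) / (1 - (2 : ℂ) ^ (-2 * s))) := by
  rw [scalarNegOne, show zeta γ / (2 * (Real.sqrt 2 : ℂ)) = (Real.sqrt 2 : ℂ)⁻¹ * zeta γ / 2 by
    rw [mul_comm 2, ← div_div, div_eq_inv_mul (zeta γ)], zeta_div_sqrt_two]
  ring

section

variable [MeasurableSpace ℚ_[2]] [BorelSpace ℚ_[2]] {μ : Measure ℚ_[2]} [μ.IsAddHaarMeasure]

lemma intertwining_phiTwo (hμ : μ {u : ℚ_[2] | ‖u‖ ≤ 1} = 1) {γ : Mp → ℂ}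
    (hγ : IsGenuineCentralCharacter γ) {s : ℂ} (hs : 0 < s.re) :
    intertwining μ (phiTwo γ s) = scalarTwo γ s • phiTwo γ (-s) := by
  have hi := gamma_h_neg_one_sq hγ
  have hr := mul_inv_cancel₀ (sub_ne_zero.2 (two_cpow_ne_one hs).symm)
  rw [phiTwo, phiTwo, phi_eq hγ, phi_eq hγ]
  refine intertwining_eq_smul hγ ?_ ?_
  · rw [intertwining_one hμ hγ _ _ hs, bigCoeff_mul hγ, zeta_div_sqrt_two, scalarTwo_eq]
    linear_combination (-(1 + γ (h (-1))) / 2) * hr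
  · rw [intertwining_w hμ hγ _ _ hs, bigCoeff_mul hγ, zeta_div_sqrt_two, scalarTwo_eq]
    -- The relation i² = -1 enters through (1 + i)² = 2i, which matches the constant term d i / 4
    -- with the product of the scalar and (1 + i)/2.
    linear_combination (-(1 + γ (h (-1))) ^ 2 / 8) * hr - 1 / 8 * hi

lemma intertwining_phiNegOne (hμ : μ {u : ℚ_[2] | ‖u‖ ≤ 1} = 1) {γ : Mp → ℂ}
    (hγ : IsGenuineCentralCharacter γ) {s : ℂ} (hs : 0 < s.re) :
    intertwining μ (phiNegOne γ s) = scalarNegOne γ s • phiNegOne γ (-s) := by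
  have hi := gamma_h_neg_one_sq hγ
  have hr := mul_inv_cancel₀ (sub_ne_zero.2 (two_cpow_ne_one hs).symm)
  rw [phiNegOne, phiNegOne, phi_eq hγ, phi_eq hγ]
  refine intertwining_eq_smul hγ ?_ ?_
  · rw [intertwining_one hμ hγ _ _ hs, bigCoeff_mul hγ, zeta_div_sqrt_two, scalarNegOne_eq]
    linear_combination (-(1 + γ (h (-1))) / 2) * hr
  · rw [intertwining_w hμ hγ _ _ hs, bigCoeff_mul hγ, zeta_div_sqrt_two, scalarNegOne_eq]
    linear_combination ((1 + γ (h (-1))) ^ 2 / 4) * hr + 1 / 4 * hi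

end

/-! ### Meromorphic continuation -/

/-- Which case of `rowFun` applies depends on g alone, so in s the function is zero or a constant
times an exponential. -/
lemma differentiable_phiFun (i e d : ℂ) (g : Mp) :
    Differentiable ℂ fun s => phiFun i e d (-s) g := by
  have hpow : ∀ {y : ℚ_[2]}, y ≠ 0 →
      Differentiable ℂ fun s : ℂ => ((‖y‖ : ℝ) : ℂ) ^ (-(-s + 1)) := fun hy =>
    Differentiable.const_cpow (by fun_prop)
      (Or.inl (by exact_mod_cast (norm_pos_iff.2 hy).ne'))
  unfold phiFun
  refine Differentiable.const_mul ?_ _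
  by_cases h1 : ‖g.mat 1 0‖ ≤ ‖g.mat 1 1‖ / 4
  · simp only [rowFun_small _ _ _ _ h1]
    exact (hpow (small_ne_zero h1)).const_mul _
  by_cases h2 : ‖g.mat 1 1‖ ≤ ‖g.mat 1 0‖
  · simp only [rowFun_big _ _ _ _ h2]
    exact (hpow (big_ne_zero h2)).const_mul _
  · simp only [rowFun_mid _ _ _ _ h1 h2]
    exact differentiable_const 0

lemma isContinuation_of_eq [MeasurableSpace ℚ_[2]] (μ : Measure ℚ_[2]) {Φ : ℂ → Mp → ℂ} {g : Mp}
    {N f : ℂ → ℂ} (hN : Differentiable ℂ N) (hf : Differentiable ℂ f)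
    (hΦ : ∀ s : ℂ, 0 < s.re →
      N s / (1 - (2 : ℂ) ^ (-2 * s)) * f s = intertwining μ (Φ s) g) :
    IsContinuation μ Φ g fun s => N s / (1 - (2 : ℂ) ^ (-2 * s)) * f s := by
  have hD : Differentiable ℂ fun s : ℂ => 1 - (2 : ℂ) ^ (-2 * s) :=
    (differentiable_const _).sub (Differentiable.const_cpow (by fun_prop) (Or.inl two_ne_zero))
  refine ⟨fun s _ => ?_, fun s hs => ?_, hΦ⟩
  · exact ((hN.analyticAt s).meromorphicAt.div (hD.analyticAt s).meromorphicAt).mul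
      (hf.analyticAt s).meromorphicAt
  · exact (((hN s).div (hD s) (sub_ne_zero.2 (Ne.symm hs))).mul (hf s)).differentiableWithinAt

end Metaplectic

end

/-! ### The proposition -/

theorem mainTheorem11
    [MeasurableSpace ℚ_[2]] [BorelSpace ℚ_[2]]
    (μ : MeasureTheory.Measure ℚ_[2]) [μ.IsAddHaarMeasure]
    (hμ : μ {u : ℚ_[2] | ‖u‖ ≤ 1} = 1)
    (γ : Metaplectic.Mp → ℂ) (hγ : Metaplectic.IsGenuineCentralCharacter γ) :
    -- the vectors `φ₂` and `φ₋₁` are well defined, for every `s`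
    (∀ s : ℂ, (∃! φ, Metaplectic.IsPhi γ s 1 φ) ∧ Metaplectic.IsPhi γ s 1 (Metaplectic.phiTwo γ s) ∧
      (∃! φ, Metaplectic.IsPhi γ s (-2) φ) ∧
      Metaplectic.IsPhi γ s (-2) (Metaplectic.phiNegOne γ s)) ∧
    -- for `Re s > 0` the integrals converge absolutely and `φ₂`, `φ₋₁` are mapped to multiples
    (∀ s : ℂ, 0 < s.re →
      (∀ g, MeasureTheory.Integrable
        (Metaplectic.integrand (Metaplectic.phiTwo γ s) g) μ) ∧
      Metaplectic.intertwining μ (Metaplectic.phiTwo γ s) =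
        Metaplectic.scalarTwo γ s • Metaplectic.phiTwo γ (-s) ∧
      (∀ g, MeasureTheory.Integrable
        (Metaplectic.integrand (Metaplectic.phiNegOne γ s) g) μ) ∧
      Metaplectic.intertwining μ (Metaplectic.phiNegOne γ s) =
        Metaplectic.scalarNegOne γ s • Metaplectic.phiNegOne γ (-s)) ∧
    -- the same formulas hold for the meromorphic continuation in `s`
    (∀ g, ∃ F : ℂ → ℂ, Metaplectic.IsContinuation μ (Metaplectic.phiTwo γ) g F ∧
      ∀ s : ℂ, (2 : ℂ) ^ (-2 * s) ≠ 1 →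
        F s = Metaplectic.scalarTwo γ s * Metaplectic.phiTwo γ (-s) g) ∧
    (∀ g, ∃ F : ℂ → ℂ, Metaplectic.IsContinuation μ (Metaplectic.phiNegOne γ) g F ∧
      ∀ s : ℂ, (2 : ℂ) ^ (-2 * s) ≠ 1 →
        F s = Metaplectic.scalarNegOne γ s * Metaplectic.phiNegOne γ (-s) g) := by
  have hd : ∀ c : ℂ, Differentiable ℂ fun s : ℂ => 1 - c * (2 : ℂ) ^ (-2 * s) := fun c =>
    (differentiable_const _).sub
      ((Differentiable.const_cpow (by fun_prop) (Or.inl two_ne_zero)).const_mul c)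
  have hφ : ∀ d g, Differentiable ℂ fun s => Metaplectic.phi γ (-s) d g := fun d g => by
    simp only [Metaplectic.phi_eq hγ]
    exact Metaplectic.differentiable_phiFun _ _ _ g
  have hex : ∀ s d, (∃! φ, Metaplectic.IsPhi γ s d φ) ∧
      Metaplectic.IsPhi γ s d (Metaplectic.phi γ s d) := fun s d => by
    have h1 := Metaplectic.isPhi_phiFun hγ s d
    exact ⟨⟨_, h1, fun φ h => h.eq h1⟩, by rwa [Metaplectic.phi_eq hγ]⟩
  have hint : ∀ s d : ℂ, 0 < s.re → ∀ g, MeasureTheory.Integrable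
      (Metaplectic.integrand (Metaplectic.phi γ s d) g) μ := fun s d hs g => by
    rw [Metaplectic.phi_eq hγ]
    exact Metaplectic.integrable_integrand hμ hγ _ _ hs g
  refine ⟨fun s => ⟨(hex s 1).1, (hex s 1).2, hex s (-2)⟩,
    fun s hs => ⟨hint s 1 hs, Metaplectic.intertwining_phiTwo hμ hγ hs, hint s (-2) hs,
      Metaplectic.intertwining_phiNegOne hμ hγ hs⟩,
    -- The continuation is the right-hand side itself, with N the numerator of the scalar; its only
    -- possible poles are the zeros of 1 - 2^{-2s}.
    fun g => ⟨_, Metaplectic.isContinuation_of_eq μ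
      ((hd (1 / 2)).const_mul (Metaplectic.zeta γ / (Real.sqrt 2 : ℂ))) (hφ 1 g) fun s hs => ?_,
      fun s _ => ?_⟩,
    fun g => ⟨_, Metaplectic.isContinuation_of_eq μ
      ((hd 2).const_mul (-(Metaplectic.zeta γ / (2 * (Real.sqrt 2 : ℂ))))) (hφ (-2) g)
      fun s hs => ?_, fun s _ => ?_⟩⟩
  · rw [Metaplectic.intertwining_phiTwo hμ hγ hs, mul_div_assoc]
    rfl
  · rw [mul_div_assoc]
    rfl
  · rw [Metaplectic.intertwining_phiNegOne hμ hγ hs, mul_div_assoc]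
    rfl
  · rw [mul_div_assoc]
    rfl
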